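/- **Setting.** Let $n\ge 2$ and $r_0>0$. Put $f(r)=r^2\bigl(1-(r_0/r)^n\bigr)$ and $\beta=\frac{4\pi}{nr_0}$, let $\theta$ be an angle of period $\beta$, and let $\mathbb T^{n-2}=\mathbb R^{n-2}/\Lambda$ with $\Lambda$ a lattice of full rank and coordinates $x^A$, $A=3,\dots,n$ (a point if $n=2$). On $M=\mathbb R^2\times\mathbb T^{n-2}$ use coordinates $(r,\theta,x^A)$, $r>r_0$, off the core $\{0\}\times\mathbb T^{n-2}$, where $\sqrt{r-r_0}\,\bigl(\cos\frac{2\pi\theta}{\beta},\sin\frac{2\pi\theta}{\beta}\bigr)$ are the Cartesian coordinates of $\mathbb R^2$. The Horowitz–Myers metric with parameter $r_0$ is $$b=\frac{dr^2}{f}+f\,d\theta^2+r^2\delta_{AB}\,dx^Adx^B,$$ with static potential $V=r$ and orthonormal frame $e_1=\sqrt f\,\partial_r$, $e_2=f^{-1/2}\partial_\theta$, $e_A=r^{-1}\partial_A$. A Riemannian metric $g$ on $M$ is said to have the *well-defined mass $m$ relative to $b$* if, for some $r_1>r_0$ and $C>0$, * $C^{-1}b(X,X)\le g(X,X)\le C\,b(X,X)$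 on $\{r>r_1\}$ for all $X$; * $\displaystyle\int_{\{r>r_1\}}\Bigl(\sum_{i,j}|g(e_i,e_j)-\delta_{ij}|^2+\sum_{i,j,k}|e_k(g(e_i,e_j))|^2\Bigr)V\,d\mu_b<\infty$; * the limit $$m=\lim_{\rho\to\infty}\int_{\{r=\rho\}}\Bigl[V g^{pj}g^{i\ell}\bigl(D_pg_{j\ell}-D_\ell g_{jp}\bigr)+\bigl(g^{pj}g^{ki}-g^{ij}g^{kp}\bigr)(g_{jp}-b_{jp})D_kV\Bigr]d\sigma_i$$ exists and is finite, where $D$ is the Levi-Civita connection of $b$ and $d\sigma_r=\sqrt{\det b}\;d\theta\,dx^3\cdots dx^n$ on $\{r=\rho\}$. **Theorem.** Let $g$ be a smooth Riemannian metric on $M=\mathbb R^2\times\mathbb T^{n-2}$ which for $r>r_0$ has the form $$g=e^{2u}dr^2+e^{2v}d\theta^2+g_{AB}\,dx^Adx^B,$$ where $u,v,g_{AB}$ depend only on $(r,\theta)$. Assume that $$u(r,\theta)=u_{\mathrm{HM}}(r):=-\ln r-\tfrac12\ln\bigl(1-(r_0/r)^n\bigr),$$ that $g$ has a well-defined mass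 $m$ relative to the Horowitz–Myers metric $b$ with parameter $r_0$, and that the scalar curvature of $g$ satisfies $R\ge -n(n-1)$. Then $m\ge 0$, and $m=0$ if and only if $g=b$. -/

import Mathlib

open Filter Topology MeasureTheory
open scoped ContDiff Matrix

noncomputable section

/-! ### Riemannian geometry in a coordinate chart

A metric in a chart with coordinates `x^i`, `i : ι`, is a function `g` from coordinate points
`ι → ℝ` to matrices, `g p i j = g_{ij}(p)`. -/

section Chart

variable {ι : Type} [Fintype ι] [DecidableEq ι]

/-- The partial derivative `∂_k F` at `p`. -/
def partialDeriv (k : ι) (F : (ι → ℝ) → ℝ) (p : ι → ℝ) : ℝ :=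
  fderiv ℝ F p (Pi.single k 1)

/-- The Christoffel symbol
`Γ^k_{ij} = (1/2) g^{kl} (∂_i g_{jl} + ∂_j g_{il} - ∂_l g_{ij})`. -/
def christoffel (g : (ι → ℝ) → Matrix ι ι ℝ) (k i j : ι) (p : ι → ℝ) : ℝ :=
  (1 / 2) * ∑ l, (g p)⁻¹ k l *
    (partialDeriv i (fun q => g q j l) p + partialDeriv j (fun q => g q i l) p
      - partialDeriv l (fun q => g q i j) p)

/-- The Ricci tensor
`R_{ij} = ∂_k Γ^k_{ij} - ∂_j Γ^k_{ik} + Γ^k_{kl} Γ^l_{ij} - Γ^k_{jl} Γ^l_{ik}`. -/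
def ricciTensor (g : (ι → ℝ) → Matrix ι ι ℝ) (i j : ι) (p : ι → ℝ) : ℝ :=
  ∑ k, (partialDeriv k (christoffel g k i j) p - partialDeriv j (christoffel g k i k) p
    + ∑ l, (christoffel g k k l p * christoffel g l i j p
      - christoffel g k j l p * christoffel g l i k p))

/-- The scalar curvature `R = g^{ij} R_{ij}`. -/
def scalarCurvature (g : (ι → ℝ) → Matrix ι ι ℝ) (p : ι → ℝ) : ℝ :=
  ∑ i, ∑ j, (g p)⁻¹ i j * ricciTensor g i j p

/-- The covariant derivative `D_k h_{ij}` of a covariant two-tensor `h` with respect to the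
Levi-Civita connection of the metric `b`. -/
def covDeriv (b h : (ι → ℝ) → Matrix ι ι ℝ) (k i j : ι) (p : ι → ℝ) : ℝ :=
  partialDeriv k (fun q => h q i j) p
    - ∑ l, (christoffel b l k i p * h p l j + christoffel b l k j p * h p i l)

/-- The mass vector field of `g` relative to the background `b` with static potential `V`:
`V g^{mj} g^{il} (D_m g_{jl} - D_l g_{jm})
  + (g^{mj} g^{ki} - g^{ij} g^{km}) (g_{jm} - b_{jm}) D_k V`,
where `D` is the Levi-Civita connection of `b`. -/
def massVector (b : (ι → ℝ) → Matrix ι ι ℝ) (V : (ι → ℝ) → ℝ) (g : (ι → ℝ) → Matrix ι ι ℝ)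
    (i : ι) (p : ι → ℝ) : ℝ :=
  (∑ a, ∑ j, ∑ l, V p * (g p)⁻¹ a j * (g p)⁻¹ i l *
      (covDeriv b g a j l p - covDeriv b g l j a p))
    + ∑ k, ∑ a, ∑ j, ((g p)⁻¹ a j * (g p)⁻¹ k i - (g p)⁻¹ i j * (g p)⁻¹ k a) *
      (g p j a - b p j a) * partialDeriv k V p

/-- The pull-back of the metric `G` by the map `Φ`:
`(Φ^* G)_{ij} = ∂_i Φ^a ∂_j Φ^c G_{ac} ∘ Φ`. -/
def pullbackMetric (Φ : (ι → ℝ) → (ι → ℝ)) (G : (ι → ℝ) → Matrix ι ι ℝ) (p : ι → ℝ) :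
    Matrix ι ι ℝ :=
  fun i j => ∑ a, ∑ c,
    partialDeriv i (fun q => Φ q a) p * partialDeriv j (fun q => Φ q c) p * G (Φ p) a c

end Chart

/-! ### The manifold `ℝ² × 𝕋^m`

The dimension is `n = m + 2`. Coordinates are indexed by `Fin 2 ⊕ Fin m`. The polar
coordinates are `r = p (inl 0)`, `θ = p (inl 1)` and `x^A = p (inr A)`. The torus is the
quotient of `ℝ^m` by the lattice spanned by a basis of `ℝ^m`. -/

/-- Index set of the coordinates on `ℝ² × 𝕋^m`. -/
abbrev Idx (m : ℕ) : Type := Fin 2 ⊕ Fin m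

/-- The point with coordinates `(r, θ, x)`. -/
def polarPoint {m : ℕ} (r θ : ℝ) (x : Fin m → ℝ) : Idx m → ℝ :=
  Sum.elim ![r, θ] x

/-- The period `4π / (n r₀)` of the angle `θ`, where `n = m + 2`. -/
def anglePeriod (m : ℕ) (r₀ : ℝ) : ℝ := 4 * Real.pi / ((m + 2 : ℕ) * r₀)

/-- The map from the polar coordinates `(r, θ, x)`, `r > r₀`, to the coordinates `(y¹, y², x)` of
`ℝ² × 𝕋^m` in which the core circle (torus) is `{y = 0}`:
`y = √(r - r₀) (cos (2πθ/β), sin (2πθ/β))`, with `β` the period of `θ`.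
The function `r - r₀` on `ℝ²` is thus `|y|²`, and a smooth function of `r - r₀` is smooth
on `ℝ²`; this is the differentiable structure for which the Horowitz-Myers metric is smooth. -/
def polarMap (m : ℕ) (r₀ : ℝ) (p : Idx m → ℝ) : Idx m → ℝ :=
  Sum.elim
    ![Real.sqrt (p (Sum.inl 0) - r₀) *
        Real.cos (2 * Real.pi * p (Sum.inl 1) / anglePeriod m r₀),
      Real.sqrt (p (Sum.inl 0) - r₀) *
        Real.sin (2 * Real.pi * p (Sum.inl 1) / anglePeriod m r₀)]
    (fun A => p (Sum.inr A))

/-- The tensor field `g`, given in the polar coordinates on `{r > r₀}`, is a smooth Riemannian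
metric on all of `ℝ² × 𝕋^m`, where the torus is `ℝ^m` modulo the lattice spanned by `B`:
it is the expression in polar coordinates of a smooth, symmetric, positive definite, lattice
periodic field `G` in the coordinates `(y, x)`, `y ∈ ℝ²`, `x ∈ ℝ^m`. -/
def IsSmoothMetric {m : ℕ} (r₀ : ℝ) (B : Module.Basis (Fin m) ℝ (Fin m → ℝ))
    (g : (Idx m → ℝ) → Matrix (Idx m) (Idx m) ℝ) : Prop :=
  ∃ G : (Idx m → ℝ) → Matrix (Idx m) (Idx m) ℝ,
    (∀ i j, ContDiff ℝ ∞ (fun y => G y i j)) ∧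
    (∀ y, (G y).PosDef) ∧
    (∀ y A, G (y + Sum.elim (0 : Fin 2 → ℝ) (B A)) = G y) ∧
    ∀ p : Idx m → ℝ, r₀ < p (Sum.inl 0) → g p = pullbackMetric (polarMap m r₀) G p

/-- The tensor field `e^{2u} dr² + e^{2v} dθ² + γ_{AB} dx^A dx^B`, where `u`, `v` and `γ_{AB}`
are functions of `(r, θ)`. -/
def blockMetric {m : ℕ} (u v : ℝ → ℝ → ℝ) (γ : ℝ → ℝ → Matrix (Fin m) (Fin m) ℝ)
    (p : Idx m → ℝ) : Matrix (Idx m) (Idx m) ℝ :=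
  Matrix.fromBlocks
    (Matrix.diagonal ![Real.exp (2 * u (p (Sum.inl 0)) (p (Sum.inl 1))),
      Real.exp (2 * v (p (Sum.inl 0)) (p (Sum.inl 1)))])
    0 0 (γ (p (Sum.inl 0)) (p (Sum.inl 1)))

/-! ### The Horowitz-Myers metric and the mass -/

/-- `f(r) = r² (1 - (r₀/r)^n)`, where `n = m + 2`. -/
def hmF (m : ℕ) (r₀ r : ℝ) : ℝ := r ^ 2 * (1 - (r₀ / r) ^ (m + 2))

/-- `u_HM(r) = - ln r - (1/2) ln (1 - (r₀/r)^n)`. -/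
def uHM (m : ℕ) (r₀ r : ℝ) : ℝ :=
  -Real.log r - (1 / 2) * Real.log (1 - (r₀ / r) ^ (m + 2))

/-- The Horowitz-Myers metric `dr²/f + f dθ² + r² δ_{AB} dx^A dx^B` on `{r > r₀}`. -/
def hmMetric (m : ℕ) (r₀ : ℝ) (p : Idx m → ℝ) : Matrix (Idx m) (Idx m) ℝ :=
  Matrix.diagonal (Sum.elim ![1 / hmF m r₀ (p (Sum.inl 0)), hmF m r₀ (p (Sum.inl 0))]
    (fun _ => p (Sum.inl 0) ^ 2))

/-- The static potential `V = r`. -/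
def hmPotential {m : ℕ} (p : Idx m → ℝ) : ℝ := p (Sum.inl 0)

/-- The Horowitz-Myers orthonormal frame is `e_k = hmFrame k • ∂_k`, that is
`√f ∂_r`, `(1/√f) ∂_θ`, `(1/r) ∂_A`. -/
def hmFrame (m : ℕ) (r₀ : ℝ) (k : Idx m) (p : Idx m → ℝ) : ℝ :=
  Sum.elim ![Real.sqrt (hmF m r₀ (p (Sum.inl 0))), 1 / Real.sqrt (hmF m r₀ (p (Sum.inl 0)))]
    (fun _ => 1 / p (Sum.inl 0)) k

/-- The component `g(e_i, e_j)` in the Horowitz-Myers orthonormal frame. -/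
def frameComponent (m : ℕ) (r₀ : ℝ) (g : (Idx m → ℝ) → Matrix (Idx m) (Idx m) ℝ)
    (i j : Idx m) (p : Idx m → ℝ) : ℝ :=
  hmFrame m r₀ i p * hmFrame m r₀ j p * g p i j

/-- `∑_{i,j} |g(e_i,e_j) - δ_{ij}|² + ∑_{i,j,k} |e_k (g(e_i,e_j))|²`. -/
def frameDeviation (m : ℕ) (r₀ : ℝ) (g : (Idx m → ℝ) → Matrix (Idx m) (Idx m) ℝ)
    (p : Idx m → ℝ) : ℝ :=
  (∑ i, ∑ j, (frameComponent m r₀ g i j p - (1 : Matrix (Idx m) (Idx m) ℝ) i j) ^ 2)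
    + ∑ k, ∑ i, ∑ j,
        (hmFrame m r₀ k p * partialDeriv k (frameComponent m r₀ g i j) p) ^ 2

/-- The integral of the mass vector over the hypersurface `{r = ρ}`, with
`dσ_r = √(det b) dθ dx³ ⋯ dxⁿ`, where `b` is the Horowitz-Myers metric. One period of `θ` and a
fundamental domain of the torus are integrated over. -/
def massFlux {m : ℕ} (r₀ : ℝ) (B : Module.Basis (Fin m) ℝ (Fin m → ℝ))
    (g : (Idx m → ℝ) → Matrix (Idx m) (Idx m) ℝ) (ρ : ℝ) : ℝ :=
  ∫ z in Set.Ico 0 (anglePeriod m r₀) ×ˢ ZSpan.fundamentalDomain B,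
    massVector (hmMetric m r₀) hmPotential g (Sum.inl 0) (polarPoint ρ z.1 z.2) *
      Real.sqrt (hmMetric m r₀ (polarPoint ρ z.1 z.2)).det

/-- `g` is asymptotic to the Horowitz-Myers metric `b` with parameter `r₀` and has a well defined
mass `μ` relative to it: for large `r`, the metrics `g` and `b` are uniformly equivalent, the
deviation of `g` from `b` is square integrable with weight `V` with respect to `b`, and the
integral defining the mass converges to `μ`. -/
structure HasMass {m : ℕ} (r₀ : ℝ) (B : Module.Basis (Fin m) ℝ (Fin m → ℝ))
    (g : (Idx m → ℝ) → Matrix (Idx m) (Idx m) ℝ) (μ : ℝ) : Prop where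
  equivalent : ∃ C > 0, ∃ r₁ > r₀, ∀ p : Idx m → ℝ, r₁ < p (Sum.inl 0) → ∀ X : Idx m → ℝ,
    C⁻¹ * (X ⬝ᵥ (hmMetric m r₀ p *ᵥ X)) ≤ X ⬝ᵥ (g p *ᵥ X) ∧
      X ⬝ᵥ (g p *ᵥ X) ≤ C * (X ⬝ᵥ (hmMetric m r₀ p *ᵥ X))
  squareIntegrable : ∃ r₁ > r₀, IntegrableOn
    (fun z : ℝ × ℝ × (Fin m → ℝ) =>
      frameDeviation m r₀ g (polarPoint z.1 z.2.1 z.2.2) *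
        hmPotential (polarPoint z.1 z.2.1 z.2.2) *
        Real.sqrt (hmMetric m r₀ (polarPoint z.1 z.2.1 z.2.2)).det)
    (Set.Ioi r₁ ×ˢ (Set.Ico 0 (anglePeriod m r₀) ×ˢ ZSpan.fundamentalDomain B))
  tendsto : Tendsto (massFlux r₀ B g) atTop (𝓝 μ)

end

set_option linter.unusedSimpArgs false

noncomputable section

/-! ### Calculus of functions of `(r, θ)` -/

/-! Write n = m + 2, f = `hmF`, c = e^{2v}, P = ½ γ⁻¹∂_r γ, Q = ½ γ⁻¹∂_θ γ, and let β be the period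
of θ. Since g_rr = 1/f, the level sets of r have mean curvature H = √f (∂_r c/(2c) + tr P). The
proof rests on the flux F(r) = ∫ J dθ with J = 2 r^m √c (r H - (n-1)√f), which is `fluxDensity`. The
weight is the background factor r^m rather than √(det γ).

Monotonicity. Inserting the scalar curvature of a block metric gives, up to a θ-derivative, that
-∂_r J is a sum of nonnegative terms (`fluxLoss_eq`). With positive weights these are (tr P - m/r)²,
tr((P - 1/r)²), (R + n(n-1))/f, (tr Q)² and tr(Q²). The traces of squares are nonnegative because P
and Q are self-adjoint with respect to γ (`trHsq_shift`). The θ-derivative integrates to zero over a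
period, so F is nonincreasing (`flux_sub`, `flux_antitone`).

The core. Because g is smooth across the core, its restriction to the ℝ² directions there is fixed
by the prescribed radial coefficient 1/f: a tangential vector is a radial vector for another angle.
Hence c ~ n r₀ (r - r₀), and J tends to n r₀^n for every θ (`exists_coreData`,
`tendsto_fluxDensity`). This is also the constant value of J on the Horowitz-Myers metric.

Infinity. The mass integrand equals n r₀^n - J up to terms quadratic in the deviation of g from b
(`massDensity_sub`). The weighted square integrability makes the angular integrals of these terms
small at arbitrarily large radii, and since the mass flux converges this suffices
(`frequently_massFlux`). Therefore the mass is vol(torus) · (β n r₀^n - lim F), which is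
nonnegative.

Rigidity. If the mass vanishes, F is constant and every nonnegative term vanishes. Then ∂_r γ =
(2/r) γ and ∂_θ γ = 0, so γ = r² k with k a constant matrix, and the decay condition forces k to be
the identity. Now J = n r₀^n at every point, which is a first-order linear equation for √c also
solved by √f. Its homogeneous solutions are the multiples of r, and vanishing at the core excludes
them, so c = f (`angle_eq_hmF`, `eq_background`). -/

/-- The directional derivative of `h` at `z` along `w`. -/
def dirDeriv (w : ℝ × ℝ) (h : ℝ × ℝ → ℝ) (z : ℝ × ℝ) : ℝ := fderiv ℝ h z w

/-- The projection of a coordinate point to `(r, θ)`. -/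
def radAng (m : ℕ) : (Idx m → ℝ) →L[ℝ] ℝ × ℝ :=
  (ContinuousLinearMap.proj (Sum.inl 0)).prod (ContinuousLinearMap.proj (Sum.inl 1))

theorem radAng_apply {m : ℕ} (p : Idx m → ℝ) :
    radAng m p = (p (Sum.inl 0), p (Sum.inl 1)) := rfl

theorem partialDeriv_comp_radAng {m : ℕ} (k : Idx m) {h : ℝ × ℝ → ℝ} {p : Idx m → ℝ}
    (hh : DifferentiableAt ℝ h (radAng m p)) :
    partialDeriv k (fun q => h (radAng m q)) p =
      dirDeriv (radAng m (Pi.single k 1)) h (radAng m p) := by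
  have := (hh.hasFDerivAt.comp p (radAng m).hasFDerivAt).fderiv
  simp only [partialDeriv, dirDeriv]
  rw [show (fun q => h (radAng m q)) = h ∘ radAng m from rfl, this]
  rfl

theorem dirDeriv_zero (h : ℝ × ℝ → ℝ) (z : ℝ × ℝ) : dirDeriv 0 h z = 0 := by
  simp [dirDeriv]

section calculus
variable {w z : ℝ × ℝ} {h k : ℝ × ℝ → ℝ}

theorem dirDeriv_const (c : ℝ) : dirDeriv w (fun _ => c) z = 0 := by
  simp [dirDeriv]

theorem dirDeriv_neg : dirDeriv w (fun y => -h y) z = -dirDeriv w h z := by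
  simp [dirDeriv]

theorem dirDeriv_mul (hh : DifferentiableAt ℝ h z) (hk : DifferentiableAt ℝ k z) :
    dirDeriv w (fun y => h y * k y) z = dirDeriv w h z * k z + h z * dirDeriv w k z := by
  simp [dirDeriv, fderiv_fun_mul hh hk]; ring

theorem dirDeriv_const_mul (c : ℝ) (hh : DifferentiableAt ℝ h z) :
    dirDeriv w (fun y => c * h y) z = c * dirDeriv w h z := by
  simp [dirDeriv, fderiv_const_mul hh]

theorem dirDeriv_comp {F : ℝ → ℝ} {F' : ℝ} (hF : HasDerivAt F F' (h z))
    (hh : DifferentiableAt ℝ h z) :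
    dirDeriv w (fun y => F (h y)) z = F' * dirDeriv w h z := by
  simp only [dirDeriv]
  rw [show (fun y => F (h y)) = F ∘ h from rfl, (hF.comp_hasFDerivAt z hh.hasFDerivAt).fderiv]
  simp

theorem dirDeriv_inv (hh : DifferentiableAt ℝ h z) (h0 : h z ≠ 0) :
    dirDeriv w (fun y => (h y)⁻¹) z = -dirDeriv w h z / h z ^ 2 := by
  rw [dirDeriv_comp (hasDerivAt_inv h0) hh]; field_simp

theorem differentiableAt_div_two_mul (hk : DifferentiableAt ℝ k z) (hh : DifferentiableAt ℝ h z)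
    (h0 : h z ≠ 0) : DifferentiableAt ℝ (fun y => k y / (2 * h y)) z := by
  have h2 : DifferentiableAt ℝ (fun y => 2 * h y) z := hh.const_mul 2
  simp only [div_eq_mul_inv]
  exact hk.mul (DifferentiableAt.fun_inv h2 (mul_ne_zero two_ne_zero h0))

theorem dirDeriv_div_two_mul (hk : DifferentiableAt ℝ k z) (hh : DifferentiableAt ℝ h z)
    (h0 : h z ≠ 0) : dirDeriv w (fun y => k y / (2 * h y)) z =
      dirDeriv w k z / (2 * h z) - k z * dirDeriv w h z / (2 * h z ^ 2) := by
  have h2 : DifferentiableAt ℝ (fun y => 2 * h y) z := hh.const_mul 2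
  have h3 : DifferentiableAt ℝ (fun y => (2 * h y)⁻¹) z :=
    DifferentiableAt.fun_inv h2 (mul_ne_zero two_ne_zero h0)
  simp only [div_eq_mul_inv]
  rw [dirDeriv_mul hk h3, dirDeriv_inv h2 (mul_ne_zero two_ne_zero h0), dirDeriv_const_mul 2 hh]
  field_simp
  ring

theorem dirDeriv_sum {ι : Type} (s : Finset ι) {H : ι → ℝ × ℝ → ℝ}
    (hH : ∀ i ∈ s, DifferentiableAt ℝ (H i) z) :
    dirDeriv w (fun y => ∑ i ∈ s, H i y) z = ∑ i ∈ s, dirDeriv w (H i) z := by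
  simp only [dirDeriv]
  rw [fderiv_fun_sum hH]
  simp

theorem dirDeriv_congr (e : h =ᶠ[𝓝 z] k) : dirDeriv w h z = dirDeriv w k z := by
  simp only [dirDeriv, e.fderiv_eq]

theorem ContDiffOn.dirDeriv {U : Set (ℝ × ℝ)} (hh : ContDiffOn ℝ ∞ h U) (hU : IsOpen U) :
    ContDiffOn ℝ ∞ (dirDeriv w h) U :=
  (hh.fderiv_of_isOpen hU (by simp)).clm_apply contDiffOn_const

theorem ContDiffOn.differentiableAt_of_isOpen {U : Set (ℝ × ℝ)} (hh : ContDiffOn ℝ ∞ h U)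
    (hU : IsOpen U) (hz : z ∈ U) : DifferentiableAt ℝ h z :=
  (hh.differentiableOn (by simp)).differentiableAt (hU.mem_nhds hz)

end calculus

/-! ### Smoothness of determinants and inverse matrices. -/

theorem contDiffOn_det {ι : Type} [Fintype ι] [DecidableEq ι] {U : Set (ℝ × ℝ)}
    {M : ℝ × ℝ → Matrix ι ι ℝ} (hM : ∀ i j, ContDiffOn ℝ ∞ (fun z => M z i j) U) :
    ContDiffOn ℝ ∞ (fun z => (M z).det) U := by
  simp only [Matrix.det_apply']
  exact ContDiffOn.sum fun σ _ => contDiffOn_const.mul (contDiffOn_prod fun i _ => hM _ _)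

/-- By Cramer's rule each entry is a determinant of entries of M, or of constants in one row,
divided by det M. -/
theorem contDiffOn_inv_apply {ι : Type} [Fintype ι] [DecidableEq ι] {U : Set (ℝ × ℝ)}
    {M : ℝ × ℝ → Matrix ι ι ℝ} (hM : ∀ i j, ContDiffOn ℝ ∞ (fun z => M z i j) U)
    (h0 : ∀ z ∈ U, (M z).det ≠ 0) (i j : ι) :
    ContDiffOn ℝ ∞ (fun z => (M z)⁻¹ i j) U := by
  have : (fun z => (M z)⁻¹ i j) = fun z => (M z).det⁻¹ * (M z).adjugate i j := by
    ext z; simp [Matrix.inv_def]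
  rw [this]
  refine ((contDiffOn_det hM).inv h0).mul ?_
  simp only [Matrix.adjugate_apply]
  refine contDiffOn_det fun k l => ?_
  by_cases hk : k = j
  · subst hk; simpa using contDiffOn_const
  · simpa [Matrix.updateRow_apply, hk] using hM k l

/-! ### Scalar curvature of block metrics -/

/-- The metric `a dr² + c dθ² + γ_{AB} dx^A dx^B` with coefficients depending on `(r, θ)`. -/
def blockG {m : ℕ} (a c : ℝ × ℝ → ℝ) (γ : ℝ × ℝ → Matrix (Fin m) (Fin m) ℝ)
    (p : Idx m → ℝ) : Matrix (Idx m) (Idx m) ℝ :=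
  Matrix.fromBlocks (Matrix.diagonal ![a (radAng m p), c (radAng m p)]) 0 0 (γ (radAng m p))

/-- The data of a smooth, non-degenerate block metric over an open set of `(r, θ)`, whose `dr²`
coefficient does not depend on `θ`. -/
structure IsBlockData {m : ℕ} (U : Set (ℝ × ℝ)) (a c : ℝ × ℝ → ℝ)
    (γ : ℝ × ℝ → Matrix (Fin m) (Fin m) ℝ) : Prop where
  isOpen : IsOpen U
  smooth_a : ContDiffOn ℝ ∞ a U
  smooth_c : ContDiffOn ℝ ∞ c U
  smooth_γ : ∀ i j, ContDiffOn ℝ ∞ (fun z => γ z i j) U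
  pos_a : ∀ z ∈ U, 0 < a z
  pos_c : ∀ z ∈ U, 0 < c z
  symm_γ : ∀ z i j, z ∈ U → γ z i j = γ z j i
  det_γ : ∀ z ∈ U, (γ z).det ≠ 0
  angle_a : ∀ z ∈ U, dirDeriv (0, 1) a z = 0

/-- The endomorphism `(1/2) γ⁻¹ ∂_w γ`. -/
def halfLog {m : ℕ} (w : ℝ × ℝ) (γ : ℝ × ℝ → Matrix (Fin m) (Fin m) ℝ) (z : ℝ × ℝ) :
    Matrix (Fin m) (Fin m) ℝ :=
  fun i j => ∑ k, (γ z)⁻¹ i k * (dirDeriv w (fun y => γ y k j) z / 2)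

namespace IsBlockData
variable {m : ℕ} {U : Set (ℝ × ℝ)} {a c : ℝ × ℝ → ℝ} {γ : ℝ × ℝ → Matrix (Fin m) (Fin m) ℝ}

theorem inv_blockG (D : IsBlockData U a c γ) {p : Idx m → ℝ} (hp : radAng m p ∈ U) :
    (blockG a c γ p)⁻¹ = Matrix.fromBlocks
      (Matrix.diagonal ![(a (radAng m p))⁻¹, (c (radAng m p))⁻¹]) 0 0 (γ (radAng m p))⁻¹ := by
  apply Matrix.inv_eq_right_inv
  have h1 := (D.pos_a _ hp).ne'
  have h2 := (D.pos_c _ hp).ne'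
  rw [blockG, Matrix.fromBlocks_multiply, Matrix.mul_nonsing_inv _ (D.det_γ _ hp).isUnit]
  simp only [Matrix.mul_zero, Matrix.zero_mul, add_zero, zero_add, Matrix.diagonal_mul_diagonal]
  rw [← Matrix.fromBlocks_one]
  congr 1
  rw [← Matrix.diagonal_one]
  congr 1
  ext i
  fin_cases i <;> simp [h1, h2]

theorem dA (D : IsBlockData U a c γ) {z} (hz : z ∈ U) : DifferentiableAt ℝ a z :=
  D.smooth_a.differentiableAt_of_isOpen D.isOpen hz
theorem dC (D : IsBlockData U a c γ) {z} (hz : z ∈ U) : DifferentiableAt ℝ c z :=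
  D.smooth_c.differentiableAt_of_isOpen D.isOpen hz
theorem dγ (D : IsBlockData U a c γ) {z} (hz : z ∈ U) (i j) :
    DifferentiableAt ℝ (fun y => γ y i j) z :=
  (D.smooth_γ i j).differentiableAt_of_isOpen D.isOpen hz

theorem smooth_halfLog (D : IsBlockData U a c γ) (w : ℝ × ℝ) (i j : Fin m) :
    ContDiffOn ℝ ∞ (fun z => halfLog w γ z i j) U := by
  unfold halfLog
  exact ContDiffOn.sum fun k _ => (contDiffOn_inv_apply D.smooth_γ D.det_γ i k).mul
    (((D.smooth_γ k j).dirDeriv D.isOpen).div_const 2)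

theorem dH (D : IsBlockData U a c γ) {z} (hz : z ∈ U) (w) (i j) :
    DifferentiableAt ℝ (fun y => halfLog w γ y i j) z :=
  (D.smooth_halfLog w i j).differentiableAt_of_isOpen D.isOpen hz

theorem partialDeriv_rr (D : IsBlockData U a c γ) {p : Idx m → ℝ} (hp : radAng m p ∈ U)
    (k : Idx m) : partialDeriv k (fun q => blockG a c γ q (Sum.inl 0) (Sum.inl 0)) p =
      dirDeriv (radAng m (Pi.single k 1)) a (radAng m p) :=
  partialDeriv_comp_radAng k (D.dA hp)

theorem partialDeriv_tt (D : IsBlockData U a c γ) {p : Idx m → ℝ} (hp : radAng m p ∈ U)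
    (k : Idx m) : partialDeriv k (fun q => blockG a c γ q (Sum.inl 1) (Sum.inl 1)) p =
      dirDeriv (radAng m (Pi.single k 1)) c (radAng m p) :=
  partialDeriv_comp_radAng k (D.dC hp)

theorem partialDeriv_AB (D : IsBlockData U a c γ) {p : Idx m → ℝ} (hp : radAng m p ∈ U)
    (k : Idx m) (i j : Fin m) :
    partialDeriv k (fun q => blockG a c γ q (Sum.inr i) (Sum.inr j)) p =
      dirDeriv (radAng m (Pi.single k 1)) (fun y => γ y i j) (radAng m p) :=
  partialDeriv_comp_radAng k (D.dγ hp i j)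

end IsBlockData

section zeros
variable {m : ℕ} {a c : ℝ × ℝ → ℝ} {γ : ℝ × ℝ → Matrix (Fin m) (Fin m) ℝ} {p : Idx m → ℝ}

theorem partialDeriv_zero {ι : Type} [DecidableEq ι] [Fintype ι] (k : ι) (p : ι → ℝ) :
    partialDeriv k (fun _ => (0 : ℝ)) p = 0 := by
  simp [partialDeriv]

theorem partialDeriv_rt (k : Idx m) :
    partialDeriv k (fun q => blockG a c γ q (Sum.inl 0) (Sum.inl 1)) p = 0 :=
  partialDeriv_zero k p

theorem partialDeriv_tr (k : Idx m) :
    partialDeriv k (fun q => blockG a c γ q (Sum.inl 1) (Sum.inl 0)) p = 0 :=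
  partialDeriv_zero k p

theorem partialDeriv_lr (k : Idx m) (i : Fin 2) (j : Fin m) :
    partialDeriv k (fun q => blockG a c γ q (Sum.inl i) (Sum.inr j)) p = 0 :=
  partialDeriv_zero k p

theorem partialDeriv_rl (k : Idx m) (i : Fin 2) (j : Fin m) :
    partialDeriv k (fun q => blockG a c γ q (Sum.inr j) (Sum.inl i)) p = 0 :=
  partialDeriv_zero k p

theorem radAng_single_zero : radAng m (Pi.single (Sum.inl 0) 1) = (1, 0) := by
  simp [radAng_apply]

theorem radAng_single_one : radAng m (Pi.single (Sum.inl 1) 1) = (0, 1) := by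
  simp [radAng_apply]

theorem radAng_single_inr (A : Fin m) : radAng m (Pi.single (Sum.inr A) 1) = 0 := by
  simp [radAng_apply]

end zeros

namespace IsBlockData
variable {m : ℕ} {U : Set (ℝ × ℝ)} {a c : ℝ × ℝ → ℝ} {γ : ℝ × ℝ → Matrix (Fin m) (Fin m) ℝ}

section christoffel
variable {p : Idx m → ℝ}

/-- All components of the Christoffel symbols of a block metric. -/
theorem christoffel_blockG (D : IsBlockData U a c γ) (hp : radAng m p ∈ U) :
    (∀ i j, christoffel (blockG a c γ) (Sum.inl 0) (Sum.inl i) (Sum.inl j) p =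
      ![![dirDeriv (1, 0) a (radAng m p) / (2 * a (radAng m p)), 0],
        ![0, -(dirDeriv (1, 0) c (radAng m p) / (2 * a (radAng m p)))]] i j) ∧
    (∀ i j, christoffel (blockG a c γ) (Sum.inl 1) (Sum.inl i) (Sum.inl j) p =
      ![![0, dirDeriv (1, 0) c (radAng m p) / (2 * c (radAng m p))],
        ![dirDeriv (1, 0) c (radAng m p) / (2 * c (radAng m p)),
          dirDeriv (0, 1) c (radAng m p) / (2 * c (radAng m p))]] i j) ∧
    (∀ A i j, christoffel (blockG a c γ) (Sum.inr A) (Sum.inl i) (Sum.inl j) p = 0) ∧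
    (∀ k i B, christoffel (blockG a c γ) (Sum.inl k) (Sum.inl i) (Sum.inr B) p = 0) ∧
    (∀ k i B, christoffel (blockG a c γ) (Sum.inl k) (Sum.inr B) (Sum.inl i) p = 0) ∧
    (∀ A B, christoffel (blockG a c γ) (Sum.inr A) (Sum.inl 0) (Sum.inr B) p =
      halfLog (1, 0) γ (radAng m p) A B) ∧
    (∀ A B, christoffel (blockG a c γ) (Sum.inr A) (Sum.inr B) (Sum.inl 0) p =
      halfLog (1, 0) γ (radAng m p) A B) ∧
    (∀ A B, christoffel (blockG a c γ) (Sum.inr A) (Sum.inl 1) (Sum.inr B) p =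
      halfLog (0, 1) γ (radAng m p) A B) ∧
    (∀ A B, christoffel (blockG a c γ) (Sum.inr A) (Sum.inr B) (Sum.inl 1) p =
      halfLog (0, 1) γ (radAng m p) A B) ∧
    (∀ A B, christoffel (blockG a c γ) (Sum.inl 0) (Sum.inr A) (Sum.inr B) p =
      -(dirDeriv (1, 0) (fun y => γ y A B) (radAng m p) / (2 * a (radAng m p)))) ∧
    (∀ A B, christoffel (blockG a c γ) (Sum.inl 1) (Sum.inr A) (Sum.inr B) p =
      -(dirDeriv (0, 1) (fun y => γ y A B) (radAng m p) / (2 * c (radAng m p)))) ∧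
    (∀ A B C, christoffel (blockG a c γ) (Sum.inr A) (Sum.inr B) (Sum.inr C) p = 0) := by
  have ha := (D.pos_a _ hp).ne'
  have hc := (D.pos_c _ hp).ne'
  have hs : ∀ w A B, dirDeriv w (fun y => γ y A B) (radAng m p) =
      dirDeriv w (fun y => γ y B A) (radAng m p) := fun w A B => dirDeriv_congr <| by
    filter_upwards [D.isOpen.mem_nhds hp] with y hy using D.symm_γ y A B hy
  -- The absence of θ-dependence in the dr² coefficient kills Γ^r_{rθ} and Γ^θ_{rr}.
  have e := D.angle_a _ hp
  refine ⟨?_, ?_, ?_, ?_, ?_, ?_, ?_, ?_, ?_, ?_, ?_, ?_⟩ <;> intros <;>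
    simp only [christoffel, D.inv_blockG hp, Fintype.sum_sum_type, Fin.sum_univ_two,
      Matrix.fromBlocks_apply₁₁, Matrix.fromBlocks_apply₁₂, Matrix.fromBlocks_apply₂₁,
      Matrix.fromBlocks_apply₂₂, Matrix.zero_apply, zero_mul, Finset.sum_const_zero, add_zero]
  · rename_i i j
    fin_cases i <;> fin_cases j <;> simp [D.partialDeriv_rr hp, D.partialDeriv_tt hp,
      partialDeriv_rt, partialDeriv_tr, radAng_single_zero, radAng_single_one, e] <;> field_simp
  · rename_i i j
    fin_cases i <;> fin_cases j <;> simp [D.partialDeriv_rr hp, D.partialDeriv_tt hp,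
      partialDeriv_rt, partialDeriv_tr, radAng_single_zero, radAng_single_one, e] <;> field_simp
  · rename_i A i j
    fin_cases i <;> fin_cases j <;> simp [partialDeriv_rt, partialDeriv_tr, partialDeriv_lr,
      D.partialDeriv_rr hp, D.partialDeriv_tt hp, radAng_single_inr, dirDeriv_zero]
  · rename_i k i B
    fin_cases k <;> fin_cases i <;> simp [partialDeriv_rt, partialDeriv_tr, partialDeriv_lr,
      partialDeriv_rl, D.partialDeriv_rr hp, D.partialDeriv_tt hp, radAng_single_inr,
      dirDeriv_zero]
  · rename_i k i B
    fin_cases k <;> fin_cases i <;> simp [partialDeriv_rt, partialDeriv_tr, partialDeriv_lr,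
      partialDeriv_rl, D.partialDeriv_rr hp, D.partialDeriv_tt hp, radAng_single_inr,
      dirDeriv_zero]
  · rename_i A B
    simp only [partialDeriv_lr, D.partialDeriv_AB hp, halfLog, Finset.mul_sum, zero_add,
      radAng_single_zero, radAng_single_inr, dirDeriv_zero, add_zero, sub_zero]
    refine Finset.sum_congr rfl fun k _ => ?_
    rw [hs _ B k]; ring
  · rename_i A B
    simp only [partialDeriv_lr, partialDeriv_rl, D.partialDeriv_AB hp, halfLog, Finset.mul_sum,
      zero_add, radAng_single_zero, radAng_single_inr, dirDeriv_zero, add_zero, sub_zero]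
    refine Finset.sum_congr rfl fun k _ => ?_
    rw [hs _ B k]; ring
  · rename_i A B
    simp only [partialDeriv_lr, D.partialDeriv_AB hp, halfLog, Finset.mul_sum, zero_add,
      radAng_single_one, radAng_single_inr, dirDeriv_zero, add_zero, sub_zero]
    refine Finset.sum_congr rfl fun k _ => ?_
    rw [hs _ B k]; ring
  · rename_i A B
    simp only [partialDeriv_lr, partialDeriv_rl, D.partialDeriv_AB hp, halfLog, Finset.mul_sum,
      zero_add, radAng_single_one, radAng_single_inr, dirDeriv_zero, add_zero, sub_zero]
    refine Finset.sum_congr rfl fun k _ => ?_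
    rw [hs _ B k]; ring
  · rename_i A B
    simp [partialDeriv_rl, D.partialDeriv_AB hp, radAng_single_zero]
    field_simp
  · rename_i A B
    simp [partialDeriv_rl, D.partialDeriv_AB hp, radAng_single_one]
    field_simp
  · rename_i A B C
    simp [partialDeriv_rl, D.partialDeriv_AB hp, radAng_single_inr, dirDeriv_zero]

end christoffel

/-! ### Identities for the logarithmic derivative of the torus metric. -/

section halfLog
variable {w z : ℝ × ℝ}

theorem dirDeriv_γ_eq (D : IsBlockData U a c γ) (hz : z ∈ U) (i j : Fin m) :
    dirDeriv w (fun y => γ y i j) z = 2 * ∑ k, γ z i k * halfLog w γ z k j := by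
  have h := congrFun (congrFun (Matrix.mul_nonsing_inv_cancel_left (A := γ z)
    (Matrix.of fun i j => dirDeriv w (fun y => γ y i j) z / 2) (D.det_γ z hz).isUnit) i) j
  simp only [Matrix.mul_apply, Matrix.of_apply] at h
  simp only [halfLog]
  linarith

theorem sum_inv_dirDeriv (i j : Fin m) :
    ∑ k, (γ z)⁻¹ i k * dirDeriv w (fun y => γ y k j) z = 2 * halfLog w γ z i j := by
  simp only [halfLog, Finset.mul_sum]
  exact Finset.sum_congr rfl fun k _ => by ring

theorem sum_inv_mul (D : IsBlockData U a c γ) (hz : z ∈ U) (i j : Fin m) :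
    ∑ k, (γ z)⁻¹ i k * γ z k j = if i = j then 1 else 0 := by
  rw [← Matrix.mul_apply, Matrix.nonsing_inv_mul _ (D.det_γ z hz).isUnit, Matrix.one_apply]

/-- The trace of the second derivative of `γ` in terms of `halfLog`. -/
theorem sum_inv_dirDeriv_dirDeriv (D : IsBlockData U a c γ) (hz : z ∈ U) :
    ∑ i, ∑ j, (γ z)⁻¹ i j * dirDeriv w (dirDeriv w (fun y => γ y j i)) z =
      2 * dirDeriv w (fun y => ∑ i, halfLog w γ y i i) z +
        4 * ∑ i, ∑ j, halfLog w γ z i j * halfLog w γ z j i := by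
  -- The relation ∂γ = 2 γ H with H = ½ γ⁻¹∂γ holds on an open set, so it can be differentiated once
  -- more.
  have e : ∀ k i, dirDeriv w (dirDeriv w (fun y => γ y k i)) z =
      2 * ∑ l, (dirDeriv w (fun y => γ y k l) z * halfLog w γ z l i +
        γ z k l * dirDeriv w (fun y => halfLog w γ y l i) z) := by
    intro k i
    rw [dirDeriv_congr (k := fun y => 2 * ∑ l, γ y k l * halfLog w γ y l i),
      dirDeriv_const_mul, dirDeriv_sum]
    · congr 1
      refine Finset.sum_congr rfl fun l _ => dirDeriv_mul (D.dγ hz _ _) (D.dH hz _ _ _)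
    · exact fun l _ => (D.dγ hz _ _).mul (D.dH hz _ _ _)
    · exact DifferentiableAt.fun_sum fun l _ => (D.dγ hz _ _).mul (D.dH hz _ _ _)
    · filter_upwards [D.isOpen.mem_nhds hz] with y hy using D.dirDeriv_γ_eq hy k i
  rw [dirDeriv_sum _ fun i _ => D.dH hz _ _ _, Finset.mul_sum, Finset.mul_sum,
    ← Finset.sum_add_distrib]
  refine Finset.sum_congr rfl fun i _ => ?_
  have e1 : ∑ j, (γ z)⁻¹ i j * dirDeriv w (dirDeriv w (fun y => γ y j i)) z =
      ∑ l, 2 * ((∑ j, (γ z)⁻¹ i j * dirDeriv w (fun y => γ y j l) z) * halfLog w γ z l i +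
        (∑ j, (γ z)⁻¹ i j * γ z j l) * dirDeriv w (fun y => halfLog w γ y l i) z) := by
    simp only [e, Finset.mul_sum, Finset.sum_mul, ← Finset.sum_add_distrib]
    rw [Finset.sum_comm]
    refine Finset.sum_congr rfl fun l _ => Finset.sum_congr rfl fun j _ => by ring
  rw [e1]
  simp only [sum_inv_dirDeriv, D.sum_inv_mul hz, mul_add, Finset.sum_add_distrib, ite_mul,
    one_mul, zero_mul, mul_ite, mul_zero, Finset.sum_ite_eq, Finset.mem_univ, if_true,
    Finset.mul_sum]
  rw [add_comm]
  congr 1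
  exact Finset.sum_congr rfl fun j _ => by ring

end halfLog

/-- The formula for a Christoffel symbol is valid on an open set of points, which is what allows
differentiating it as a function of (r, θ) alone. -/
theorem partialDeriv_christoffel (D : IsBlockData U a c γ) {p : Idx m → ℝ} (hp : radAng m p ∈ U)
    {k i j l : Idx m} {h : ℝ × ℝ → ℝ}
    (hh : ∀ q, radAng m q ∈ U → christoffel (blockG a c γ) k i j q = h (radAng m q))
    (hd : DifferentiableAt ℝ h (radAng m p)) :
    partialDeriv l (christoffel (blockG a c γ) k i j) p =
      dirDeriv (radAng m (Pi.single l 1)) h (radAng m p) := by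
  rw [← partialDeriv_comp_radAng l hd]
  unfold partialDeriv
  rw [Filter.EventuallyEq.fderiv_eq]
  filter_upwards [(D.isOpen.preimage (radAng m).continuous).mem_nhds hp] with q hq using hh q hq

/-! ### Ricci and scalar curvature of a block metric. -/

section ricci
variable {p : Idx m → ℝ}

/-- The inverse metric is block diagonal with diagonal (r, θ) block, so the rr, θθ and torus
components of Ricci are all that the scalar curvature needs. -/
theorem ricci_rr (D : IsBlockData U a c γ) (hp : radAng m p ∈ U) :
    ricciTensor (blockG a c γ) (Sum.inl 0) (Sum.inl 0) p =
      -dirDeriv (1, 0) (fun z => dirDeriv (1, 0) c z / (2 * c z)) (radAng m p)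
      - dirDeriv (1, 0) (fun z => ∑ i, halfLog (1, 0) γ z i i) (radAng m p)
      + dirDeriv (1, 0) a (radAng m p) / (2 * a (radAng m p)) *
        (dirDeriv (1, 0) c (radAng m p) / (2 * c (radAng m p)) +
          ∑ i, halfLog (1, 0) γ (radAng m p) i i)
      - (dirDeriv (1, 0) c (radAng m p) / (2 * c (radAng m p))) ^ 2
      - ∑ i, ∑ j, halfLog (1, 0) γ (radAng m p) i j * halfLog (1, 0) γ (radAng m p) j i := by
  obtain ⟨h1, h2, h3, h4, h5, h6, h7, h8, h9, h10, h11, h12⟩ := D.christoffel_blockG hp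
  have hc2 : DifferentiableAt ℝ (fun z => dirDeriv (1, 0) c z / (2 * c z)) (radAng m p) :=
    differentiableAt_div_two_mul
      ((D.smooth_c.dirDeriv D.isOpen).differentiableAt_of_isOpen D.isOpen hp) (D.dC hp)
      (D.pos_c _ hp).ne'
  have d1 : partialDeriv (Sum.inl 1) (christoffel (blockG a c γ) (Sum.inl 1) (Sum.inl 0)
      (Sum.inl 0)) p = 0 := by
    rw [D.partialDeriv_christoffel hp (h := fun _ => 0)
      (fun q hq => by simpa using (D.christoffel_blockG hq).2.1 0 0) (by fun_prop), dirDeriv_const]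
  have d2 : partialDeriv (Sum.inl 0) (christoffel (blockG a c γ) (Sum.inl 1) (Sum.inl 0)
      (Sum.inl 1)) p = dirDeriv (1, 0) (fun z => dirDeriv (1, 0) c z / (2 * c z)) (radAng m p) := by
    rw [D.partialDeriv_christoffel hp (h := fun z => dirDeriv (1, 0) c z / (2 * c z))
      (fun q hq => by simpa using (D.christoffel_blockG hq).2.1 0 1) hc2, radAng_single_zero]
  have d3 : ∀ A, partialDeriv (Sum.inr A) (christoffel (blockG a c γ) (Sum.inr A) (Sum.inl 0)
      (Sum.inl 0)) p = 0 := fun A => by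
    rw [D.partialDeriv_christoffel hp (h := fun _ => 0)
      (fun q hq => by simpa using (D.christoffel_blockG hq).2.2.1 A 0 0) (by fun_prop),
      dirDeriv_const]
  have d4 : ∀ A, partialDeriv (Sum.inl 0) (christoffel (blockG a c γ) (Sum.inr A) (Sum.inl 0)
      (Sum.inr A)) p = dirDeriv (1, 0) (fun z => halfLog (1, 0) γ z A A) (radAng m p) := fun A => by
    rw [D.partialDeriv_christoffel hp (h := fun z => halfLog (1, 0) γ z A A)
      (fun q hq => by simpa using (D.christoffel_blockG hq).2.2.2.2.2.1 A A) (D.dH hp _ _ _),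
      radAng_single_zero]
  rw [dirDeriv_sum _ fun i _ => D.dH hp _ _ _]
  simp only [ricciTensor, Fintype.sum_sum_type, Fin.sum_univ_two, h1, h2, h3, h4, h5, h6, h7, h8,
    h9, h10, h11, h12, d1, d2, d3, d4]
  simp only [Matrix.cons_val_zero, Matrix.cons_val_one, mul_zero, zero_mul, sub_zero, add_zero,
    zero_add, zero_sub, Finset.sum_add_distrib, Finset.sum_sub_distrib, Finset.sum_const_zero,
    Finset.sum_neg_distrib, ← Finset.sum_mul]
  ring

theorem ricci_tt (D : IsBlockData U a c γ) (hp : radAng m p ∈ U) :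
    ricciTensor (blockG a c γ) (Sum.inl 1) (Sum.inl 1) p =
      -dirDeriv (1, 0) (fun z => dirDeriv (1, 0) c z / (2 * a z)) (radAng m p)
      - dirDeriv (0, 1) (fun z => ∑ i, halfLog (0, 1) γ z i i) (radAng m p)
      - (dirDeriv (1, 0) a (radAng m p) / (2 * a (radAng m p)) -
        dirDeriv (1, 0) c (radAng m p) / (2 * c (radAng m p)) +
          ∑ i, halfLog (1, 0) γ (radAng m p) i i) *
        (dirDeriv (1, 0) c (radAng m p) / (2 * a (radAng m p)))
      + dirDeriv (0, 1) c (radAng m p) / (2 * c (radAng m p)) *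
          ∑ i, halfLog (0, 1) γ (radAng m p) i i
      - ∑ i, ∑ j, halfLog (0, 1) γ (radAng m p) i j * halfLog (0, 1) γ (radAng m p) j i := by
  obtain ⟨h1, h2, h3, h4, h5, h6, h7, h8, h9, h10, h11, h12⟩ := D.christoffel_blockG hp
  have hc2 : DifferentiableAt ℝ (fun z => dirDeriv (1, 0) c z / (2 * a z)) (radAng m p) :=
    differentiableAt_div_two_mul
      ((D.smooth_c.dirDeriv D.isOpen).differentiableAt_of_isOpen D.isOpen hp) (D.dA hp)
      (D.pos_a _ hp).ne'
  have d1 : partialDeriv (Sum.inl 0) (christoffel (blockG a c γ) (Sum.inl 0) (Sum.inl 1)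
      (Sum.inl 1)) p = -dirDeriv (1, 0) (fun z => dirDeriv (1, 0) c z / (2 * a z)) (radAng m p) := by
    rw [D.partialDeriv_christoffel hp (h := fun z => -(dirDeriv (1, 0) c z / (2 * a z)))
      (fun q hq => by simpa using (D.christoffel_blockG hq).1 1 1) hc2.neg, radAng_single_zero,
      dirDeriv_neg]
  have d2 : partialDeriv (Sum.inl 1) (christoffel (blockG a c γ) (Sum.inl 0) (Sum.inl 1)
      (Sum.inl 0)) p = 0 := by
    rw [D.partialDeriv_christoffel hp (h := fun _ => 0)
      (fun q hq => by simpa using (D.christoffel_blockG hq).1 1 0) (by fun_prop), dirDeriv_const]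
  have d3 : ∀ A, partialDeriv (Sum.inr A) (christoffel (blockG a c γ) (Sum.inr A) (Sum.inl 1)
      (Sum.inl 1)) p = 0 := fun A => by
    rw [D.partialDeriv_christoffel hp (h := fun _ => 0)
      (fun q hq => by simpa using (D.christoffel_blockG hq).2.2.1 A 1 1) (by fun_prop),
      dirDeriv_const]
  have d4 : ∀ A, partialDeriv (Sum.inl 1) (christoffel (blockG a c γ) (Sum.inr A) (Sum.inl 1)
      (Sum.inr A)) p = dirDeriv (0, 1) (fun z => halfLog (0, 1) γ z A A) (radAng m p) := fun A => by
    rw [D.partialDeriv_christoffel hp (h := fun z => halfLog (0, 1) γ z A A)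
      (fun q hq => by simpa using (D.christoffel_blockG hq).2.2.2.2.2.2.2.1 A A) (D.dH hp _ _ _),
      radAng_single_one]
  rw [dirDeriv_sum _ fun i _ => D.dH hp _ _ _]
  simp only [ricciTensor, Fintype.sum_sum_type, Fin.sum_univ_two, h1, h2, h3, h4, h5, h6, h7, h8,
    h9, h10, h11, h12, d1, d2, d3, d4]
  simp only [Matrix.cons_val_zero, Matrix.cons_val_one, mul_zero, zero_mul, sub_zero, add_zero,
    zero_add, zero_sub, Finset.sum_add_distrib, Finset.sum_sub_distrib, Finset.sum_const_zero,
    Finset.sum_neg_distrib, ← Finset.sum_mul]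
  ring

theorem ricci_AB (D : IsBlockData U a c γ) (hp : radAng m p ∈ U) (A B : Fin m) :
    ricciTensor (blockG a c γ) (Sum.inr A) (Sum.inr B) p =
      -dirDeriv (1, 0) (fun z => dirDeriv (1, 0) (fun y => γ y A B) z / (2 * a z)) (radAng m p)
      - dirDeriv (0, 1) (fun z => dirDeriv (0, 1) (fun y => γ y A B) z / (2 * c z)) (radAng m p)
      - (dirDeriv (1, 0) a (radAng m p) / (2 * a (radAng m p)) +
        dirDeriv (1, 0) c (radAng m p) / (2 * c (radAng m p)) +
          ∑ i, halfLog (1, 0) γ (radAng m p) i i) *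
        (dirDeriv (1, 0) (fun y => γ y A B) (radAng m p) / (2 * a (radAng m p)))
      - (dirDeriv (0, 1) c (radAng m p) / (2 * c (radAng m p)) +
          ∑ i, halfLog (0, 1) γ (radAng m p) i i) *
        (dirDeriv (0, 1) (fun y => γ y A B) (radAng m p) / (2 * c (radAng m p)))
      + ∑ C, (dirDeriv (1, 0) (fun y => γ y B C) (radAng m p) / (2 * a (radAng m p)) *
            halfLog (1, 0) γ (radAng m p) C A +
          halfLog (1, 0) γ (radAng m p) C B *
            (dirDeriv (1, 0) (fun y => γ y A C) (radAng m p) / (2 * a (radAng m p))))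
      + ∑ C, (dirDeriv (0, 1) (fun y => γ y B C) (radAng m p) / (2 * c (radAng m p)) *
            halfLog (0, 1) γ (radAng m p) C A +
          halfLog (0, 1) γ (radAng m p) C B *
            (dirDeriv (0, 1) (fun y => γ y A C) (radAng m p) / (2 * c (radAng m p)))) := by
  obtain ⟨h1, h2, h3, h4, h5, h6, h7, h8, h9, h10, h11, h12⟩ := D.christoffel_blockG hp
  have d1 : partialDeriv (Sum.inl 0) (christoffel (blockG a c γ) (Sum.inl 0) (Sum.inr A)
      (Sum.inr B)) p =
      -dirDeriv (1, 0) (fun z => dirDeriv (1, 0) (fun y => γ y A B) z / (2 * a z)) (radAng m p) := by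
    rw [D.partialDeriv_christoffel hp
      (h := fun z => -(dirDeriv (1, 0) (fun y => γ y A B) z / (2 * a z)))
      (fun q hq => (D.christoffel_blockG hq).2.2.2.2.2.2.2.2.2.1 A B) ?_, radAng_single_zero,
      dirDeriv_neg]
    exact (differentiableAt_div_two_mul
      (((D.smooth_γ A B).dirDeriv D.isOpen).differentiableAt_of_isOpen D.isOpen hp) (D.dA hp)
      (D.pos_a _ hp).ne').neg
  have d2 : partialDeriv (Sum.inl 1) (christoffel (blockG a c γ) (Sum.inl 1) (Sum.inr A)
      (Sum.inr B)) p =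
      -dirDeriv (0, 1) (fun z => dirDeriv (0, 1) (fun y => γ y A B) z / (2 * c z)) (radAng m p) := by
    rw [D.partialDeriv_christoffel hp
      (h := fun z => -(dirDeriv (0, 1) (fun y => γ y A B) z / (2 * c z)))
      (fun q hq => (D.christoffel_blockG hq).2.2.2.2.2.2.2.2.2.2.1 A B) ?_, radAng_single_one,
      dirDeriv_neg]
    exact (differentiableAt_div_two_mul
      (((D.smooth_γ A B).dirDeriv D.isOpen).differentiableAt_of_isOpen D.isOpen hp) (D.dC hp)
      (D.pos_c _ hp).ne').neg
  have d3 : ∀ k, partialDeriv (Sum.inr B) (christoffel (blockG a c γ) (Sum.inl k) (Sum.inr A)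
      (Sum.inl k)) p = 0 := fun k => by
    rw [D.partialDeriv_christoffel hp (h := fun _ => 0)
      (fun q hq => by simpa using (D.christoffel_blockG hq).2.2.2.2.1 k k A) (by fun_prop),
      dirDeriv_const]
  have d4 : ∀ C E F G, partialDeriv (Sum.inr G) (christoffel (blockG a c γ) (Sum.inr C) (Sum.inr E)
      (Sum.inr F)) p = 0 := fun C E F G => by
    rw [D.partialDeriv_christoffel hp (h := fun _ => 0)
      (fun q hq => by simpa using (D.christoffel_blockG hq).2.2.2.2.2.2.2.2.2.2.2 C E F)
      (by fun_prop), dirDeriv_const]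
  simp only [ricciTensor, Fintype.sum_sum_type, Fin.sum_univ_two, h1, h2, h3, h4, h5, h6, h7, h8,
    h9, h10, h11, h12, d1, d2, d3, d4]
  simp only [Matrix.cons_val_zero, Matrix.cons_val_one, mul_zero, zero_mul, sub_zero, add_zero,
    zero_add, zero_sub, Finset.sum_add_distrib, Finset.sum_sub_distrib, Finset.sum_const_zero,
    Finset.sum_neg_distrib, ← Finset.sum_mul]
  simp only [neg_mul, mul_neg, Finset.sum_neg_distrib]
  ring

/-- The scalar curvature of a block metric. -/
theorem scalarCurvature_blockG (D : IsBlockData U a c γ) (hp : radAng m p ∈ U) {α l ε t s : ℝ}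
    (hα : α = dirDeriv (1, 0) a (radAng m p) / (2 * a (radAng m p)))
    (hl : l = dirDeriv (1, 0) c (radAng m p) / (2 * c (radAng m p)))
    (hε : ε = dirDeriv (0, 1) c (radAng m p) / (2 * c (radAng m p)))
    (ht : t = ∑ i, halfLog (1, 0) γ (radAng m p) i i)
    (hs : s = ∑ i, halfLog (0, 1) γ (radAng m p) i i) :
    scalarCurvature (blockG a c γ) p =
      (-2 * dirDeriv (1, 0) (fun z => dirDeriv (1, 0) c z / (2 * c z)) (radAng m p)
        - 2 * l ^ 2 - 2 * dirDeriv (1, 0) (fun z => ∑ i, halfLog (1, 0) γ z i i) (radAng m p)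
        - t ^ 2 - (∑ i, ∑ j, halfLog (1, 0) γ (radAng m p) i j * halfLog (1, 0) γ (radAng m p) j i)
        + 2 * α * (l + t) - 2 * l * t) / a (radAng m p) +
      (-2 * dirDeriv (0, 1) (fun z => ∑ i, halfLog (0, 1) γ z i i) (radAng m p)
        + 2 * ε * s - s ^ 2
        - ∑ i, ∑ j, halfLog (0, 1) γ (radAng m p) i j * halfLog (0, 1) γ (radAng m p) j i) /
        c (radAng m p) := by
  have ha := (D.pos_a _ hp).ne'
  have hc := (D.pos_c _ hp).ne'
  set z := radAng m p with hz
  have hac : dirDeriv (0, 1) a z = 0 := D.angle_a z hp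
  have dcc := (D.smooth_c.dirDeriv (w := (1, 0)) D.isOpen).differentiableAt_of_isOpen D.isOpen hp
  -- the derivative of the `rθθ` Christoffel symbol
  have e1 : dirDeriv (1, 0) (fun z => dirDeriv (1, 0) c z / (2 * a z)) z =
      c z / a z * dirDeriv (1, 0) (fun z => dirDeriv (1, 0) c z / (2 * c z)) z +
        2 * c z * l ^ 2 / a z - 2 * α * c z * l / a z := by
    rw [dirDeriv_div_two_mul dcc (D.dA hp) ha, dirDeriv_div_two_mul dcc (D.dC hp) hc, hα, hl]
    field_simp
    ring
  have e2 : ∀ A B, dirDeriv (1, 0) (fun z => dirDeriv (1, 0) (fun y => γ y A B) z / (2 * a z)) z =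
      (2 * a z)⁻¹ * dirDeriv (1, 0) (dirDeriv (1, 0) (fun y => γ y A B)) z -
        α / a z * dirDeriv (1, 0) (fun y => γ y A B) z := by
    intro A B
    rw [dirDeriv_div_two_mul
      (((D.smooth_γ A B).dirDeriv D.isOpen).differentiableAt_of_isOpen D.isOpen hp) (D.dA hp) ha, hα]
    field_simp
  have e3 : ∀ A B, dirDeriv (0, 1) (fun z => dirDeriv (0, 1) (fun y => γ y A B) z / (2 * c z)) z =
      (2 * c z)⁻¹ * dirDeriv (0, 1) (dirDeriv (0, 1) (fun y => γ y A B)) z -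
        ε / c z * dirDeriv (0, 1) (fun y => γ y A B) z := by
    intro A B
    rw [dirDeriv_div_two_mul
      (((D.smooth_γ A B).dirDeriv D.isOpen).differentiableAt_of_isOpen D.isOpen hp) (D.dC hp) hc, hε]
    field_simp
  have hsym : ∀ w A B, dirDeriv w (fun y => γ y A B) z = dirDeriv w (fun y => γ y B A) z :=
    fun w A B => dirDeriv_congr <| by
      filter_upwards [D.isOpen.mem_nhds hp] with y hy using D.symm_γ y A B hy
  have hsym2 : ∀ w A B, dirDeriv w (dirDeriv w (fun y => γ y A B)) z =
      dirDeriv w (dirDeriv w (fun y => γ y B A)) z := fun w A B => dirDeriv_congr <| by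
    filter_upwards [D.isOpen.mem_nhds hp] with y hy
    exact dirDeriv_congr (by
      filter_upwards [D.isOpen.mem_nhds hy] with x hx using D.symm_γ x A B hx)
  have hPs : ∀ A B, (γ z)⁻¹ A B = (γ z)⁻¹ B A := fun A B => by
    have : (γ z)ᵀ = γ z := Matrix.ext fun i j => D.symm_γ z j i hp
    conv_rhs => rw [← this, ← Matrix.transpose_nonsing_inv, Matrix.transpose_apply]
  -- traces
  have t1 : ∀ w, ∑ A, ∑ B, (γ z)⁻¹ A B * dirDeriv w (fun y => γ y A B) z =
      2 * ∑ i, halfLog w γ z i i := fun w => by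
    rw [Finset.mul_sum]
    refine Finset.sum_congr rfl fun A _ => ?_
    rw [← sum_inv_dirDeriv]
    exact Finset.sum_congr rfl fun B _ => by rw [hsym w A B]
  have t2 : ∀ w, ∑ A, ∑ B, (γ z)⁻¹ A B * dirDeriv w (dirDeriv w (fun y => γ y A B)) z =
      2 * dirDeriv w (fun y => ∑ i, halfLog w γ y i i) z +
        4 * ∑ i, ∑ j, halfLog w γ z i j * halfLog w γ z j i := fun w => by
    rw [← D.sum_inv_dirDeriv_dirDeriv hp]
    exact Finset.sum_congr rfl fun A _ => Finset.sum_congr rfl fun B _ => by rw [hsym2 w A B]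
  have t3 : ∀ w, ∑ A, ∑ B, (γ z)⁻¹ A B * ∑ C, dirDeriv w (fun y => γ y B C) z * halfLog w γ z C A =
      2 * ∑ i, ∑ j, halfLog w γ z i j * halfLog w γ z j i := fun w => by
    simp only [Finset.mul_sum]
    refine Finset.sum_congr rfl fun A _ => ?_
    rw [Finset.sum_comm]
    refine Finset.sum_congr rfl fun C _ => ?_
    rw [← mul_assoc, ← sum_inv_dirDeriv, Finset.sum_mul]
    exact Finset.sum_congr rfl fun B _ => by ring
  have t4 : ∀ w, ∑ A, ∑ B, (γ z)⁻¹ A B * ∑ C, halfLog w γ z C B * dirDeriv w (fun y => γ y A C) z =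
      2 * ∑ i, ∑ j, halfLog w γ z i j * halfLog w γ z j i := fun w => by
    rw [← t3 w, Finset.sum_comm]
    refine Finset.sum_congr rfl fun A _ => Finset.sum_congr rfl fun B _ => ?_
    rw [hPs B A]
    exact congrArg _ (Finset.sum_congr rfl fun C _ => mul_comm _ _)
  -- In the trace of the torus block the squares tr H² cancel: the second derivatives of γ
  -- contribute -2 tr H² in each direction, and the two quadratic Christoffel sums contribute +2 tr
  -- H².
  have key : ∑ A, ∑ B, (γ z)⁻¹ A B * ricciTensor (blockG a c γ) (Sum.inr A) (Sum.inr B) p =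
      (-dirDeriv (1, 0) (fun y => ∑ i, halfLog (1, 0) γ y i i) z + α * t - l * t - t ^ 2) / a z +
      (-dirDeriv (0, 1) (fun y => ∑ i, halfLog (0, 1) γ y i i) z + ε * s - s ^ 2) / c z := by
    have e4 : ∀ A B, (γ z)⁻¹ A B * ricciTensor (blockG a c γ) (Sum.inr A) (Sum.inr B) p =
        -(2 * a z)⁻¹ * ((γ z)⁻¹ A B * dirDeriv (1, 0) (dirDeriv (1, 0) (fun y => γ y A B)) z) +
        (α - l - t) / (2 * a z) * ((γ z)⁻¹ A B * dirDeriv (1, 0) (fun y => γ y A B) z) +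
        -(2 * c z)⁻¹ * ((γ z)⁻¹ A B * dirDeriv (0, 1) (dirDeriv (0, 1) (fun y => γ y A B)) z) +
        (ε - s) / (2 * c z) * ((γ z)⁻¹ A B * dirDeriv (0, 1) (fun y => γ y A B) z) +
        (2 * a z)⁻¹ * ((γ z)⁻¹ A B * ∑ C, dirDeriv (1, 0) (fun y => γ y B C) z *
          halfLog (1, 0) γ z C A) +
        (2 * a z)⁻¹ * ((γ z)⁻¹ A B * ∑ C, halfLog (1, 0) γ z C B *
          dirDeriv (1, 0) (fun y => γ y A C) z) +
        (2 * c z)⁻¹ * ((γ z)⁻¹ A B * ∑ C, dirDeriv (0, 1) (fun y => γ y B C) z *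
          halfLog (0, 1) γ z C A) +
        (2 * c z)⁻¹ * ((γ z)⁻¹ A B * ∑ C, halfLog (0, 1) γ z C B *
          dirDeriv (0, 1) (fun y => γ y A C) z) := by
      intro A B
      rw [D.ricci_AB hp, ← hz, e2, e3, ← hα, ← hl, ← hε, ← ht, ← hs]
      have q1 : ∀ (w : ℝ × ℝ) (x : ℝ), ∑ C, (dirDeriv w (fun y => γ y B C) z / (2 * x) *
            halfLog w γ z C A + halfLog w γ z C B * (dirDeriv w (fun y => γ y A C) z / (2 * x))) =
          (2 * x)⁻¹ * ∑ C, dirDeriv w (fun y => γ y B C) z * halfLog w γ z C A +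
          (2 * x)⁻¹ * ∑ C, halfLog w γ z C B * dirDeriv w (fun y => γ y A C) z := fun w x => by
        rw [Finset.mul_sum, Finset.mul_sum, ← Finset.sum_add_distrib]
        exact Finset.sum_congr rfl fun C _ => by ring
      rw [q1, q1]
      field_simp
      ring
    simp only [e4, Finset.sum_add_distrib, ← Finset.mul_sum, t1, t2, t3, t4, ← ht, ← hs]
    field_simp
    ring
  rw [scalarCurvature]
  simp only [D.inv_blockG hp, Fintype.sum_sum_type, Fin.sum_univ_two, Matrix.fromBlocks_apply₁₁,
    Matrix.fromBlocks_apply₁₂, Matrix.fromBlocks_apply₂₁, Matrix.fromBlocks_apply₂₂,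
    Matrix.zero_apply, zero_mul, Finset.sum_const_zero, add_zero, zero_add, Matrix.diagonal_apply,
    Finset.sum_add_distrib, ← hz]
  rw [key, D.ricci_rr hp, D.ricci_tt hp, ← hz, e1, ← hα, ← hl, ← hε, ← ht, ← hs]
  simp only [if_true, Fin.zero_eq_one_iff, Fin.one_eq_zero_iff, if_false, zero_mul,
    Matrix.cons_val_zero, Matrix.cons_val_one, add_zero, zero_add, OfNat.ofNat_ne_one]
  have hcl : dirDeriv (1, 0) c z / (2 * a z) = c z * l / a z := by rw [hl]; field_simp
  rw [hcl]
  field_simp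
  ring

end ricci
end IsBlockData

/-! ### The radial functions of the Horowitz-Myers metric -/

section radial
variable {m : ℕ} {r₀ r : ℝ}

theorem hmQ_lt_one (hr₀ : 0 < r₀) (hr : r₀ < r) : (r₀ / r) ^ (m + 2) < 1 :=
  pow_lt_one₀ (by have := hr₀.trans hr; positivity) ((div_lt_one (hr₀.trans hr)).2 hr) (by omega)

theorem hmF_pos (hr₀ : 0 < r₀) (hr : r₀ < r) : 0 < hmF m r₀ r := by
  have h := hmQ_lt_one (m := m) hr₀ hr
  have : 0 < r := hr₀.trans hr
  unfold hmF
  have : 0 < 1 - (r₀ / r) ^ (m + 2) := by linarith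
  positivity

theorem exp_uHM (hr₀ : 0 < r₀) (hr : r₀ < r) : Real.exp (2 * uHM m r₀ r) = 1 / hmF m r₀ r := by
  have h : 0 < 1 - (r₀ / r) ^ (m + 2) := by linarith [hmQ_lt_one (m := m) hr₀ hr]
  have hr' : 0 < r := hr₀.trans hr
  rw [uHM, show 2 * (-Real.log r - 1 / 2 * Real.log (1 - (r₀ / r) ^ (m + 2))) =
    -(Real.log r + Real.log r + Real.log (1 - (r₀ / r) ^ (m + 2))) by ring, Real.exp_neg,
    Real.exp_add, Real.exp_add, Real.exp_log hr', Real.exp_log h, hmF]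
  field_simp

/-- The derivative of `hmF`. -/
def hmF' (m : ℕ) (r₀ r : ℝ) : ℝ := 2 * r + m * r * (r₀ / r) ^ (m + 2)

theorem hasDerivAt_hmF (hr : r ≠ 0) : HasDerivAt (hmF m r₀) (hmF' m r₀ r) r := by
  have h1 : HasDerivAt (fun r : ℝ => r₀ / r) (-r₀ / r ^ 2) r := by
    simpa [div_eq_mul_inv, neg_mul, mul_comm] using (hasDerivAt_inv hr).const_mul r₀
  have h2 := ((hasDerivAt_id r).pow 2).mul ((h1.pow (m + 2)).const_sub 1)
  refine h2.congr_deriv ?_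
  simp [hmF', pow_succ]
  field_simp
  ring

theorem hmF_core : hmF m r₀ r₀ = 0 := by
  by_cases h : r₀ = 0
  · simp [hmF, h]
  · simp [hmF, h]

theorem hmF'_core (hr₀ : r₀ ≠ 0) : hmF' m r₀ r₀ = (m + 2) * r₀ := by
  simp [hmF', hr₀]; ring

/-- `f(r₀ + s) / s` tends to `n r₀` at the core. -/
theorem tendsto_hmF_div (hr₀ : r₀ ≠ 0) :
    Tendsto (fun s => hmF m r₀ (r₀ + s) / s) (𝓝[>] 0) (𝓝 ((m + 2) * r₀)) := by
  have := (hasDerivAt_hmF (m := m) (r₀ := r₀) hr₀).tendsto_slope_zero_right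
  rw [hmF'_core hr₀] at this
  refine this.congr fun s => ?_
  simp [hmF_core, div_eq_inv_mul]

theorem pow_mul_hmQ (hr : r ≠ 0) : r ^ (m + 2) * (r₀ / r) ^ (m + 2) = r₀ ^ (m + 2) := by
  rw [← mul_pow, mul_div_cancel₀ _ hr]

theorem contDiffOn_hmF (hr₀ : 0 < r₀) : ContDiffOn ℝ ∞ (hmF m r₀) (Set.Ioi r₀) := by
  unfold hmF
  refine (contDiffOn_id.pow 2).mul (contDiffOn_const.sub ((contDiffOn_const.div contDiffOn_id ?_).pow _))
  intro x hx
  exact (hr₀.trans hx).ne'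

end radial

/-! ### The metric near the core -/

/-- The `dθ²` coefficient `c` and the torus part `γ` of a block metric, described by functions
`W`, `Γ` of `(√(r - r₀), θ)` that are smooth up to the core. -/
structure CoreData {m : ℕ} (r₀ : ℝ) (c : ℝ × ℝ → ℝ) (γ : ℝ × ℝ → Matrix (Fin m) (Fin m) ℝ)
    (W : ℝ × ℝ → ℝ) (Γ : ℝ × ℝ → Matrix (Fin m) (Fin m) ℝ) : Prop where
  smooth_W : ContDiff ℝ ∞ W
  smooth_Γ : ∀ i j, ContDiff ℝ ∞ (fun z => Γ z i j)
  pos_W : ∀ z, 0 < W z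
  posDef_Γ : ∀ z, (Γ z).PosDef
  c_eq : ∀ z : ℝ × ℝ, r₀ < z.1 → c z = (z.1 - r₀) * W (√(z.1 - r₀), z.2)
  γ_eq : ∀ z : ℝ × ℝ, r₀ < z.1 → γ z = Γ (√(z.1 - r₀), z.2)
  period_W : ∀ ρ θ, W (ρ, θ + anglePeriod m r₀) = W (ρ, θ)
  period_Γ : ∀ ρ θ, Γ (ρ, θ + anglePeriod m r₀) = Γ (ρ, θ)
  W_core : ∀ θ, W (0, θ) = (m + 2) * r₀

/-- The angular frequency `2π / β`. -/
def angleFreq (m : ℕ) (r₀ : ℝ) : ℝ := (m + 2) * r₀ / 2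

theorem anglePeriod_pos {m : ℕ} {r₀ : ℝ} (hr₀ : 0 < r₀) : 0 < anglePeriod m r₀ := by
  unfold anglePeriod; positivity

theorem angle_eq {m : ℕ} {r₀ : ℝ} (hr₀ : 0 < r₀) (t : ℝ) :
    2 * Real.pi * t / anglePeriod m r₀ = angleFreq m r₀ * t := by
  unfold anglePeriod angleFreq
  push_cast
  field_simp
  ring

theorem angleFreq_mul_period {m : ℕ} {r₀ : ℝ} (hr₀ : 0 < r₀) :
    angleFreq m r₀ * anglePeriod m r₀ = 2 * Real.pi := by
  unfold anglePeriod angleFreq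
  push_cast
  field_simp
  ring

section pullback
variable {m : ℕ} {r₀ : ℝ}

/-- The point of `ℝ² × ℝ^m` with polar coordinates `(ρ, θ)` and `x = 0`. -/
def corePoint (m : ℕ) (r₀ : ℝ) (z : ℝ × ℝ) : Idx m → ℝ :=
  Sum.elim ![z.1 * Real.cos (angleFreq m r₀ * z.2), z.1 * Real.sin (angleFreq m r₀ * z.2)] 0

theorem contDiff_corePoint : ContDiff ℝ ∞ (corePoint m r₀) := by
  rw [contDiff_pi]
  rintro (i | i)
  · fin_cases i
    · exact contDiff_fst.mul (Real.contDiff_cos.comp (contDiff_const.mul contDiff_snd))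
    · exact contDiff_fst.mul (Real.contDiff_sin.comp (contDiff_const.mul contDiff_snd))
  · exact contDiff_const

theorem polarMap_eq (hr₀ : 0 < r₀) {r θ : ℝ} :
    polarMap m r₀ (polarPoint r θ 0) = corePoint m r₀ (√(r - r₀), θ) := by
  simp only [polarMap, corePoint, polarPoint]
  ext i
  rcases i with i | i
  · fin_cases i <;> simp [angle_eq hr₀]
  · simp

/-- The partial derivatives of the map from polar to Cartesian coordinates. -/
theorem partialDeriv_polarMap (hr₀ : 0 < r₀) {r θ : ℝ} (hr : r₀ < r) :
    (∀ w : Idx m → ℝ, fderiv ℝ (fun q => polarMap m r₀ q (Sum.inl 0)) (polarPoint r θ 0) w =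
      w (Sum.inl 0) * (Real.cos (angleFreq m r₀ * θ) / (2 * √(r - r₀))) -
      w (Sum.inl 1) * (angleFreq m r₀ * √(r - r₀) * Real.sin (angleFreq m r₀ * θ))) ∧
    (∀ w : Idx m → ℝ, fderiv ℝ (fun q => polarMap m r₀ q (Sum.inl 1)) (polarPoint r θ 0) w =
      w (Sum.inl 0) * (Real.sin (angleFreq m r₀ * θ) / (2 * √(r - r₀))) +
      w (Sum.inl 1) * (angleFreq m r₀ * √(r - r₀) * Real.cos (angleFreq m r₀ * θ))) ∧
    (∀ (A : Fin m) (w : Idx m → ℝ),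
      fderiv ℝ (fun q => polarMap m r₀ q (Sum.inr A)) (polarPoint r θ 0) w = w (Sum.inr A)) := by
  have hp : ∀ i, HasFDerivAt (fun q : Idx m → ℝ => q i)
      (ContinuousLinearMap.proj (R := ℝ) (φ := fun _ : Idx m => ℝ) i) (polarPoint r θ 0) :=
    fun i => hasFDerivAt_apply i _
  have hs := ((hp (Sum.inl 0)).sub_const r₀).sqrt (by simp [polarPoint]; linarith)
  have hθ := (hp (Sum.inl 1)).const_mul (angleFreq m r₀)
  refine ⟨fun w => ?_, fun w => ?_, fun A w => ?_⟩
  · have := (hs.mul hθ.cos).fderiv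
    simp only [polarMap, Sum.elim_inl, Matrix.cons_val_zero, angle_eq hr₀]
    rw [show (fun q : Idx m → ℝ => √(q (Sum.inl 0) - r₀) * Real.cos (angleFreq m r₀ * q (Sum.inl 1)))
      = (fun q => √(q (Sum.inl 0) - r₀)) * fun q => Real.cos (angleFreq m r₀ * q (Sum.inl 1)) from rfl,
      this]
    simp [polarPoint]
    ring
  · have := (hs.mul hθ.sin).fderiv
    simp only [polarMap, Sum.elim_inl, Matrix.cons_val_one, Matrix.cons_val_zero, angle_eq hr₀]
    rw [show (fun q : Idx m → ℝ => √(q (Sum.inl 0) - r₀) * Real.sin (angleFreq m r₀ * q (Sum.inl 1)))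
      = (fun q => √(q (Sum.inl 0) - r₀)) * fun q => Real.sin (angleFreq m r₀ * q (Sum.inl 1)) from rfl,
      this]
    simp [polarPoint]
    ring
  · simp only [polarMap, Sum.elim_inr]
    rw [(hp (Sum.inr A)).fderiv]
    rfl

/-- The squared length of the tangential unit vector in the Cartesian metric `G`. -/
def coreTan (m : ℕ) (r₀ : ℝ) (G : (Idx m → ℝ) → Matrix (Idx m) (Idx m) ℝ) (z : ℝ × ℝ) : ℝ :=
  (Real.sin (angleFreq m r₀ * z.2)) ^ 2 * G (corePoint m r₀ z) (Sum.inl 0) (Sum.inl 0)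
  - Real.sin (angleFreq m r₀ * z.2) * Real.cos (angleFreq m r₀ * z.2) *
    (G (corePoint m r₀ z) (Sum.inl 0) (Sum.inl 1) + G (corePoint m r₀ z) (Sum.inl 1) (Sum.inl 0))
  + (Real.cos (angleFreq m r₀ * z.2)) ^ 2 * G (corePoint m r₀ z) (Sum.inl 1) (Sum.inl 1)

/-- The squared length of the radial unit vector in the Cartesian metric `G`. -/
def coreRad (m : ℕ) (r₀ : ℝ) (G : (Idx m → ℝ) → Matrix (Idx m) (Idx m) ℝ) (z : ℝ × ℝ) : ℝ :=
  (Real.cos (angleFreq m r₀ * z.2)) ^ 2 * G (corePoint m r₀ z) (Sum.inl 0) (Sum.inl 0)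
  + Real.sin (angleFreq m r₀ * z.2) * Real.cos (angleFreq m r₀ * z.2) *
    (G (corePoint m r₀ z) (Sum.inl 0) (Sum.inl 1) + G (corePoint m r₀ z) (Sum.inl 1) (Sum.inl 0))
  + (Real.sin (angleFreq m r₀ * z.2)) ^ 2 * G (corePoint m r₀ z) (Sum.inl 1) (Sum.inl 1)

variable {G : (Idx m → ℝ) → Matrix (Idx m) (Idx m) ℝ}

/-- With ρ = √(r - r₀) one has dρ = dr/(2ρ), whence the factor 1/(4(r - r₀)); the rotational field
has length κρ in Cartesian coordinates, whence (r - r₀)κ² with κ = `angleFreq`. -/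
theorem pullback_polarMap (hr₀ : 0 < r₀) {r θ : ℝ} (hr : r₀ < r) :
    pullbackMetric (polarMap m r₀) G (polarPoint r θ 0) (Sum.inl 0) (Sum.inl 0) =
      coreRad m r₀ G (√(r - r₀), θ) / (4 * (r - r₀)) ∧
    pullbackMetric (polarMap m r₀) G (polarPoint r θ 0) (Sum.inl 1) (Sum.inl 1) =
      (r - r₀) * (angleFreq m r₀ ^ 2 * coreTan m r₀ G (√(r - r₀), θ)) ∧
    ∀ A B, pullbackMetric (polarMap m r₀) G (polarPoint r θ 0) (Sum.inr A) (Sum.inr B) =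
      G (corePoint m r₀ (√(r - r₀), θ)) (Sum.inr A) (Sum.inr B) := by
  obtain ⟨h1, h2, h3⟩ := partialDeriv_polarMap (m := m) (θ := θ) hr₀ hr
  have hs : √(r - r₀) ^ 2 = r - r₀ := Real.sq_sqrt (by linarith)
  have hs0 : 0 < √(r - r₀) := Real.sqrt_pos.2 (by linarith)
  refine ⟨?_, ?_, fun A B => ?_⟩
  · simp [pullbackMetric, partialDeriv, Fintype.sum_sum_type, Fin.sum_univ_two, h1, h2, h3,
      polarMap_eq hr₀, coreRad]
    generalize √(r - r₀) = s at hs hs0 ⊢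
    rw [← hs]
    field_simp
    ring
  · simp [pullbackMetric, partialDeriv, Fintype.sum_sum_type, Fin.sum_univ_two, h1, h2, h3,
      polarMap_eq hr₀, coreTan]
    generalize √(r - r₀) = s at hs ⊢
    rw [← hs]
    ring
  · simp [pullbackMetric, partialDeriv, Fintype.sum_sum_type, Fin.sum_univ_two, h1, h2, h3,
      polarMap_eq hr₀, Pi.single_apply]

/-- This is the quadratic form G evaluated on the nonzero vector (-sin, cos, 0). -/
theorem coreTan_pos (hG : ∀ y, (G y).PosDef) (z : ℝ × ℝ) : 0 < coreTan m r₀ G z := by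
  have h := (hG (corePoint m r₀ z)).dotProduct_mulVec_pos
    (x := Sum.elim ![-Real.sin (angleFreq m r₀ * z.2), Real.cos (angleFreq m r₀ * z.2)] 0) ?_
  · simp [dotProduct, Matrix.mulVec, Fintype.sum_sum_type, Fin.sum_univ_two] at h
    unfold coreTan
    linarith
  · intro h0
    have e1 := congrFun h0 (Sum.inl 0)
    have e2 := congrFun h0 (Sum.inl 1)
    simp at e1 e2
    have := Real.sin_sq_add_cos_sq (angleFreq m r₀ * z.2)
    rw [e1, e2] at this
    norm_num at this

theorem contDiff_comp_core (hG : ∀ i j, ContDiff ℝ ∞ (fun y => G y i j)) (i j : Idx m) :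
    ContDiff ℝ ∞ (fun z => G (corePoint m r₀ z) i j) :=
  (hG i j).comp contDiff_corePoint

theorem contDiff_coreTan (hG : ∀ i j, ContDiff ℝ ∞ (fun y => G y i j)) :
    ContDiff ℝ ∞ (coreTan m r₀ G) := by
  have hs : ContDiff ℝ ∞ fun z : ℝ × ℝ => Real.sin (angleFreq m r₀ * z.2) :=
    Real.contDiff_sin.comp (contDiff_const.mul contDiff_snd)
  have hc : ContDiff ℝ ∞ fun z : ℝ × ℝ => Real.cos (angleFreq m r₀ * z.2) :=
    Real.contDiff_cos.comp (contDiff_const.mul contDiff_snd)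
  have := contDiff_comp_core (r₀ := r₀) hG
  exact (((hs.pow 2).mul (this _ _)).sub ((hs.mul hc).mul ((this _ _).add (this _ _)))).add
    ((hc.pow 2).mul (this _ _))

theorem continuous_coreRad (hG : ∀ i j, ContDiff ℝ ∞ (fun y => G y i j)) :
    Continuous (coreRad m r₀ G) := by
  have := fun i j => (contDiff_comp_core (r₀ := r₀) hG i j).continuous
  have hs : Continuous fun z : ℝ × ℝ => Real.sin (angleFreq m r₀ * z.2) := by fun_prop
  have hc : Continuous fun z : ℝ × ℝ => Real.cos (angleFreq m r₀ * z.2) := by fun_prop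
  exact (((hc.pow 2).mul (this _ _)).add ((hs.mul hc).mul ((this _ _).add (this _ _)))).add
    ((hs.pow 2).mul (this _ _))

theorem corePoint_period (hr₀ : 0 < r₀) (ρ θ : ℝ) :
    corePoint m r₀ (ρ, θ + anglePeriod m r₀) = corePoint m r₀ (ρ, θ) := by
  simp [corePoint, mul_add, angleFreq_mul_period hr₀]

theorem coreTan_period (hr₀ : 0 < r₀) (ρ θ : ℝ) :
    coreTan m r₀ G (ρ, θ + anglePeriod m r₀) = coreTan m r₀ G (ρ, θ) := by
  simp only [coreTan, corePoint_period hr₀]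
  simp [mul_add, angleFreq_mul_period hr₀]

/-- All angles describe the same point when ρ = 0, and there the tangential direction at θ is the
radial direction a quarter period later. This transfers information on g_rr to g_θθ at the core. -/
theorem coreTan_zero (hr₀ : 0 < r₀) (θ : ℝ) :
    coreTan m r₀ G (0, θ) = coreRad m r₀ G (0, θ + anglePeriod m r₀ / 4) := by
  have e : angleFreq m r₀ * (θ + anglePeriod m r₀ / 4) = angleFreq m r₀ * θ + Real.pi / 2 := by
    rw [mul_add, ← mul_div_assoc, angleFreq_mul_period hr₀]; ring
  have e2 : corePoint m r₀ (0, θ + anglePeriod m r₀ / 4) = corePoint m r₀ (0, θ) := by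
    simp [corePoint]
  simp only [coreTan, coreRad, e, e2, Real.sin_add_pi_div_two, Real.cos_add_pi_div_two]
  ring

end pullback

/-- A smooth metric of block form whose `dr²` coefficient is that of the Horowitz-Myers metric. -/
theorem exists_coreData {m : ℕ} {r₀ : ℝ} (hr₀ : 0 < r₀)
    {B : Module.Basis (Fin m) ℝ (Fin m → ℝ)}
    {u v : ℝ → ℝ → ℝ} {γ : ℝ → ℝ → Matrix (Fin m) (Fin m) ℝ}
    (hsmooth : IsSmoothMetric r₀ B (blockMetric u v γ))
    (hu : ∀ r θ, r₀ < r → u r θ = uHM m r₀ r) :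
    ∃ W Γ, CoreData r₀ (fun z => Real.exp (2 * v z.1 z.2)) (fun z => γ z.1 z.2) W Γ := by
  obtain ⟨G, hG, hpos, -, hpull⟩ := hsmooth
  -- The block metric does not depend on x, so evaluating at x = 0 loses nothing.
  have key : ∀ r θ, r₀ < r → Real.exp (2 * u r θ) = coreRad m r₀ G (√(r - r₀), θ) / (4 * (r - r₀)) ∧
      Real.exp (2 * v r θ) = (r - r₀) * (angleFreq m r₀ ^ 2 * coreTan m r₀ G (√(r - r₀), θ)) ∧
      ∀ A B, γ r θ A B = G (corePoint m r₀ (√(r - r₀), θ)) (Sum.inr A) (Sum.inr B) := by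
    intro r θ hr
    have h := pullback_polarMap (m := m) (G := G) (θ := θ) hr₀ hr
    rw [← hpull (polarPoint r θ 0) hr] at h
    exact h
  have hκ : 0 < angleFreq m r₀ := by unfold angleFreq; positivity
  refine ⟨fun z => angleFreq m r₀ ^ 2 * coreTan m r₀ G z,
    fun z => (G (corePoint m r₀ z)).submatrix Sum.inr Sum.inr, ?_⟩
  refine ⟨contDiff_const.mul (contDiff_coreTan hG), fun i j => contDiff_comp_core hG _ _,
    fun z => mul_pos (by positivity) (coreTan_pos hpos z), fun z => ?_, fun z hz => (key _ _ hz).2.1,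
    fun z hz => Matrix.ext fun i j => (key _ _ hz).2.2 i j, fun ρ θ => ?_, fun ρ θ => ?_,
    fun θ => ?_⟩
  · exact (hpos _).submatrix Sum.inr_injective
  · simp only [coreTan_period hr₀]
  · simp only [corePoint_period hr₀]
  -- Equating the radial coefficient `coreRad`/(4ρ²) with 1/f gives `coreRad` = 4ρ²/f, and f/ρ²
  -- tends to f'(r₀) = n r₀.
  · have h1 : ∀ t, coreRad m r₀ G (0, t) = 4 / ((m + 2) * r₀) := by
      intro t
      have ht1 : Tendsto (fun ρ => coreRad m r₀ G (ρ, t)) (𝓝[>] 0) (𝓝 (coreRad m r₀ G (0, t))) :=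
        (((continuous_coreRad hG).comp (by fun_prop : Continuous fun ρ : ℝ => (ρ, t))).tendsto 0).mono_left
          nhdsWithin_le_nhds
      have hsq : Tendsto (fun ρ : ℝ => ρ ^ 2) (𝓝[>] 0) (𝓝[>] 0) := by
        refine tendsto_nhdsWithin_iff.2 ⟨?_, ?_⟩
        · have : Tendsto (fun ρ : ℝ => ρ ^ 2) (𝓝 0) (𝓝 (0 ^ 2)) := (continuous_pow 2).tendsto 0
          simpa using this.mono_left nhdsWithin_le_nhds
        · filter_upwards [self_mem_nhdsWithin] with ρ hρ
          exact pow_pos (Set.mem_Ioi.1 hρ) 2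
      have ht2 : Tendsto (fun ρ : ℝ => 4 / (hmF m r₀ (r₀ + ρ ^ 2) / ρ ^ 2)) (𝓝[>] 0)
          (𝓝 (4 / ((m + 2) * r₀))) :=
        tendsto_const_nhds.div ((tendsto_hmF_div hr₀.ne').comp hsq) (by positivity)
      refine tendsto_nhds_unique ht1 (ht2.congr' ?_)
      filter_upwards [self_mem_nhdsWithin] with ρ hρ
      have hρ' : (0:ℝ) < ρ := hρ
      have hr : r₀ < r₀ + ρ ^ 2 := by have := pow_pos hρ' 2; linarith
      have h := (key _ t hr).1
      rw [hu _ _ hr, exp_uHM hr₀ hr, add_sub_cancel_left, Real.sqrt_sq hρ'.le] at h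
      have hf := hmF_pos (m := m) hr₀ hr
      field_simp at h ⊢
      linarith
    -- With κ = n r₀/2 the core value is κ² · 4/(n r₀) = n r₀. The choice of period enters here: it
    -- is the one without a conical singularity.
    simp only [coreTan_zero hr₀, h1]
    unfold angleFreq
    field_simp
    ring

/-! ### The flux through the hypersurfaces of constant `r` -/

/-- The domain `r > r₀` of the polar coordinates. -/
def outer (r₀ : ℝ) : Set (ℝ × ℝ) := {z | r₀ < z.1}

theorem isOpen_outer (r₀ : ℝ) : IsOpen (outer r₀) := isOpen_lt continuous_const continuous_fst

section
variable {m : ℕ} {r₀ : ℝ}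

theorem contDiffOn_sqrt_outer : ContDiffOn ℝ ∞ (fun z : ℝ × ℝ => √(z.1 - r₀)) (outer r₀) :=
  (contDiffOn_fst.sub contDiffOn_const).sqrt fun _ hz => (sub_pos.2 hz).ne'

theorem contDiffOn_comp_core {h : ℝ × ℝ → ℝ} (hh : ContDiff ℝ ∞ h) :
    ContDiffOn ℝ ∞ (fun z : ℝ × ℝ => h (√(z.1 - r₀), z.2)) (outer r₀) :=
  hh.comp_contDiffOn (contDiffOn_sqrt_outer.prodMk contDiffOn_snd)

theorem contDiffOn_hmF_fst (hr₀ : 0 < r₀) :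
    ContDiffOn ℝ ∞ (fun z : ℝ × ℝ => hmF m r₀ z.1) (outer r₀) :=
  (contDiffOn_hmF hr₀).comp contDiffOn_fst fun _ hz => hz

variable {c : ℝ × ℝ → ℝ} {γ : ℝ × ℝ → Matrix (Fin m) (Fin m) ℝ} {W : ℝ × ℝ → ℝ}
  {Γ : ℝ × ℝ → Matrix (Fin m) (Fin m) ℝ}

theorem CoreData.posDef (K : CoreData r₀ c γ W Γ) {z : ℝ × ℝ} (hz : r₀ < z.1) : (γ z).PosDef := by
  rw [K.γ_eq z hz]; exact K.posDef_Γ _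

theorem CoreData.isBlockData (hr₀ : 0 < r₀) (K : CoreData r₀ c γ W Γ) {a : ℝ × ℝ → ℝ}
    (ha : ∀ z : ℝ × ℝ, r₀ < z.1 → a z = 1 / hmF m r₀ z.1) : IsBlockData (outer r₀) a c γ where
  isOpen := isOpen_outer r₀
  smooth_a := (contDiffOn_const.div (contDiffOn_hmF_fst hr₀)
    (fun z hz => (hmF_pos hr₀ hz).ne')).congr fun z hz => ha z hz
  smooth_c := ((contDiffOn_fst.sub contDiffOn_const).mul (contDiffOn_comp_core K.smooth_W)).congr
    fun z hz => K.c_eq z hz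
  smooth_γ i j := (contDiffOn_comp_core (K.smooth_Γ i j)).congr fun z hz => by
    rw [K.γ_eq z hz]
  pos_a z hz := by rw [ha z hz]; exact one_div_pos.2 (hmF_pos hr₀ hz)
  pos_c z hz := by rw [K.c_eq z hz]; exact mul_pos (sub_pos.2 hz) (K.pos_W _)
  symm_γ z i j hz := by simpa using (K.posDef hz).isHermitian.apply j i
  det_γ z hz := (K.posDef hz).det_pos.ne'
  angle_a z hz := by
    have e : a =ᶠ[𝓝 z] fun z => 1 / hmF m r₀ z.1 := by
      filter_upwards [(isOpen_outer r₀).mem_nhds hz] with y hy using ha y hy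
    have h1 := ((hasDerivAt_hmF (m := m) (r₀ := r₀) (hr₀.trans hz).ne').inv
      (hmF_pos hr₀ hz).ne').comp_hasFDerivAt z (hasFDerivAt_fst (𝕜 := ℝ))
    rw [dirDeriv_congr e, dirDeriv]
    simp only [one_div]
    rw [show (fun z : ℝ × ℝ => (hmF m r₀ z.1)⁻¹) = (hmF m r₀)⁻¹ ∘ Prod.fst from rfl, h1.fderiv]
    simp

theorem hasDerivAt_slice_fst {h : ℝ × ℝ → ℝ} {r θ : ℝ} (hh : DifferentiableAt ℝ h (r, θ)) :
    HasDerivAt (fun s => h (s, θ)) (dirDeriv (1, 0) h (r, θ)) r :=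
  hh.hasFDerivAt.comp_hasDerivAt r ((hasDerivAt_id r).prodMk (hasDerivAt_const r θ))

theorem hasDerivAt_slice_snd {h : ℝ × ℝ → ℝ} {r θ : ℝ} (hh : DifferentiableAt ℝ h (r, θ)) :
    HasDerivAt (fun t => h (r, t)) (dirDeriv (0, 1) h (r, θ)) θ :=
  hh.hasFDerivAt.comp_hasDerivAt θ ((hasDerivAt_const θ r).prodMk (hasDerivAt_id θ))

/-- The trace of `halfLog`. -/
def trH (w : ℝ × ℝ) (γ : ℝ × ℝ → Matrix (Fin m) (Fin m) ℝ) (z : ℝ × ℝ) : ℝ :=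
  ∑ i, halfLog w γ z i i

/-- The trace of the square of `halfLog`. -/
def trHsq (w : ℝ × ℝ) (γ : ℝ × ℝ → Matrix (Fin m) (Fin m) ℝ) (z : ℝ × ℝ) : ℝ :=
  ∑ i, ∑ j, halfLog w γ z i j * halfLog w γ z j i

/-- The integrand of the monotone flux. -/
def fluxDensity (r₀ : ℝ) (c : ℝ × ℝ → ℝ) (γ : ℝ × ℝ → Matrix (Fin m) (Fin m) ℝ)
    (z : ℝ × ℝ) : ℝ :=
  2 * z.1 ^ m * √(hmF m r₀ z.1) * √(c z) *
    (z.1 * (dirDeriv (1, 0) c z / (2 * c z) + trH (1, 0) γ z) - (m + 1))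

/-- The function whose `θ`-derivative enters the derivative of the flux density. -/
def angularTerm (c : ℝ × ℝ → ℝ) (γ : ℝ × ℝ → Matrix (Fin m) (Fin m) ℝ) (z : ℝ × ℝ) : ℝ :=
  trH (0, 1) γ z / √(c z)

/-- Minus the derivative of the flux density, up to a `θ`-derivative. -/
def fluxLoss (r₀ : ℝ) (c : ℝ × ℝ → ℝ) (γ : ℝ × ℝ → Matrix (Fin m) (Fin m) ℝ) (z : ℝ × ℝ) : ℝ :=
  -(dirDeriv (1, 0) (fluxDensity r₀ c γ) z +
    2 * z.1 ^ (m + 1) / √(hmF m r₀ z.1) * dirDeriv (0, 1) (angularTerm c γ) z)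

variable {a : ℝ × ℝ → ℝ}

namespace IsBlockData

theorem smooth_trH {U : Set (ℝ × ℝ)} (D : IsBlockData U a c γ) (w : ℝ × ℝ) :
    ContDiffOn ℝ ∞ (trH w γ) U :=
  ContDiffOn.sum fun i _ => D.smooth_halfLog w i i

theorem smooth_sqrt_c {U : Set (ℝ × ℝ)} (D : IsBlockData U a c γ) :
    ContDiffOn ℝ ∞ (fun z => √(c z)) U :=
  D.smooth_c.sqrt fun z hz => (D.pos_c z hz).ne'

theorem smooth_logDeriv {U : Set (ℝ × ℝ)} (D : IsBlockData U a c γ) :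
    ContDiffOn ℝ ∞ (fun z => dirDeriv (1, 0) c z / (2 * c z)) U :=
  (D.smooth_c.dirDeriv D.isOpen).div (contDiffOn_const.mul D.smooth_c)
    fun z hz => (mul_pos two_pos (D.pos_c z hz)).ne'

theorem smooth_angularTerm {U : Set (ℝ × ℝ)} (D : IsBlockData U a c γ) :
    ContDiffOn ℝ ∞ (angularTerm c γ) U :=
  (D.smooth_trH _).div D.smooth_sqrt_c fun z hz => (Real.sqrt_pos.2 (D.pos_c z hz)).ne'

theorem smooth_sqrt_hmF (hr₀ : 0 < r₀) :
    ContDiffOn ℝ ∞ (fun z : ℝ × ℝ => √(hmF m r₀ z.1)) (outer r₀) :=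
  (contDiffOn_hmF_fst hr₀).sqrt fun _ hz => (hmF_pos hr₀ hz).ne'

theorem smooth_fluxDensity (hr₀ : 0 < r₀) (D : IsBlockData (outer r₀) a c γ) :
    ContDiffOn ℝ ∞ (fluxDensity r₀ c γ) (outer r₀) :=
  (((contDiffOn_const.mul (contDiffOn_fst.pow m)).mul (smooth_sqrt_hmF hr₀)).mul
    D.smooth_sqrt_c).mul
    ((contDiffOn_fst.mul (D.smooth_logDeriv.add (D.smooth_trH _))).sub contDiffOn_const)

theorem continuousOn_fluxLoss (hr₀ : 0 < r₀) (D : IsBlockData (outer r₀) a c γ) :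
    ContinuousOn (fluxLoss r₀ c γ) (outer r₀) := by
  have h1 := ((D.smooth_fluxDensity hr₀).dirDeriv (w := (1, 0)) D.isOpen).continuousOn
  have h2 := (D.smooth_angularTerm.dirDeriv (w := (0, 1)) D.isOpen).continuousOn
  refine (h1.add (ContinuousOn.mul ?_ h2)).neg
  exact ((continuousOn_const.mul (continuousOn_fst.pow (m + 1))).div
    (smooth_sqrt_hmF hr₀).continuousOn fun z hz => (Real.sqrt_pos.2 (hmF_pos hr₀ hz)).ne')

/-- The flux loss in terms of the scalar curvature. -/
theorem fluxLoss_eq (hr₀ : 0 < r₀) (D : IsBlockData (outer r₀) a c γ)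
    (ha : ∀ z : ℝ × ℝ, r₀ < z.1 → a z = 1 / hmF m r₀ z.1) {r θ : ℝ} (hr : r₀ < r) :
    fluxLoss r₀ c γ (r, θ) =
      r ^ (m + 1) * √(hmF m r₀ r) * √(c (r, θ)) *
        (((trH (1, 0) γ (r, θ) - m / r) ^ 2 +
          (trHsq (1, 0) γ (r, θ) - 2 * trH (1, 0) γ (r, θ) / r + m / r ^ 2)) +
        (scalarCurvature (blockG a c γ) (polarPoint r θ 0) + (m + 2) * (m + 1)) / hmF m r₀ r) +
      r ^ (m + 1) / (√(hmF m r₀ r) * √(c (r, θ))) *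
        (trH (0, 1) γ (r, θ) ^ 2 + trHsq (0, 1) γ (r, θ)) := by
  have hz : ((r, θ) : ℝ × ℝ) ∈ outer r₀ := hr
  have hr' : 0 < r := hr₀.trans hr
  have hf := hmF_pos (m := m) hr₀ hr
  have hc := D.pos_c _ hz
  have hsf := Real.sqrt_pos.2 hf
  have hsc := Real.sqrt_pos.2 hc
  have df := hasDerivAt_hmF (m := m) (r₀ := r₀) hr'.ne'
  have dα : dirDeriv (1, 0) a (r, θ) / (2 * a (r, θ)) = -hmF' m r₀ r / (2 * hmF m r₀ r) := by
    have e : a =ᶠ[𝓝 (r, θ)] fun z => 1 / hmF m r₀ z.1 := by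
      filter_upwards [(isOpen_outer r₀).mem_nhds hz] with y hy using ha y hy
    have h1 := hasDerivAt_slice_fst (D.dA hz)
    have h2 : HasDerivAt (fun s => a (s, θ)) (-hmF' m r₀ r / hmF m r₀ r ^ 2) r := by
      refine (df.inv hf.ne').congr_of_eventuallyEq ?_
      filter_upwards [Ioi_mem_nhds hr] with s hs
      simpa using ha (s, θ) hs
    rw [h1.unique h2, ha _ hr]
    field_simp
  have d1 := hasDerivAt_slice_fst (D.dC hz)
  have d2 := hasDerivAt_slice_fst (D.smooth_logDeriv.differentiableAt_of_isOpen D.isOpen hz)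
  have d3 := hasDerivAt_slice_fst ((D.smooth_trH (1, 0)).differentiableAt_of_isOpen D.isOpen hz)
  have dJ := hasDerivAt_slice_fst ((D.smooth_fluxDensity hr₀).differentiableAt_of_isOpen D.isOpen hz)
  have dJ' := ((((hasDerivAt_pow m r).const_mul 2).mul (df.sqrt hf.ne')).mul (d1.sqrt hc.ne')).mul
    (((hasDerivAt_id r).mul (d2.add d3)).sub_const ((m : ℝ) + 1))
  have eJ := dJ.unique dJ'
  have t1 := hasDerivAt_slice_snd (D.smooth_angularTerm.differentiableAt_of_isOpen D.isOpen hz)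
  have t1' := (hasDerivAt_slice_snd
    ((D.smooth_trH (0, 1)).differentiableAt_of_isOpen D.isOpen hz)).div
    ((hasDerivAt_slice_snd (D.dC hz)).sqrt hc.ne') hsc.ne'
  have eT := t1.unique t1'
  have hR := D.scalarCurvature_blockG (p := polarPoint r θ 0) (by exact hz) rfl rfl rfl rfl rfl
  rw [show radAng m (polarPoint r θ 0) = (r, θ) from rfl, dα] at hR
  change scalarCurvature (blockG a c γ) (polarPoint r θ 0) =
      (-2 * dirDeriv (1, 0) (fun z => dirDeriv (1, 0) c z / (2 * c z)) (r, θ)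
        - 2 * (dirDeriv (1, 0) c (r, θ) / (2 * c (r, θ))) ^ 2
        - 2 * dirDeriv (1, 0) (trH (1, 0) γ) (r, θ)
        - trH (1, 0) γ (r, θ) ^ 2 - trHsq (1, 0) γ (r, θ)
        + 2 * (-hmF' m r₀ r / (2 * hmF m r₀ r)) *
          (dirDeriv (1, 0) c (r, θ) / (2 * c (r, θ)) + trH (1, 0) γ (r, θ))
        - 2 * (dirDeriv (1, 0) c (r, θ) / (2 * c (r, θ))) * trH (1, 0) γ (r, θ)) / a (r, θ) +
      (-2 * dirDeriv (0, 1) (trH (0, 1) γ) (r, θ)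
        + 2 * (dirDeriv (0, 1) c (r, θ) / (2 * c (r, θ))) * trH (0, 1) γ (r, θ)
        - trH (0, 1) γ (r, θ) ^ 2 - trHsq (0, 1) γ (r, θ)) / c (r, θ) at hR
  rw [fluxLoss, eJ, eT, hR, ha _ hr]
  -- This first-order equation for f eliminates f'; afterwards the claim is an algebraic identity in
  -- which √f is a free positive variable.
  have hff : r * hmF' m r₀ r = (m + 2) * r ^ 2 - m * hmF m r₀ r := by
    simp only [hmF, hmF']; ring
  have hff' : hmF' m r₀ r = ((m + 2) * r ^ 2 - m * hmF m r₀ r) / r := by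
    rw [← hff]; field_simp
  have q1 : hmF m r₀ r = √(hmF m r₀ r) ^ 2 := (Real.sq_sqrt hf.le).symm
  have q2 : c (r, θ) = √(c (r, θ)) ^ 2 := (Real.sq_sqrt hc.le).symm
  -- For m = 0 the exponent is truncated, but the factor m vanishes.
  have hpow : (m : ℝ) * r ^ (m - 1) = m * r ^ m / r := by
    rcases m with _ | k
    · simp
    · simp [pow_succ]; field_simp
  simp only [hpow, hff', id, Pi.mul_apply, Pi.add_apply]
  generalize √(hmF m r₀ r) = f at *
  generalize √(c (r, θ)) = C at *
  rw [q1, q2]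
  generalize dirDeriv (1, 0) (fun z => dirDeriv (1, 0) c z / (2 * c z)) (r, θ) = L1
  generalize dirDeriv (1, 0) c (r, θ) = c1
  generalize dirDeriv (0, 1) c (r, θ) = c2
  generalize trH (1, 0) γ (r, θ) = X
  generalize trH (0, 1) γ (r, θ) = Y
  generalize dirDeriv (1, 0) (trH (1, 0) γ) (r, θ) = X1
  generalize dirDeriv (0, 1) (trH (0, 1) γ) (r, θ) = Y1
  generalize trHsq (1, 0) γ (r, θ) = X2
  generalize trHsq (0, 1) γ (r, θ) = Y2
  clear * - hr' hsf hsc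
  rw [pow_succ r m]
  generalize r ^ m = P
  field_simp
  ring

end IsBlockData
end

/-! ### Positivity of the flux loss. -/

open scoped MatrixOrder Matrix.Norms.L2Operator in
-- Factor M⁻¹ = CᵀC with C invertible. By cyclicity the trace is the squared Frobenius norm of the
-- symmetric matrix C T Cᵀ, which vanishes only for T = 0.
theorem Matrix.PosDef.trace_inv_mul_sq {ι : Type} [Fintype ι] [DecidableEq ι]
    {M T : Matrix ι ι ℝ} (hM : M.PosDef) (hT : Tᵀ = T) :
    0 ≤ ((M⁻¹ * T) * (M⁻¹ * T)).trace ∧ (((M⁻¹ * T) * (M⁻¹ * T)).trace = 0 → T = 0) := by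
  obtain ⟨C, hCu, hC⟩ : ∃ C : Matrix ι ι ℝ, IsUnit C ∧ M⁻¹ = Cᵀ * C := by
    obtain ⟨C, hC⟩ := CStarAlgebra.nonneg_iff_eq_star_mul_self.mp hM.inv.posSemidef.nonneg
    rw [Matrix.star_eq_conjTranspose, Matrix.conjTranspose_eq_transpose_of_trivial] at hC
    refine ⟨C, ?_, hC⟩
    rw [Matrix.isUnit_iff_isUnit_det, isUnit_iff_ne_zero]
    intro h0
    have := hM.inv.det_pos
    rw [hC, Matrix.det_mul, h0, mul_zero] at this
    exact lt_irrefl _ this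
  have hN : ((M⁻¹ * T) * (M⁻¹ * T)).trace = ((C * T * Cᵀ)ᴴ * (C * T * Cᵀ)).trace := by
    rw [Matrix.conjTranspose_eq_transpose_of_trivial, hC]
    simp only [Matrix.transpose_mul, Matrix.transpose_transpose, hT, Matrix.mul_assoc]
    rw [Matrix.trace_mul_comm]
    simp only [Matrix.mul_assoc]
  rw [hN]
  refine ⟨(Matrix.posSemidef_conjTranspose_mul_self _).trace_nonneg, fun h => ?_⟩
  rw [Matrix.trace_conjTranspose_mul_self_eq_zero_iff] at h
  have hCt : IsUnit Cᵀ := by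
    rw [Matrix.isUnit_iff_isUnit_det, Matrix.det_transpose, ← Matrix.isUnit_iff_isUnit_det]
    exact hCu
  rw [hCt.mul_left_eq_zero, hCu.mul_right_eq_zero] at h
  exact h

section
variable {m : ℕ} {r₀ : ℝ} {a c : ℝ × ℝ → ℝ} {γ : ℝ × ℝ → Matrix (Fin m) (Fin m) ℝ}

theorem halfLog_eq (w z : ℝ × ℝ) :
    halfLog w γ z = (γ z)⁻¹ * Matrix.of fun i j => dirDeriv w (fun y => γ y i j) z / 2 := by
  ext i j
  simp [halfLog, Matrix.mul_apply]

namespace IsBlockData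

theorem symm_dirDeriv {U : Set (ℝ × ℝ)} (D : IsBlockData U a c γ) {z : ℝ × ℝ} (hz : z ∈ U)
    (w : ℝ × ℝ) : (Matrix.of fun i j => dirDeriv w (fun y => γ y i j) z / 2)ᵀ =
      Matrix.of fun i j => dirDeriv w (fun y => γ y i j) z / 2 := by
  ext i j
  simp only [Matrix.transpose_apply, Matrix.of_apply]
  rw [dirDeriv_congr]
  filter_upwards [D.isOpen.mem_nhds hz] with y hy using D.symm_γ y j i hy

/-- The quadratic form in the flux loss is positive. -/
theorem trHsq_shift {U : Set (ℝ × ℝ)} (D : IsBlockData U a c γ) {z : ℝ × ℝ} (hz : z ∈ U)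
    (hγ : (γ z).PosDef) (w : ℝ × ℝ) (s : ℝ) :
    0 ≤ trHsq w γ z - 2 * trH w γ z * s + m * s ^ 2 ∧
      (trHsq w γ z - 2 * trH w γ z * s + m * s ^ 2 = 0 →
        ∀ i j, dirDeriv w (fun y => γ y i j) z = 2 * s * γ z i j) := by
  have hs : (γ z)ᵀ = γ z := Matrix.ext fun i j => D.symm_γ z j i hz
  -- With T = ½∂γ - sγ the matrix γ⁻¹T is H - s, where H = ½ γ⁻¹∂γ, and the trace of its square
  -- expands to the stated expression.
  have h := hγ.trace_inv_mul_sq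
    (T := (Matrix.of fun i j => dirDeriv w (fun y => γ y i j) z / 2) - s • γ z)
    (by rw [Matrix.transpose_sub, Matrix.transpose_smul, D.symm_dirDeriv hz, hs])
  have e : (γ z)⁻¹ * ((Matrix.of fun i j => dirDeriv w (fun y => γ y i j) z / 2) - s • γ z) =
      halfLog w γ z - s • 1 := by
    rw [mul_sub, ← halfLog_eq, Matrix.mul_smul, Matrix.nonsing_inv_mul _ (D.det_γ z hz).isUnit]
  have e2 : ((halfLog w γ z - s • 1) * (halfLog w γ z - s • 1)).trace =
      trHsq w γ z - 2 * trH w γ z * s + m * s ^ 2 := by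
    have h1 : (halfLog w γ z * halfLog w γ z).trace = trHsq w γ z := by
      simp [Matrix.trace, trHsq, Matrix.mul_apply]
    have h2 : (halfLog w γ z).trace = trH w γ z := rfl
    simp only [sub_mul, mul_sub, Matrix.trace_sub, h1, Matrix.smul_mul, Matrix.mul_smul,
      Matrix.trace_smul, one_mul, mul_one, h2, Matrix.trace_one, smul_eq_mul, Fintype.card_fin]
    ring
  rw [e, e2] at h
  refine ⟨h.1, fun h0 i j => ?_⟩
  have := congrFun (congrFun (h.2 h0) i) j
  simp at this
  linarith

variable (hr₀ : 0 < r₀) (D : IsBlockData (outer r₀) a c γ)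
  (ha : ∀ z : ℝ × ℝ, r₀ < z.1 → a z = 1 / hmF m r₀ z.1)
  (hγ : ∀ z : ℝ × ℝ, r₀ < z.1 → (γ z).PosDef)
  (hR : ∀ p : Idx m → ℝ, r₀ < p (Sum.inl 0) →
    -((m + 2) * (m + 1)) ≤ scalarCurvature (blockG a c γ) p)
include hr₀ D ha hγ hR

/-- All terms of `fluxLoss_eq` have a sign. The radial square is centred at s = 1/r, the logarithmic
rate of the cone r²δ, and the angular one at s = 0; a zero sum forces each square to vanish. -/
theorem fluxLoss_nonneg_and {r θ : ℝ} (hr : r₀ < r) :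
    0 ≤ fluxLoss r₀ c γ (r, θ) ∧ (fluxLoss r₀ c γ (r, θ) = 0 →
      (∀ i j, dirDeriv (1, 0) (fun y => γ y i j) (r, θ) = 2 / r * γ (r, θ) i j) ∧
      (∀ i j, dirDeriv (0, 1) (fun y => γ y i j) (r, θ) = 0)) := by
  have hz : ((r, θ) : ℝ × ℝ) ∈ outer r₀ := hr
  have hr' : 0 < r := hr₀.trans hr
  have hf := hmF_pos (m := m) hr₀ hr
  have hsf := Real.sqrt_pos.2 hf
  have hsc := Real.sqrt_pos.2 (D.pos_c _ hz)
  obtain ⟨s1, s2⟩ := D.trHsq_shift hz (hγ _ hr) (1, 0) (1 / r)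
  obtain ⟨s3, s4⟩ := D.trHsq_shift hz (hγ _ hr) (0, 1) 0
  have hR' := hR (polarPoint r θ 0) hr
  have e1 : trHsq (1, 0) γ (r, θ) - 2 * trH (1, 0) γ (r, θ) * (1 / r) + m * (1 / r) ^ 2 =
      trHsq (1, 0) γ (r, θ) - 2 * trH (1, 0) γ (r, θ) / r + m / r ^ 2 := by ring
  have e3 : trHsq (0, 1) γ (r, θ) - 2 * trH (0, 1) γ (r, θ) * 0 + m * 0 ^ 2 =
      trHsq (0, 1) γ (r, θ) := by ring
  rw [e1] at s1 s2
  rw [e3] at s3 s4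
  rw [D.fluxLoss_eq hr₀ ha hr]
  set R := scalarCurvature (blockG a c γ) (polarPoint r θ 0)
  have p1 : 0 < r ^ (m + 1) * √(hmF m r₀ r) * √(c (r, θ)) := by positivity
  have p2 : 0 < r ^ (m + 1) / (√(hmF m r₀ r) * √(c (r, θ))) := by positivity
  have p3 : 0 ≤ (R + (m + 2) * (m + 1)) / hmF m r₀ r := div_nonneg (by linarith) hf.le
  have p4 := sq_nonneg (trH (1, 0) γ (r, θ) - m / r)
  have p5 := sq_nonneg (trH (0, 1) γ (r, θ))
  have p6 : 0 ≤ (trH (1, 0) γ (r, θ) - m / r) ^ 2 +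
          (trHsq (1, 0) γ (r, θ) - 2 * trH (1, 0) γ (r, θ) / r + m / r ^ 2) +
        (R + (m + 2) * (m + 1)) / hmF m r₀ r := by linarith
  have p7 : 0 ≤ trH (0, 1) γ (r, θ) ^ 2 + trHsq (0, 1) γ (r, θ) := by linarith
  refine ⟨add_nonneg (mul_nonneg p1.le p6) (mul_nonneg p2.le p7), fun h0 => ?_⟩
  obtain ⟨z1, z2⟩ := (add_eq_zero_iff_of_nonneg (mul_nonneg p1.le p6) (mul_nonneg p2.le p7)).1 h0
  have z1' := (mul_eq_zero.1 z1).resolve_left p1.ne'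
  have z2' := (mul_eq_zero.1 z2).resolve_left p2.ne'
  refine ⟨fun i j => ?_, fun i j => ?_⟩
  · rw [s2 (by linarith) i j]; ring
  · rw [s4 (by linarith) i j]; ring

end IsBlockData
end

/-! ### Monotonicity of the flux and its limit at the core. -/

section
variable {m : ℕ} {r₀ : ℝ} {a c : ℝ × ℝ → ℝ} {γ : ℝ × ℝ → Matrix (Fin m) (Fin m) ℝ}
  {W : ℝ × ℝ → ℝ} {Γ : ℝ × ℝ → Matrix (Fin m) (Fin m) ℝ}

theorem ContinuousOn.continuous_slice_snd {h : ℝ × ℝ → ℝ} (hh : ContinuousOn h (outer r₀)) {r : ℝ}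
    (hr : r₀ < r) : Continuous fun θ => h (r, θ) :=
  hh.comp_continuous (by fun_prop) fun _ => hr

theorem ContinuousOn.continuous_max {h : ℝ × ℝ → ℝ} (hh : ContinuousOn h (outer r₀)) {r : ℝ}
    (hr : r₀ < r) : Continuous fun z : ℝ × ℝ => h (max z.1 r, z.2) :=
  hh.comp_continuous (by fun_prop) fun _ => hr.trans_le (le_max_right _ _)

/-- The flux through `{r} × S¹`. -/
def flux (r₀ : ℝ) (c : ℝ × ℝ → ℝ) (γ : ℝ × ℝ → Matrix (Fin m) (Fin m) ℝ) (r : ℝ) : ℝ :=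
  ∫ θ in 0..anglePeriod m r₀, fluxDensity r₀ c γ (r, θ)

theorem dirDeriv_add_right {h : ℝ × ℝ → ℝ} {w z t : ℝ × ℝ}
    (hh : (fun y => h (y + t)) =ᶠ[𝓝 z] h) : dirDeriv w h (z + t) = dirDeriv w h z := by
  rw [dirDeriv, ← fderiv_comp_add_right, hh.fderiv_eq, dirDeriv]

theorem CoreData.period_c (K : CoreData r₀ c γ W Γ) {z : ℝ × ℝ} (hz : r₀ < z.1) :
    c (z + (0, anglePeriod m r₀)) = c z := by
  rw [K.c_eq z hz, K.c_eq _ (by simpa using hz)]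
  simp [K.period_W]

theorem CoreData.period_γ (K : CoreData r₀ c γ W Γ) {z : ℝ × ℝ} (hz : r₀ < z.1) :
    γ (z + (0, anglePeriod m r₀)) = γ z := by
  rw [K.γ_eq z hz, K.γ_eq _ (by simpa using hz)]
  simp [K.period_Γ]

theorem CoreData.angularTerm_period (K : CoreData r₀ c γ W Γ) {r : ℝ} (hr : r₀ < r) :
    angularTerm c γ (r, anglePeriod m r₀) = angularTerm c γ (r, 0) := by
  have e : ((r, anglePeriod m r₀) : ℝ × ℝ) = (r, 0) + (0, anglePeriod m r₀) := by simp
  have hd : ∀ i j, dirDeriv (0, 1) (fun y => γ y i j) ((r, 0) + (0, anglePeriod m r₀)) =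
      dirDeriv (0, 1) (fun y => γ y i j) (r, 0) := fun i j => by
    apply dirDeriv_add_right
    filter_upwards [(isOpen_outer r₀).mem_nhds (show ((r, 0) : ℝ × ℝ) ∈ outer r₀ from hr)] with y hy
    rw [K.period_γ hy]
  rw [e]
  simp only [angularTerm, trH, halfLog, hd]
  rw [K.period_c (z := (r, 0)) hr, K.period_γ (z := (r, 0)) hr]

/-- For fixed θ the fundamental theorem of calculus gives the difference of densities. After
exchanging the integrals, the angular term is a θ-derivative of a periodic function and drops out.
-/
theorem CoreData.flux_sub (hr₀ : 0 < r₀) (K : CoreData r₀ c γ W Γ)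
    (D : IsBlockData (outer r₀) a c γ) {r₁ r₂ : ℝ} (h₁ : r₀ < r₁) (h₂ : r₁ ≤ r₂) :
    flux r₀ c γ r₂ - flux r₀ c γ r₁ =
      -∫ r in r₁..r₂, ∫ θ in 0..anglePeriod m r₀, fluxLoss r₀ c γ (r, θ) := by
  have sJ := D.smooth_fluxDensity hr₀
  have cdJ := (sJ.dirDeriv (w := (1, 0)) D.isOpen).continuousOn
  have sA := D.smooth_angularTerm
  have cdA := (sA.dirDeriv (w := (0, 1)) D.isOpen).continuousOn
  have cQ := D.continuousOn_fluxLoss hr₀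
  have e1 : ∀ θ, ∫ r in r₁..r₂, dirDeriv (1, 0) (fluxDensity r₀ c γ) (r, θ) =
      fluxDensity r₀ c γ (r₂, θ) - fluxDensity r₀ c γ (r₁, θ) := fun θ => by
    refine intervalIntegral.integral_eq_sub_of_hasDerivAt (f := fun r => fluxDensity r₀ c γ (r, θ)) (fun r hr => ?_) ?_
    · rw [Set.uIcc_of_le h₂] at hr
      exact hasDerivAt_slice_fst (sJ.differentiableAt_of_isOpen D.isOpen (h₁.trans_le hr.1))
    · refine ContinuousOn.intervalIntegrable (cdJ.comp (by fun_prop) fun r hr => ?_)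
      rw [Set.uIcc_of_le h₂] at hr
      exact h₁.trans_le hr.1
  have e2 : ∀ r, r₀ < r → ∫ θ in 0..anglePeriod m r₀, dirDeriv (1, 0) (fluxDensity r₀ c γ) (r, θ) =
      -∫ θ in 0..anglePeriod m r₀, fluxLoss r₀ c γ (r, θ) := fun r hr => by
    have e3 : ∫ θ in 0..anglePeriod m r₀, dirDeriv (0, 1) (angularTerm c γ) (r, θ) = 0 := by
      rw [intervalIntegral.integral_eq_sub_of_hasDerivAt (f := fun θ => angularTerm c γ (r, θ))
        (fun θ _ => hasDerivAt_slice_snd (sA.differentiableAt_of_isOpen D.isOpen hr))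
        ((cdA.continuous_slice_snd hr).intervalIntegrable _ _), K.angularTerm_period hr, sub_self]
    have e4 : ∀ θ, dirDeriv (1, 0) (fluxDensity r₀ c γ) (r, θ) = -fluxLoss r₀ c γ (r, θ) -
        2 * r ^ (m + 1) / √(hmF m r₀ r) * dirDeriv (0, 1) (angularTerm c γ) (r, θ) := fun θ => by
      rw [fluxLoss]; ring
    simp only [e4]
    rw [intervalIntegral.integral_sub, intervalIntegral.integral_const_mul, e3,
      intervalIntegral.integral_neg]
    · ring
    · exact (cQ.continuous_slice_snd hr).neg.intervalIntegrable _ _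
    · exact ((cdA.continuous_slice_snd hr).const_mul _).intervalIntegrable _ _
  rw [flux, flux, ← intervalIntegral.integral_sub
    ((sJ.continuousOn.continuous_slice_snd (h₁.trans_le h₂)).intervalIntegrable _ _)
    ((sJ.continuousOn.continuous_slice_snd h₁).intervalIntegrable _ _)]
  simp only [← e1]
  rw [← intervalIntegral_intervalIntegral_swap, ← intervalIntegral.integral_neg]
  · refine intervalIntegral.integral_congr fun r hr => ?_
    rw [Set.uIcc_of_le h₂] at hr
    exact e2 r (h₁.trans_le hr.1)
  · have hi : IntegrableOn (dirDeriv (1, 0) (fluxDensity r₀ c γ))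
        (Set.uIcc r₁ r₂ ×ˢ Set.uIcc 0 (anglePeriod m r₀)) volume := by
      refine ContinuousOn.integrableOn_compact (isCompact_uIcc.prod isCompact_uIcc) (cdJ.mono ?_)
      rintro ⟨r, θ⟩ ⟨hr, -⟩
      simp only [Set.uIcc_of_le h₂] at hr
      exact h₁.trans_le hr.1
    exact hi.mono_set (Set.prod_mono Set.uIoc_subset_uIcc Set.uIoc_subset_uIcc)

theorem CoreData.flux_antitone (hr₀ : 0 < r₀) (K : CoreData r₀ c γ W Γ)
    (D : IsBlockData (outer r₀) a c γ) (hQ : ∀ r θ, r₀ < r → 0 ≤ fluxLoss r₀ c γ (r, θ)) :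
    AntitoneOn (flux r₀ c γ) (Set.Ioi r₀) := by
  intro r₁ h₁ r₂ _ h
  have h1 : r₀ < r₁ := h₁
  have := K.flux_sub hr₀ D h1 h
  have h2 : 0 ≤ ∫ r in r₁..r₂, ∫ θ in 0..anglePeriod m r₀, fluxLoss r₀ c γ (r, θ) :=
    intervalIntegral.integral_nonneg h fun r hr => intervalIntegral.integral_nonneg
      (anglePeriod_pos hr₀).le fun θ _ => hQ r θ (h1.trans_le hr.1)
  linarith

/-- A continuous nonnegative loss that is positive at one point has positive integral over a
rectangle containing it, which would make the flux strictly decrease. -/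
theorem CoreData.fluxLoss_eq_zero (hr₀ : 0 < r₀) (K : CoreData r₀ c γ W Γ)
    (D : IsBlockData (outer r₀) a c γ) (hQ : ∀ r θ, r₀ < r → 0 ≤ fluxLoss r₀ c γ (r, θ))
    (hF : ∀ r₁ r₂, r₀ < r₁ → r₀ < r₂ → flux r₀ c γ r₁ = flux r₀ c γ r₂) {r θ : ℝ} (hr : r₀ < r)
    (hθ : θ ∈ Set.Icc 0 (anglePeriod m r₀)) : fluxLoss r₀ c γ (r, θ) = 0 := by
  by_contra h0
  have hpos : 0 < fluxLoss r₀ c γ (r, θ) := lt_of_le_of_ne (hQ r θ hr) (Ne.symm h0)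
  have cQ := D.continuousOn_fluxLoss hr₀
  obtain ⟨r₁, h1, h2⟩ := exists_between hr
  have hin : 0 < ∫ θ in 0..anglePeriod m r₀, fluxLoss r₀ c γ (r, θ) :=
    intervalIntegral.integral_pos (anglePeriod_pos hr₀) (cQ.continuous_slice_snd hr).continuousOn
      (fun t _ => hQ r t hr) ⟨θ, hθ, hpos⟩
  have hcont : ContinuousOn (fun s => ∫ θ in 0..anglePeriod m r₀, fluxLoss r₀ c γ (s, θ))
      (Set.Icc r₁ (r + 1)) := by
    -- Clamping the radius at r₁ makes the integrand continuous on the whole plane without changing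
    -- it on the interval.
    have : Continuous fun s => ∫ θ in 0..anglePeriod m r₀, fluxLoss r₀ c γ (max s r₁, θ) :=
      intervalIntegral.continuous_parametric_intervalIntegral_of_continuous'
        (f := fun s θ => fluxLoss r₀ c γ (max s r₁, θ)) (cQ.continuous_max h1) _ _
    refine this.continuousOn.congr fun s hs => ?_
    simp only [max_eq_left hs.1]
  have hpos2 := intervalIntegral.integral_pos (by linarith : r₁ < r + 1) hcont
    (fun s hs => intervalIntegral.integral_nonneg (anglePeriod_pos hr₀).le
      fun t _ => hQ s t (h1.trans hs.1)) ⟨r, ⟨h2.le, by linarith⟩, hin⟩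
  have := K.flux_sub hr₀ D h1 (by linarith : r₁ ≤ r + 1)
  rw [hF r₁ (r + 1) h1 (by linarith), sub_self] at this
  linarith

/-- The flux density near the core, divided by `√(f / ρ²)`, in terms of `ρ = √(r - r₀)`. -/
def coreDensity (r₀ : ℝ) (W : ℝ × ℝ → ℝ) (Γ : ℝ × ℝ → Matrix (Fin m) (Fin m) ℝ) (z : ℝ × ℝ) : ℝ :=
  2 * (r₀ + z.1 ^ 2) ^ m * √(W z) *
    ((r₀ + z.1 ^ 2) * (1 / 2 + z.1 * (dirDeriv (1, 0) W z / (4 * W z)) + z.1 / 2 * trH (1, 0) Γ z)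
      - (m + 1) * z.1 ^ 2)

/-- The coefficient 1 is a placeholder: the purpose is to reuse the smoothness of ½ Γ⁻¹∂Γ for the
data in ρ = √(r - r₀), up to and including ρ = 0. -/
theorem CoreData.isBlockData_core (K : CoreData r₀ c γ W Γ) :
    IsBlockData Set.univ (fun _ => 1) W Γ where
  isOpen := isOpen_univ
  smooth_a := contDiffOn_const
  smooth_c := K.smooth_W.contDiffOn
  smooth_γ i j := (K.smooth_Γ i j).contDiffOn
  pos_a _ _ := one_pos
  pos_c z _ := K.pos_W z
  symm_γ z i j _ := by simpa using (K.posDef_Γ z).isHermitian.apply j i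
  det_γ z _ := (K.posDef_Γ z).det_pos.ne'
  angle_a _ _ := dirDeriv_const _

theorem CoreData.continuous_coreDensity (K : CoreData r₀ c γ W Γ) :
    Continuous (coreDensity r₀ W Γ) := by
  have D := K.isBlockData_core
  have h1 : Continuous (trH (1, 0) Γ) := by
    rw [← continuousOn_univ]; exact (D.smooth_trH _).continuousOn
  have h2 : Continuous (dirDeriv (1, 0) W) := by
    rw [← continuousOn_univ]; exact (D.smooth_c.dirDeriv isOpen_univ).continuousOn
  have h3 : Continuous W := K.smooth_W.continuous
  have h4 : Continuous fun z => dirDeriv (1, 0) W z / (4 * W z) :=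
    h2.div (continuous_const.mul h3) fun z => (mul_pos (by norm_num) (K.pos_W z)).ne'
  unfold coreDensity
  fun_prop

/-- With c = ρ²W one has √f √c = √(f/ρ²) · ρ²√W. The factor ρ² absorbs the singular part 1/(2ρ²) of
∂_r c/(2c), as well as the 1/(2ρ) from the chain rule, so the rest is continuous at the core. -/
theorem CoreData.fluxDensity_eq (hr₀ : 0 < r₀) (K : CoreData r₀ c γ W Γ) {r θ : ℝ} (hr : r₀ < r) :
    fluxDensity r₀ c γ (r, θ) =
      √(hmF m r₀ r / (r - r₀)) * coreDensity r₀ W Γ (√(r - r₀), θ) := by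
  have D := K.isBlockData_core
  have hs : 0 < r - r₀ := sub_pos.2 hr
  have hρ : 0 < √(r - r₀) := Real.sqrt_pos.2 hs
  have dρ : HasDerivAt (fun s => √(s - r₀)) (1 / (2 * √(r - r₀))) r :=
    ((hasDerivAt_id r).sub_const r₀).sqrt hs.ne'
  have dcomp : ∀ {h : ℝ × ℝ → ℝ}, ContDiff ℝ ∞ h →
      HasDerivAt (fun s => h (√(s - r₀), θ))
        (dirDeriv (1, 0) h (√(r - r₀), θ) * (1 / (2 * √(r - r₀)))) r := fun {h} hh =>
    HasDerivAt.comp r (hasDerivAt_slice_fst ((hh.differentiable (by simp)) (√(r - r₀), θ))) dρ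
  have K0 := K.isBlockData hr₀ (a := fun z => 1 / hmF m r₀ z.1) fun _ _ => rfl
  have hz : ((r, θ) : ℝ × ℝ) ∈ outer r₀ := hr
  have ec : dirDeriv (1, 0) c (r, θ) = W (√(r - r₀), θ) +
      (r - r₀) * (dirDeriv (1, 0) W (√(r - r₀), θ) * (1 / (2 * √(r - r₀)))) := by
    refine (hasDerivAt_slice_fst (K0.dC hz)).unique ?_
    have := (((hasDerivAt_id r).sub_const r₀).mul (dcomp K.smooth_W)).congr_of_eventuallyEq
      (f₁ := fun s => c (s, θ)) (by
        filter_upwards [Ioi_mem_nhds hr] with s hs using K.c_eq (s, θ) hs)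
    simpa using this
  have eγ : ∀ i j, dirDeriv (1, 0) (fun y => γ y i j) (r, θ) =
      dirDeriv (1, 0) (fun y => Γ y i j) (√(r - r₀), θ) * (1 / (2 * √(r - r₀))) := fun i j => by
    refine (hasDerivAt_slice_fst (K0.dγ hz i j)).unique ?_
    refine (dcomp (K.smooth_Γ i j)).congr_of_eventuallyEq ?_
    filter_upwards [Ioi_mem_nhds hr] with s hs
    rw [K.γ_eq (s, θ) hs]
  have eH : trH (1, 0) γ (r, θ) = 1 / (2 * √(r - r₀)) * trH (1, 0) Γ (√(r - r₀), θ) := by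
    simp only [trH, halfLog, eγ, K.γ_eq (r, θ) hr, Finset.mul_sum]
    refine Finset.sum_congr rfl fun i _ => Finset.sum_congr rfl fun j _ => by ring
  have hW := K.pos_W (√(r - r₀), θ)
  have hsq : √(r - r₀) ^ 2 = r - r₀ := Real.sq_sqrt hs.le
  rw [fluxDensity, coreDensity, ec, eH, K.c_eq (r, θ) hr, Real.sqrt_div' _ hs.le,
    Real.sqrt_mul hs.le]
  dsimp only
  generalize dirDeriv (1, 0) W (√(r - r₀), θ) = W1
  generalize trH (1, 0) Γ (√(r - r₀), θ) = X
  have hsW := Real.sqrt_pos.2 hW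
  generalize W (√(r - r₀), θ) = W0 at *
  generalize √(r - r₀) = ρ at *
  rw [← hsq]
  have : r = r₀ + ρ ^ 2 := by linarith
  rw [← this]
  field_simp
  ring

theorem tendsto_core_factor (hr₀ : 0 < r₀) :
    Tendsto (fun r => √(hmF m r₀ r / (r - r₀))) (𝓝[>] r₀) (𝓝 √((m + 2) * r₀)) := by
  refine (Real.continuous_sqrt.tendsto _).comp ?_
  have h1 : Tendsto (fun r => r - r₀) (𝓝[>] r₀) (𝓝[>] 0) := by
    refine tendsto_nhdsWithin_iff.2 ⟨?_, ?_⟩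
    · have : Tendsto (fun r => r - r₀) (𝓝 r₀) (𝓝 (r₀ - r₀)) :=
        (continuous_sub_right r₀).tendsto r₀
      simpa using this.mono_left nhdsWithin_le_nhds
    · filter_upwards [self_mem_nhdsWithin] with r hr using sub_pos.2 (Set.mem_Ioi.1 hr)
  refine ((tendsto_hmF_div (m := m) hr₀.ne').comp h1).congr fun r => ?_
  simp

theorem tendsto_sqrt_sub : Tendsto (fun r => √(r - r₀)) (𝓝[>] r₀) (𝓝 0) := by
  have : Continuous fun r => √(r - r₀) := by fun_prop
  have := this.tendsto r₀
  simp only [sub_self, Real.sqrt_zero] at this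
  exact this.mono_left nhdsWithin_le_nhds

/-- At ρ = 0 only the term 1/2 survives; the value W = n r₀ at the core supplies the second square
root. -/
theorem CoreData.coreDensity_zero (K : CoreData r₀ c γ W Γ) (hr₀ : 0 < r₀) (θ : ℝ) :
    √((m + 2) * r₀) * coreDensity r₀ W Γ (0, θ) = (m + 2) * r₀ ^ (m + 2) := by
  have h : √((m + 2) * r₀) * √((m + 2) * r₀) = (m + 2) * r₀ := Real.mul_self_sqrt (by positivity)
  simp only [coreDensity, K.W_core]
  calc _ = (√((m + 2) * r₀) * √((m + 2) * r₀)) * r₀ ^ (m + 1) := by simp; ring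
    _ = _ := by rw [h]; ring

/-- The limit of the flux density at the core. -/
theorem CoreData.tendsto_fluxDensity (hr₀ : 0 < r₀) (K : CoreData r₀ c γ W Γ) (θ : ℝ) :
    Tendsto (fun r => fluxDensity r₀ c γ (r, θ)) (𝓝[>] r₀) (𝓝 ((m + 2) * r₀ ^ (m + 2))) := by
  have h1 : Tendsto (fun r => coreDensity r₀ W Γ (√(r - r₀), θ)) (𝓝[>] r₀)
      (𝓝 (coreDensity r₀ W Γ (0, θ))) :=
    ((K.continuous_coreDensity.comp (by fun_prop : Continuous fun ρ : ℝ => (ρ, θ))).tendsto 0).comp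
      tendsto_sqrt_sub
  rw [← K.coreDensity_zero hr₀ θ]
  refine ((tendsto_core_factor hr₀).mul h1).congr' ?_
  filter_upwards [self_mem_nhdsWithin] with r hr using (K.fluxDensity_eq hr₀ hr).symm

/-- The limit of the flux at the core. -/
theorem CoreData.tendsto_flux (hr₀ : 0 < r₀) (K : CoreData r₀ c γ W Γ) :
    Tendsto (flux r₀ c γ) (𝓝[>] r₀) (𝓝 (anglePeriod m r₀ * ((m + 2) * r₀ ^ (m + 2)))) := by
  have hc : Continuous fun ρ : ℝ => ∫ θ in 0..anglePeriod m r₀, coreDensity r₀ W Γ (ρ, θ) :=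
    intervalIntegral.continuous_parametric_intervalIntegral_of_continuous'
      (f := fun ρ θ => coreDensity r₀ W Γ (ρ, θ)) K.continuous_coreDensity _ _
  have h1 := (tendsto_core_factor (m := m) hr₀).mul ((hc.tendsto 0).comp tendsto_sqrt_sub)
  rw [← intervalIntegral.integral_const_mul] at h1
  simp only [K.coreDensity_zero hr₀, intervalIntegral.integral_const, smul_eq_mul, sub_zero] at h1
  refine h1.congr' ?_
  filter_upwards [self_mem_nhdsWithin] with r hr
  rw [flux, Function.comp, ← intervalIntegral.integral_const_mul]
  exact intervalIntegral.integral_congr fun θ _ => (K.fluxDensity_eq hr₀ hr).symm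

end

/-! ### The mass integrand -/

section
variable {m : ℕ} {r₀ : ℝ} {a c : ℝ × ℝ → ℝ} {γ : ℝ × ℝ → Matrix (Fin m) (Fin m) ℝ}

/-- This makes the block Christoffel formulas available for the background connection in the mass
integral. -/
theorem hmMetric_eq_blockG : hmMetric m r₀ = blockG (fun z => 1 / hmF m r₀ z.1)
    (fun z => hmF m r₀ z.1) (fun z => Matrix.diagonal fun _ => z.1 ^ 2) := by
  ext p i j
  rcases i with i | i <;> rcases j with j | j
  · fin_cases i <;> fin_cases j <;> simp [hmMetric, blockG, radAng_apply, Matrix.diagonal_apply]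
  · simp [hmMetric, blockG]
  · simp [hmMetric, blockG]
  · simp [hmMetric, blockG, radAng_apply, Matrix.diagonal_apply]

theorem isBlockData_hm (hr₀ : 0 < r₀) : IsBlockData (outer r₀) (fun z => 1 / hmF m r₀ z.1)
    (fun z => hmF m r₀ z.1)
    (fun z => (Matrix.diagonal fun _ => z.1 ^ 2 : Matrix (Fin m) (Fin m) ℝ)) where
  isOpen := isOpen_outer r₀
  smooth_a := contDiffOn_const.div (contDiffOn_hmF_fst hr₀) fun z hz => (hmF_pos hr₀ hz).ne'
  smooth_c := contDiffOn_hmF_fst hr₀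
  smooth_γ i j := by
    by_cases h : i = j
    · subst h; simpa using (contDiff_fst.pow 2).contDiffOn
    · simpa [h] using contDiffOn_const
  pos_a z hz := one_div_pos.2 (hmF_pos hr₀ hz)
  pos_c z hz := hmF_pos hr₀ hz
  symm_γ z i j _ := by simp [Matrix.diagonal_apply, eq_comm]
  det_γ z hz := by
    have : 0 < z.1 := hr₀.trans hz
    rw [Matrix.det_diagonal]
    exact (Finset.prod_pos fun _ _ => pow_pos this 2).ne'
  angle_a z hz := by
    have h1 := ((hasDerivAt_hmF (m := m) (r₀ := r₀) (hr₀.trans hz).ne').inv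
      (hmF_pos hr₀ hz).ne').comp_hasFDerivAt z (hasFDerivAt_fst (𝕜 := ℝ))
    rw [dirDeriv]
    simp only [one_div]
    rw [show (fun z : ℝ × ℝ => (hmF m r₀ z.1)⁻¹) = (hmF m r₀)⁻¹ ∘ Prod.fst from rfl, h1.fderiv]
    simp

theorem dirDeriv_fst_comp {F : ℝ → ℝ} {F' : ℝ} {z : ℝ × ℝ} (w : ℝ × ℝ) (hF : HasDerivAt F F' z.1) :
    dirDeriv w (fun z => F z.1) z = F' * w.1 := by
  rw [dirDeriv_comp hF differentiableAt_fst, dirDeriv, fderiv_fst]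
  rfl

variable {r θ : ℝ}

theorem halfLog_hm (hr : r ≠ 0) :
    halfLog (1, 0) (fun z => (Matrix.diagonal fun _ => z.1 ^ 2 : Matrix (Fin m) (Fin m) ℝ)) (r, θ) =
      (1 / r) • 1 := by
  have h : (Matrix.of fun i j => dirDeriv (1, 0) (fun y : ℝ × ℝ =>
      (Matrix.diagonal fun _ => y.1 ^ 2 : Matrix (Fin m) (Fin m) ℝ) i j) (r, θ) / 2) =
      (1 / r) • (Matrix.diagonal fun _ => r ^ 2) := by
    ext i j
    by_cases hij : i = j
    · subst hij
      simp [dirDeriv_fst_comp (1, 0) (z := (r, θ)) (hasDerivAt_pow 2 r)]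
      field_simp
    · simp [hij, dirDeriv_const]
  rw [halfLog_eq, h, Matrix.mul_smul, Matrix.nonsing_inv_mul]
  rw [Matrix.det_diagonal]
  exact (Finset.prod_ne_zero_iff.2 fun _ _ => pow_ne_zero 2 hr).isUnit

theorem sqrt_det_hmMetric (hr₀ : 0 < r₀) {p : Idx m → ℝ} (hp : r₀ < p (Sum.inl 0)) :
    √(hmMetric m r₀ p).det = p (Sum.inl 0) ^ m := by
  have hr' : 0 < p (Sum.inl 0) := hr₀.trans hp
  rw [hmMetric, Matrix.det_diagonal, Fintype.prod_sum_type]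
  simp
  rw [inv_mul_cancel₀ (hmF_pos hr₀ hp).ne', one_mul, ← pow_mul, mul_comm, pow_mul]
  exact Real.sqrt_sq (by positivity)

/-- The integrand of the mass flux, including the area factor `r ^ m`. -/
def massDensity (r₀ : ℝ) (c : ℝ × ℝ → ℝ) (γ : ℝ × ℝ → Matrix (Fin m) (Fin m) ℝ) (z : ℝ × ℝ) : ℝ :=
  z.1 ^ m * (z.1 * hmF m r₀ z.1 * (hmF' m r₀ z.1 / (2 * c z) +
    hmF' m r₀ z.1 / (2 * hmF m r₀ z.1) - dirDeriv (1, 0) c z / c z + m / z.1 - 2 * trH (1, 0) γ z) +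
    hmF m r₀ z.1 * (1 + m - hmF m r₀ z.1 / c z))

/-- As g_rr = b_rr, only the θθ and torus components contribute. The terms r² f tr γ⁻¹ from the
derivative part and from the part with DV cancel, so γ enters only through tr(½ γ⁻¹∂_r γ), as it
does in the flux density. -/
theorem IsBlockData.massVector_eq (hr₀ : 0 < r₀) (D : IsBlockData (outer r₀) a c γ)
    (ha : ∀ z : ℝ × ℝ, r₀ < z.1 → a z = 1 / hmF m r₀ z.1) {p : Idx m → ℝ}
    (hp : radAng m p ∈ outer r₀) :
    massVector (hmMetric m r₀) hmPotential (blockG a c γ) (Sum.inl 0) p *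
      √(hmMetric m r₀ p).det = massDensity r₀ c γ (radAng m p) := by
  obtain ⟨r, θ, hz⟩ : ∃ r θ, radAng m p = (r, θ) := ⟨_, _, rfl⟩
  have hr : r₀ < r := by rw [hz] at hp; exact hp
  have hr' : 0 < r := hr₀.trans hr
  have hf := hmF_pos (m := m) hr₀ hr
  have hc := D.pos_c _ hp
  have hdet : √(hmMetric m r₀ p).det = r ^ m := by
    have e1 : p (Sum.inl 0) = r := congrArg Prod.fst hz
    rw [sqrt_det_hmMetric hr₀ (by rwa [e1]), e1]
  have hV : ∀ k, partialDeriv k (hmPotential (m := m)) p = if k = Sum.inl 0 then 1 else 0 := by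
    intro k
    rw [partialDeriv, show (hmPotential (m := m)) = fun q => q (Sum.inl 0) from rfl,
      (hasFDerivAt_apply (𝕜 := ℝ) (Sum.inl 0 : Idx m) p).fderiv]
    simp [Pi.single_apply, eq_comm]
  have df := hasDerivAt_hmF (m := m) (r₀ := r₀) hr'.ne'
  have dfc : dirDeriv (1, 0) (fun z : ℝ × ℝ => hmF m r₀ z.1) (r, θ) = hmF' m r₀ r := by
    rw [dirDeriv_fst_comp (z := (r, θ)) (1, 0) df]; simp
  obtain ⟨h1, h2, h3, h4, h5, h6, h7, h8, h9, h10, h11, h12⟩ :=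
    (isBlockData_hm (m := m) hr₀).christoffel_blockG hp
  have hh := halfLog_hm (m := m) (θ := θ) hr'.ne'
  have hγ2 : ∀ A B, dirDeriv (1, 0) (fun y : ℝ × ℝ =>
      (Matrix.diagonal fun _ => y.1 ^ 2 : Matrix (Fin m) (Fin m) ℝ) A B) (r, θ) =
      if A = B then 2 * r else 0 := fun A B => by
    by_cases hij : A = B
    · subst hij
      simp [dirDeriv_fst_comp (1, 0) (z := (r, θ)) (hasDerivAt_pow 2 r)]
    · simp [hij, dirDeriv_const]
  have hb : ∀ (i j : Idx m), hmMetric m r₀ p i j = blockG (fun z => 1 / hmF m r₀ z.1)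
    (fun z => hmF m r₀ z.1) (fun z => Matrix.diagonal fun _ => z.1 ^ 2) p i j := fun i j => by
      rw [hmMetric_eq_blockG]
  have hBG : ∀ i j, blockG a c γ p i j = Matrix.fromBlocks (Matrix.diagonal ![1 / hmF m r₀ r,
      c (r, θ)]) 0 0 (γ (r, θ)) i j := fun i j => by rw [blockG, hz, ha _ (by exact hr)]
  simp only [hz, hh, hγ2, dfc] at h1 h2 h3 h4 h5 h6 h7 h8 h9 h10 h11 h12
  have c1 : covDeriv (hmMetric m r₀) (blockG a c γ) (Sum.inl 1) (Sum.inl 1) (Sum.inl 0) p =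
      hmF' m r₀ r / 2 - hmF' m r₀ r / (2 * hmF m r₀ r) * c (r, θ) := by
    simp only [covDeriv, hmMetric_eq_blockG, Fintype.sum_sum_type, Fin.sum_univ_two, h1, h2, h3, h4,
      h5, h6, h7, h8, h9, h10, h11, h12, hBG, partialDeriv_tr]
    simp
    field_simp
    ring
  have c2 : covDeriv (hmMetric m r₀) (blockG a c γ) (Sum.inl 0) (Sum.inl 1) (Sum.inl 1) p =
      dirDeriv (1, 0) c (r, θ) - hmF' m r₀ r / hmF m r₀ r * c (r, θ) := by
    simp only [covDeriv, hmMetric_eq_blockG, Fintype.sum_sum_type, Fin.sum_univ_two, h1, h2, h3, h4,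
      h5, h6, h7, h8, h9, h10, h11, h12, hBG, D.partialDeriv_tt hp, radAng_single_zero, hz]
    simp
    field_simp
    ring
  have c3 : ∀ A B, covDeriv (hmMetric m r₀) (blockG a c γ) (Sum.inr A) (Sum.inr B) (Sum.inl 0) p =
      (if A = B then r else 0) - γ (r, θ) B A / r := fun A B => by
    simp only [covDeriv, hmMetric_eq_blockG, Fintype.sum_sum_type, Fin.sum_univ_two, h1, h2, h3, h4,
      h5, h6, h7, h8, h9, h10, h11, h12, hBG, partialDeriv_rl]
    by_cases hAB : A = B
    · subst hAB
      simp [Matrix.one_apply]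
      field_simp
      ring
    · simp [hAB, Matrix.one_apply]
      field_simp
  have c4 : ∀ A B, covDeriv (hmMetric m r₀) (blockG a c γ) (Sum.inl 0) (Sum.inr B) (Sum.inr A) p =
      dirDeriv (1, 0) (fun y => γ y B A) (r, θ) - 2 * γ (r, θ) B A / r := fun A B => by
    simp only [covDeriv, hmMetric_eq_blockG, Fintype.sum_sum_type, Fin.sum_univ_two, h1, h2, h3, h4,
      h5, h6, h7, h8, h9, h10, h11, h12, hBG, D.partialDeriv_AB hp, radAng_single_zero, hz]
    simp [Matrix.one_apply, Finset.sum_add_distrib]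
    field_simp
    ring
  have t1 : ∑ A, ∑ B, (γ (r, θ))⁻¹ A B * γ (r, θ) B A = m := by
    simp only [D.sum_inv_mul (z := (r, θ)) hr]
    simp
  have t2 : ∑ A, ∑ B, (γ (r, θ))⁻¹ A B * dirDeriv (1, 0) (fun y => γ y B A) (r, θ) =
      2 * trH (1, 0) γ (r, θ) := by
    simp only [IsBlockData.sum_inv_dirDeriv, trH, Finset.mul_sum]
  have t3 : ∑ A, ∑ B, (γ (r, θ))⁻¹ A B * (if A = B then r else 0) =
      r * (γ (r, θ))⁻¹.trace := by
    simp [Matrix.trace, Finset.mul_sum, mul_comm]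
  have t4 : ∑ A, ∑ B, (γ (r, θ))⁻¹ A B * (Matrix.diagonal (fun _ => r ^ 2) : Matrix _ _ ℝ) B A =
      r ^ 2 * (γ (r, θ))⁻¹.trace := by
    simp [Matrix.trace, Finset.mul_sum, mul_comm, Matrix.diagonal_apply]
  have s1 : ∑ A, ∑ B, (γ (r, θ))⁻¹ A B * (((if A = B then r else 0) - γ (r, θ) B A / r) -
      (dirDeriv (1, 0) (fun y => γ y B A) (r, θ) - 2 * γ (r, θ) B A / r)) =
      -- The trace of γ⁻¹ here is cancelled by the one in `s2`.
      r * (γ (r, θ))⁻¹.trace + m / r - 2 * trH (1, 0) γ (r, θ) := by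
    rw [← t1, ← t2, ← t3, Finset.sum_div, ← Finset.sum_add_distrib, ← Finset.sum_sub_distrib]
    refine Finset.sum_congr rfl fun A _ => ?_
    rw [Finset.sum_div, ← Finset.sum_add_distrib, ← Finset.sum_sub_distrib]
    refine Finset.sum_congr rfl fun B _ => ?_
    ring
  have s2 : ∑ A, ∑ B, (γ (r, θ))⁻¹ A B * (γ (r, θ) B A -
      (Matrix.diagonal (fun _ => r ^ 2) : Matrix _ _ ℝ) B A) = m - r ^ 2 * (γ (r, θ))⁻¹.trace := by
    rw [← t1, ← t4, ← Finset.sum_sub_distrib]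
    refine Finset.sum_congr rfl fun A _ => ?_
    rw [← Finset.sum_sub_distrib]
    refine Finset.sum_congr rfl fun B _ => ?_
    ring
  have hVp : hmPotential p = r := congrArg Prod.fst hz
  rw [hdet, massVector]
  simp only [hV, hVp, D.inv_blockG hp, hz, ha (r, θ) hr, Fintype.sum_sum_type, Fin.sum_univ_two,
    Matrix.fromBlocks_apply₁₁, Matrix.fromBlocks_apply₁₂, Matrix.fromBlocks_apply₂₁,
    Matrix.fromBlocks_apply₂₂, Matrix.zero_apply, Matrix.diagonal_apply, hBG, hb]
  simp [c1, c2, c3, c4, blockG, hz]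
  have e1 : ∀ k : ℝ, ∀ F : Fin m → Fin m → ℝ, ∑ A, ∑ B, k * (γ (r, θ))⁻¹ A B * hmF m r₀ r * F A B =
      k * hmF m r₀ r * ∑ A, ∑ B, (γ (r, θ))⁻¹ A B * F A B := fun k F => by
    simp only [Finset.mul_sum]
    exact Finset.sum_congr rfl fun A _ => Finset.sum_congr rfl fun B _ => by ring
  have e2 := e1 1
  simp only [one_mul] at e2
  rw [hz] at hc
  rw [e1, e2, s1, s2, massDensity]
  field_simp
  ring

/-! ### Second-order agreement of the mass integrand and the flux density. -/

/-- The part of the deviation from the Horowitz-Myers metric that controls the mass integrand. -/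
def radialDeviation (r₀ : ℝ) (c : ℝ × ℝ → ℝ) (γ : ℝ × ℝ → Matrix (Fin m) (Fin m) ℝ)
    (z : ℝ × ℝ) : ℝ :=
  (c z / hmF m r₀ z.1 - 1) ^ 2 +
    (∑ i, ∑ j, (γ z i j / z.1 ^ 2 - (1 : Matrix (Fin m) (Fin m) ℝ) i j) ^ 2) +
    hmF m r₀ z.1 * dirDeriv (1, 0) (fun y => c y / hmF m r₀ y.1) z ^ 2 +
    ∑ i, ∑ j, hmF m r₀ z.1 * dirDeriv (1, 0) (fun y => γ y i j / y.1 ^ 2) z ^ 2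

/-- Multiplied by r^m, the left side is the flux density of the background, hence the constant n
r₀^n. -/
theorem mul_hmF'_eq (r₀ r : ℝ) :
    r * hmF' m r₀ r - 2 * hmF m r₀ r = (m + 2) * r ^ 2 * (r₀ / r) ^ (m + 2) := by
  simp only [hmF, hmF']; ring

theorem hmF_le (hr₀ : 0 < r₀) (hr : r₀ < r) : hmF m r₀ r ≤ r ^ 2 := by
  have h : 0 ≤ (r₀ / r) ^ (m + 2) := pow_nonneg (div_nonneg hr₀.le (hr₀.trans hr).le) _
  unfold hmF
  nlinarith [sq_nonneg r]

theorem dirDeriv_c_div (hr₀ : 0 < r₀) (D : IsBlockData (outer r₀) a c γ) (hr : r₀ < r) :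
    dirDeriv (1, 0) (fun y => c y / hmF m r₀ y.1) (r, θ) =
      c (r, θ) / hmF m r₀ r * (dirDeriv (1, 0) c (r, θ) / c (r, θ) - hmF' m r₀ r / hmF m r₀ r) := by
  have hz : ((r, θ) : ℝ × ℝ) ∈ outer r₀ := hr
  have hf := hmF_pos (m := m) hr₀ hr
  have hc := D.pos_c _ hz
  have h1 := (hasDerivAt_slice_fst (D.dC hz)).div (hasDerivAt_hmF (m := m) (r₀ := r₀)
    (hr₀.trans hr).ne') hf.ne'
  have h2 : DifferentiableAt ℝ (fun y : ℝ × ℝ => c y / hmF m r₀ y.1) (r, θ) :=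
    (D.smooth_c.div (contDiffOn_hmF_fst hr₀) fun z hz => (hmF_pos hr₀ hz).ne').differentiableAt_of_isOpen
      D.isOpen hz
  rw [(hasDerivAt_slice_fst h2).unique h1]
  field_simp

theorem dirDeriv_γ_div (hr₀ : 0 < r₀) (D : IsBlockData (outer r₀) a c γ) (hr : r₀ < r)
    (i j : Fin m) : dirDeriv (1, 0) (fun y => γ y i j / y.1 ^ 2) (r, θ) =
      (dirDeriv (1, 0) (fun y => γ y i j) (r, θ) - 2 / r * γ (r, θ) i j) / r ^ 2 := by
  have hz : ((r, θ) : ℝ × ℝ) ∈ outer r₀ := hr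
  have hr' := (hr₀.trans hr)
  have h1 := (hasDerivAt_slice_fst (D.dγ hz i j)).div (hasDerivAt_pow 2 r) (pow_ne_zero 2 hr'.ne')
  have h2 : DifferentiableAt ℝ (fun y : ℝ × ℝ => γ y i j / y.1 ^ 2) (r, θ) :=
    ((D.smooth_γ i j).div (contDiffOn_fst.pow 2)
      fun z hz => pow_ne_zero 2 (hr₀.trans hz).ne').differentiableAt_of_isOpen D.isOpen hz
  rw [(hasDerivAt_slice_fst h2).unique h1]
  field_simp
  simp
  field_simp

/-- On the background A = 1 and B = τ = 0. Expanding around it, the linear terms cancel exactly,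
leaving a multiple of (A - 1)² and a product of B + τ with 1 - A. -/
theorem massDensity_sub (hr₀ : 0 < r₀) (D : IsBlockData (outer r₀) a c γ) (hr : r₀ < r) {A B τ : ℝ}
    (hA : A = √(c (r, θ)) / √(hmF m r₀ r))
    (hB : B = dirDeriv (1, 0) c (r, θ) / (2 * c (r, θ)) - hmF' m r₀ r / (2 * hmF m r₀ r))
    (hτ : τ = trH (1, 0) γ (r, θ) - m / r) :
    massDensity r₀ c γ (r, θ) - ((m + 2) * r₀ ^ (m + 2) - fluxDensity r₀ c γ (r, θ)) =
      r ^ m * ((m + 2) / 2 * r ^ 2 * (r₀ / r) ^ (m + 2) * ((A - 1) ^ 2 * (2 * A + 1) / A ^ 2) -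
        2 * r * hmF m r₀ r * (B + τ) * (1 - A)) := by
  have hz : ((r, θ) : ℝ × ℝ) ∈ outer r₀ := hr
  have hr' : 0 < r := hr₀.trans hr
  have hf := hmF_pos (m := m) hr₀ hr
  have hc := D.pos_c _ hz
  have hsf := Real.sqrt_pos.2 hf
  have hsc := Real.sqrt_pos.2 hc
  have q1 : hmF m r₀ r = √(hmF m r₀ r) ^ 2 := (Real.sq_sqrt hf.le).symm
  have q2 : c (r, θ) = √(c (r, θ)) ^ 2 := (Real.sq_sqrt hc.le).symm
  have e1 : (m + 2) * r₀ ^ (m + 2) = r ^ m * (r * hmF' m r₀ r - 2 * hmF m r₀ r) := by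
    rw [mul_hmF'_eq, ← pow_mul_hmQ (m := m) (r₀ := r₀) hr'.ne']; ring
  have e2 : (m + 2) / 2 * r ^ 2 * (r₀ / r) ^ (m + 2) = (r * hmF' m r₀ r - 2 * hmF m r₀ r) / 2 := by
    rw [mul_hmF'_eq]; ring
  rw [e1, e2, massDensity, fluxDensity, hA, hB, hτ]
  dsimp only
  generalize √(hmF m r₀ r) = f at *
  generalize √(c (r, θ)) = C at *
  rw [q1, q2]
  field_simp
  ring

/-- The elementary estimate of the quadratic error terms. -/
theorem error_estimate {A r s y B τ C q : ℝ} {w P : Fin m → Fin m → ℝ} (hA0 : 0 < A)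
    (hAC : 1 / A ^ 2 ≤ C) (hsf : 0 < s) (hsr : s ≤ r) (hBy : s * B = y * (1 / A ^ 2) / 2)
    (hτw : s * τ = (∑ i, ∑ j, P i j * w j i) / 2) (h2 : ∀ i j, |P i j| ≤ C) (hq0 : 0 ≤ q)
    (hq1 : q ≤ 1) :
    |r ^ m * ((m + 2) / 2 * r ^ 2 * q * ((A - 1) ^ 2 * (2 * A + 1) / A ^ 2) -
        2 * r * s ^ 2 * (B + τ) * (1 - A))| ≤
      ((m + 2) / 2 * (1 + 2 * C) + C / 2 + C / 2 * (1 + m ^ 2)) *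
        (r ^ (m + 2) * ((A ^ 2 - 1) ^ 2 + y ^ 2 + ∑ i, ∑ j, w i j ^ 2)) := by
  have hr' : 0 < r := hsf.trans_le hsr
  have hC : 0 < C := lt_of_lt_of_le (by positivity) hAC
  obtain ⟨X, hX⟩ : ∃ X, X = |A ^ 2 - 1| := ⟨_, rfl⟩
  have hX0 : 0 ≤ X := by rw [hX]; positivity
  -- A² - 1 = (A - 1)(A + 1) and A + 1 ≥ 1. The deviation controls A² = c/f rather than A.
  have hAX : |1 - A| ≤ X := by
    rw [hX, show A ^ 2 - 1 = (A - 1) * (A + 1) by ring, abs_mul, abs_sub_comm]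
    have : 1 ≤ |A + 1| := by rw [abs_of_pos (by linarith)]; linarith
    nlinarith [abs_nonneg (A - 1)]
  have b1 : (A - 1) ^ 2 * (2 * A + 1) / A ^ 2 ≤ (1 + 2 * C) * X ^ 2 := by
    have e : (A - 1) ^ 2 * (2 * A + 1) / A ^ 2 = (A - 1) ^ 2 * ((2 * A + 1) / A ^ 2) := by ring
    have e2 : (2 * A + 1) / A ^ 2 ≤ 1 + 2 * C := by
      have : (2 * A + 1) / A ^ 2 ≤ 1 + 2 * (1 / A ^ 2) := by
        rw [← sub_nonneg]
        have : 1 + 2 * (1 / A ^ 2) - (2 * A + 1) / A ^ 2 = (A - 1) ^ 2 / A ^ 2 := by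
          field_simp; ring
        rw [this]; positivity
      linarith
    have e3 : (A - 1) ^ 2 ≤ X ^ 2 := by
      rw [← sq_abs, abs_sub_comm]; exact pow_le_pow_left₀ (abs_nonneg _) hAX 2
    rw [e, mul_comm]
    exact mul_le_mul e2 e3 (sq_nonneg _) (by linarith)
  have b1' : 0 ≤ (A - 1) ^ 2 * (2 * A + 1) / A ^ 2 := by positivity
  have b2 : 2 * |s * B| * |1 - A| ≤ C / 2 * (y ^ 2 + X ^ 2) := by
    have e : 2 * |s * B| ≤ C * |y| := by
      rw [hBy, abs_div, abs_mul, abs_of_pos (by positivity : 0 < 1 / A ^ 2), abs_two]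
      nlinarith [abs_nonneg y]
    calc _ ≤ C * |y| * X := mul_le_mul e hAX (abs_nonneg _) (by positivity)
      _ ≤ C / 2 * (y ^ 2 + X ^ 2) := by
        nlinarith [mul_nonneg hC.le (sq_nonneg (|y| - X)), sq_abs y]
  -- The arithmetic-geometric inequality is applied to each of the m² entries, hence m² X².
  have b3 : 2 * |s * τ| * |1 - A| ≤ C / 2 * (∑ i, ∑ j, w i j ^ 2 + m ^ 2 * X ^ 2) := by
    have e : 2 * |s * τ| ≤ ∑ i, ∑ j, C * |w j i| := by
      rw [hτw, abs_div, abs_two, mul_div_cancel₀ _ two_ne_zero]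
      refine (Finset.abs_sum_le_sum_abs _ _).trans (Finset.sum_le_sum fun i _ => ?_)
      refine (Finset.abs_sum_le_sum_abs _ _).trans (Finset.sum_le_sum fun j _ => ?_)
      rw [abs_mul]
      exact mul_le_mul_of_nonneg_right (h2 i j) (abs_nonneg _)
    calc _ ≤ (∑ i, ∑ j, C * |w j i|) * X := mul_le_mul e hAX (abs_nonneg _)
          (Finset.sum_nonneg fun _ _ => Finset.sum_nonneg fun _ _ => by positivity)
      _ = ∑ i, ∑ j, C * |w i j| * X := by
        rw [Finset.sum_comm, Finset.sum_mul]
        exact Finset.sum_congr rfl fun _ _ => by rw [Finset.sum_mul]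
      _ ≤ ∑ i, ∑ j, (C / 2 * (w i j) ^ 2 + C / 2 * X ^ 2) := by
        refine Finset.sum_le_sum fun i _ => Finset.sum_le_sum fun j _ => ?_
        nlinarith [mul_nonneg hC.le (sq_nonneg (|w i j| - X)), sq_abs (w i j)]
      _ = _ := by
        simp only [Finset.sum_add_distrib, Finset.sum_const, Finset.card_univ, Fintype.card_fin,
          nsmul_eq_mul, ← Finset.mul_sum]
        ring
  have hw0 : 0 ≤ ∑ i, ∑ j, w i j ^ 2 :=
    Finset.sum_nonneg fun _ _ => Finset.sum_nonneg fun _ _ => sq_nonneg _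
  rw [abs_mul, abs_of_pos (pow_pos hr' m)]
  have f1 : |(m + 2) / 2 * r ^ 2 * q * ((A - 1) ^ 2 * (2 * A + 1) / A ^ 2)| ≤
      r ^ 2 * ((m + 2) / 2 * (1 + 2 * C) * X ^ 2) := by
    rw [abs_of_nonneg (by positivity)]
    calc _ = r ^ 2 * (((m : ℝ) + 2) / 2) * (q * ((A - 1) ^ 2 * (2 * A + 1) / A ^ 2)) := by ring
      _ ≤ r ^ 2 * (((m : ℝ) + 2) / 2) * (1 * ((1 + 2 * C) * X ^ 2)) :=
        mul_le_mul_of_nonneg_left (mul_le_mul hq1 b1 b1' zero_le_one) (by positivity)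
      _ = _ := by ring
  have f2 : |2 * r * s ^ 2 * (B + τ) * (1 - A)| ≤ r ^ 2 * (C / 2 * (y ^ 2 + X ^ 2) +
      C / 2 * (∑ i, ∑ j, w i j ^ 2 + m ^ 2 * X ^ 2)) := by
    have e : 2 * r * s ^ 2 * (B + τ) * (1 - A) =
        r * s * (2 * (s * B + s * τ) * (1 - A)) := by
      ring
    rw [e, abs_mul, abs_of_pos (by positivity : 0 < r * s), abs_mul, abs_mul, abs_two]
    have e2 : r * s ≤ r ^ 2 := by nlinarith
    refine mul_le_mul e2 ?_ (by positivity) (by positivity)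
    have e3 := mul_le_mul_of_nonneg_right (abs_add_le (s * B) (s * τ))
      (abs_nonneg (1 - A))
    linarith
  have f3 := (abs_sub _ _).trans (add_le_add f1 f2)
  have f4 : ((m + 2) / 2 * (1 + 2 * C) * X ^ 2) + (C / 2 * (y ^ 2 + X ^ 2) +
      C / 2 * (∑ i, ∑ j, w i j ^ 2 + m ^ 2 * X ^ 2)) ≤
      ((m + 2) / 2 * (1 + 2 * C) + C / 2 + C / 2 * (1 + m ^ 2)) * ((A ^ 2 - 1) ^ 2 + y ^ 2 + ∑ i, ∑ j, w i j ^ 2) := by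
    rw [← sq_abs (A ^ 2 - 1), ← hX]
    have g1 : 0 ≤ ((m:ℝ) + 2) / 2 * (1 + 2 * C) * (y ^ 2 + ∑ i, ∑ j, w i j ^ 2) := by positivity
    have g2 : 0 ≤ C / 2 * (∑ i, ∑ j, w i j ^ 2) := by positivity
    have g3 : 0 ≤ C / 2 * (X ^ 2 + y ^ 2 + m ^ 2 * y ^ 2 + m ^ 2 * ∑ i, ∑ j, w i j ^ 2) := by positivity
    linarith
  calc _ ≤ r ^ m * (r ^ 2 * ((m + 2) / 2 * (1 + 2 * C) * X ^ 2) + r ^ 2 * (C / 2 * (y ^ 2 + X ^ 2) +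
      C / 2 * (∑ i, ∑ j, w i j ^ 2 + m ^ 2 * X ^ 2))) :=
        mul_le_mul_of_nonneg_left f3 (by positivity)
    _ = r ^ (m + 2) * (((m + 2) / 2 * (1 + 2 * C) * X ^ 2) + (C / 2 * (y ^ 2 + X ^ 2) +
      C / 2 * (∑ i, ∑ j, w i j ^ 2 + m ^ 2 * X ^ 2))) := by ring
    _ ≤ _ := by
      rw [mul_left_comm]
      exact mul_le_mul_of_nonneg_left f4 (by positivity)

/-- √f B and √f τ are linear in the frame derivatives √f ∂_r(c/f) and √f ∂_r(γ_ij/r²), with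
coefficients f/c and r²γ⁻¹ that uniform equivalence keeps bounded. So `error_estimate` applies. -/
theorem massDensity_bound (hr₀ : 0 < r₀) (D : IsBlockData (outer r₀) a c γ) (hr : r₀ < r) {C : ℝ}
    (hC : 0 < C) (h1 : C⁻¹ * hmF m r₀ r ≤ c (r, θ))
    (h2 : ∀ i j, |r ^ 2 * (γ (r, θ))⁻¹ i j| ≤ C) :
    |massDensity r₀ c γ (r, θ) - ((m + 2) * r₀ ^ (m + 2) - fluxDensity r₀ c γ (r, θ))| ≤
      ((m + 2) / 2 * (1 + 2 * C) + C / 2 + C / 2 * (1 + m ^ 2)) *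
        (r ^ (m + 2) * radialDeviation r₀ c γ (r, θ)) := by
  have hz : ((r, θ) : ℝ × ℝ) ∈ outer r₀ := hr
  have hr' : 0 < r := hr₀.trans hr
  have hf := hmF_pos (m := m) hr₀ hr
  have hc := D.pos_c _ hz
  have hsf := Real.sqrt_pos.2 hf
  have hsc := Real.sqrt_pos.2 hc
  have hfs : √(hmF m r₀ r) ^ 2 = hmF m r₀ r := Real.sq_sqrt hf.le
  have hcs : √(c (r, θ)) ^ 2 = c (r, θ) := Real.sq_sqrt hc.le
  obtain ⟨A, hA⟩ : ∃ A, A = √(c (r, θ)) / √(hmF m r₀ r) := ⟨_, rfl⟩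
  obtain ⟨B, hB⟩ : ∃ B, B = dirDeriv (1, 0) c (r, θ) / (2 * c (r, θ)) -
    hmF' m r₀ r / (2 * hmF m r₀ r) := ⟨_, rfl⟩
  obtain ⟨τ, hτ⟩ : ∃ τ, τ = trH (1, 0) γ (r, θ) - m / r := ⟨_, rfl⟩
  have hA0 : 0 < A := by rw [hA]; positivity
  have hA2 : A ^ 2 = c (r, θ) / hmF m r₀ r := by rw [hA, div_pow, hfs, hcs]
  have hAC : 1 / A ^ 2 ≤ C := by
    rw [hA2, one_div_div, div_le_iff₀ hc]
    rw [inv_mul_le_iff₀ hC] at h1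
    exact h1
  obtain ⟨w, hw⟩ : ∃ w : Fin m → Fin m → ℝ, w = fun i j => √(hmF m r₀ r) *
    dirDeriv (1, 0) (fun y => γ y i j / y.1 ^ 2) (r, θ) := ⟨_, rfl⟩
  obtain ⟨y, hy⟩ : ∃ y, y = √(hmF m r₀ r) *
    dirDeriv (1, 0) (fun y => c y / hmF m r₀ y.1) (r, θ) := ⟨_, rfl⟩
  have hBy : √(hmF m r₀ r) * B = y * (1 / A ^ 2) / 2 := by
    rw [hy, dirDeriv_c_div hr₀ D hr, hB, hA2]; field_simp
  have hτw : √(hmF m r₀ r) * τ = (∑ i, ∑ j, r ^ 2 * (γ (r, θ))⁻¹ i j * w j i) / 2 := by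
    have t1 : ∑ A, ∑ B, (γ (r, θ))⁻¹ A B * γ (r, θ) B A = m := by
      simp only [D.sum_inv_mul (z := (r, θ)) hr]
      simp
    have t2 : ∑ A, ∑ B, (γ (r, θ))⁻¹ A B * dirDeriv (1, 0) (fun y => γ y B A) (r, θ) =
        2 * trH (1, 0) γ (r, θ) := by
      simp only [IsBlockData.sum_inv_dirDeriv, trH, Finset.mul_sum]
    have t3 : τ = (2 * trH (1, 0) γ (r, θ) - 2 / r * m) / 2 := by rw [hτ]; ring
    rw [t3, ← t2, ← t1, hw, ← mul_div_assoc]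
    congr 1
    simp only [Finset.mul_sum, ← Finset.sum_sub_distrib]
    refine Finset.sum_congr rfl fun i _ => Finset.sum_congr rfl fun j _ => ?_
    rw [dirDeriv_γ_div hr₀ D hr]
    field_simp
  have hdev : (A ^ 2 - 1) ^ 2 + y ^ 2 + ∑ i, ∑ j, w i j ^ 2 ≤ radialDeviation r₀ c γ (r, θ) := by
    have e : ∀ d : ℝ, (√(hmF m r₀ r) * d) ^ 2 = hmF m r₀ r * d ^ 2 := fun d => by
      rw [mul_pow, hfs]
    have : 0 ≤ ∑ i, ∑ j, (γ (r, θ) i j / r ^ 2 - (1 : Matrix (Fin m) (Fin m) ℝ) i j) ^ 2 :=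
      Finset.sum_nonneg fun i _ => Finset.sum_nonneg fun j _ => sq_nonneg _
    rw [hy, hw, hA2]
    simp only [e, radialDeviation]
    linarith
  have hq0 : 0 ≤ (r₀ / r) ^ (m + 2) := pow_nonneg (div_nonneg hr₀.le hr'.le) _
  have hsr : √(hmF m r₀ r) ≤ r := Real.sqrt_le_iff.2 ⟨hr'.le, hmF_le hr₀ hr⟩
  rw [massDensity_sub hr₀ D hr hA hB hτ, ← hfs]
  refine (error_estimate hA0 hAC hsf hsr hBy hτw h2 hq0 (hmQ_lt_one hr₀ hr).le).trans ?_
  gcongr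

end

/-! ### Bounds from the asymptotic conditions. -/

section
variable {m : ℕ} {r₀ : ℝ} {a c : ℝ × ℝ → ℝ} {γ : ℝ × ℝ → Matrix (Fin m) (Fin m) ℝ} {r θ : ℝ}

theorem le_sum_blocks {F : Idx m → Idx m → ℝ} (hF : ∀ i j, 0 ≤ F i j) :
    F (Sum.inl 1) (Sum.inl 1) + ∑ A, ∑ B, F (Sum.inr A) (Sum.inr B) ≤ ∑ i, ∑ j, F i j := by
  simp only [Fintype.sum_sum_type, Fin.sum_univ_two, Finset.sum_add_distrib]
  have h1 : ∀ i, 0 ≤ ∑ B, F (Sum.inl i) (Sum.inr B) := fun i => Finset.sum_nonneg fun _ _ => hF _ _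
  have h2 : ∀ i, 0 ≤ ∑ B, F (Sum.inr B) (Sum.inl i) := fun i => Finset.sum_nonneg fun _ _ => hF _ _
  linarith [h1 0, h1 1, h2 0, h2 1, hF (Sum.inl 0) (Sum.inl 0), hF (Sum.inl 0) (Sum.inl 1),
    hF (Sum.inl 1) (Sum.inl 0)]

theorem frameComponent_blockG (hr₀ : 0 < r₀) {p : Idx m → ℝ} (hp : r₀ < p (Sum.inl 0)) :
    frameComponent m r₀ (blockG a c γ) (Sum.inl 1) (Sum.inl 1) p =
      (fun y : ℝ × ℝ => c y / hmF m r₀ y.1) (radAng m p) ∧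
    ∀ A B, frameComponent m r₀ (blockG a c γ) (Sum.inr A) (Sum.inr B) p =
      (fun y : ℝ × ℝ => γ y A B / y.1 ^ 2) (radAng m p) := by
  refine ⟨?_, fun A B => ?_⟩
  · have h := Real.mul_self_sqrt (hmF_pos (m := m) hr₀ hp).le
    simp only [frameComponent, hmFrame, blockG, Sum.elim_inl, Matrix.cons_val_one,
      Matrix.cons_val_zero, Matrix.fromBlocks_apply₁₁, Matrix.diagonal_apply_eq, radAng_apply]
    conv_rhs => rw [← h]
    rw [one_div, ← mul_inv, div_eq_inv_mul]
  · simp only [frameComponent, hmFrame, blockG, Sum.elim_inr, Matrix.fromBlocks_apply₂₂,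
      radAng_apply]
    rw [one_div, ← mul_inv, div_eq_inv_mul, sq]

/-- The left side keeps only the θθ and torus components and the derivatives along e₁; what is
discarded is a sum of squares. -/
theorem radialDeviation_le (hr₀ : 0 < r₀) (D : IsBlockData (outer r₀) a c γ) (hr : r₀ < r)
    (x : Fin m → ℝ) :
    radialDeviation r₀ c γ (r, θ) ≤ frameDeviation m r₀ (blockG a c γ) (polarPoint r θ x) := by
  have hz : ((r, θ) : ℝ × ℝ) ∈ outer r₀ := hr
  have hp : r₀ < polarPoint r θ x (Sum.inl 0) := hr
  have hev : ∀ᶠ q : Idx m → ℝ in 𝓝 (polarPoint r θ x), r₀ < q (Sum.inl 0) :=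
    (isOpen_lt continuous_const (continuous_apply _)).mem_nhds hp
  have hd1 : DifferentiableAt ℝ (fun y : ℝ × ℝ => c y / hmF m r₀ y.1) (r, θ) :=
    (D.smooth_c.div (contDiffOn_hmF_fst hr₀) fun z hz => (hmF_pos hr₀ hz).ne').differentiableAt_of_isOpen
      D.isOpen hz
  have hd2 : ∀ i j, DifferentiableAt ℝ (fun y : ℝ × ℝ => γ y i j / y.1 ^ 2) (r, θ) := fun i j =>
    ((D.smooth_γ i j).div (contDiffOn_fst.pow 2)
      fun z hz => pow_ne_zero 2 (hr₀.trans hz).ne').differentiableAt_of_isOpen D.isOpen hz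
  have e1 : partialDeriv (Sum.inl 0) (frameComponent m r₀ (blockG a c γ) (Sum.inl 1) (Sum.inl 1))
      (polarPoint r θ x) = dirDeriv (1, 0) (fun y => c y / hmF m r₀ y.1) (r, θ) := by
    rw [← radAng_single_zero (m := m)]
    refine Eq.trans ?_ (partialDeriv_comp_radAng (p := polarPoint r θ x) _ hd1)
    unfold partialDeriv
    rw [Filter.EventuallyEq.fderiv_eq]
    filter_upwards [hev] with q hq using (frameComponent_blockG hr₀ hq).1
  have e2 : ∀ A B, partialDeriv (Sum.inl 0)
      (frameComponent m r₀ (blockG a c γ) (Sum.inr A) (Sum.inr B)) (polarPoint r θ x) =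
      dirDeriv (1, 0) (fun y => γ y A B / y.1 ^ 2) (r, θ) := fun A B => by
    rw [← radAng_single_zero (m := m)]
    refine Eq.trans ?_ (partialDeriv_comp_radAng (p := polarPoint r θ x) _ (hd2 A B))
    unfold partialDeriv
    rw [Filter.EventuallyEq.fderiv_eq]
    filter_upwards [hev] with q hq using (frameComponent_blockG hr₀ hq).2 A B
  have e3 : ∀ d : ℝ, (hmFrame m r₀ (Sum.inl 0) (polarPoint r θ x) * d) ^ 2 = hmF m r₀ r * d ^ 2 :=
    fun d => by
      rw [mul_pow, show hmFrame m r₀ (Sum.inl 0) (polarPoint r θ x) = √(hmF m r₀ r) from rfl,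
        Real.sq_sqrt (hmF_pos hr₀ hr).le]
  have f1 := le_sum_blocks (F := fun i j => (frameComponent m r₀ (blockG a c γ) i j
    (polarPoint r θ x) - (1 : Matrix (Idx m) (Idx m) ℝ) i j) ^ 2) fun _ _ => sq_nonneg _
  have f2 := le_sum_blocks (F := fun i j => (hmFrame m r₀ (Sum.inl 0) (polarPoint r θ x) *
    partialDeriv (Sum.inl 0) (frameComponent m r₀ (blockG a c γ) i j) (polarPoint r θ x)) ^ 2)
    fun _ _ => sq_nonneg _
  have f3 := Finset.single_le_sum (f := fun k => ∑ i, ∑ j, (hmFrame m r₀ k (polarPoint r θ x) *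
    partialDeriv k (frameComponent m r₀ (blockG a c γ) i j) (polarPoint r θ x)) ^ 2)
    (fun _ _ => Finset.sum_nonneg fun _ _ => Finset.sum_nonneg fun _ _ => sq_nonneg _)
    (Finset.mem_univ (Sum.inl 0))
  simp only [e1, e2, e3, (frameComponent_blockG hr₀ hp).1, (frameComponent_blockG hr₀ hp).2] at f1 f2
  have e4 : ∀ A B : Fin m, (1 : Matrix (Idx m) (Idx m) ℝ) (Sum.inr A) (Sum.inr B) =
      (1 : Matrix (Fin m) (Fin m) ℝ) A B := fun A B => by simp [Matrix.one_apply]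
  simp only [e4, Matrix.one_apply_eq] at f1
  simp only [e3] at f3
  rw [frameDeviation, radialDeviation]
  refine le_trans (le_of_eq ?_) (add_le_add f1 (f2.trans f3))
  simp only [radAng_apply, polarPoint, Sum.elim_inl, Matrix.cons_val_zero, Matrix.cons_val_one]
  ring

theorem continuousOn_radialDeviation (hr₀ : 0 < r₀) (D : IsBlockData (outer r₀) a c γ) :
    ContinuousOn (radialDeviation r₀ c γ) (outer r₀) := by
  have h1 : ContDiffOn ℝ ∞ (fun y : ℝ × ℝ => c y / hmF m r₀ y.1) (outer r₀) :=
    D.smooth_c.div (contDiffOn_hmF_fst hr₀) fun z hz => (hmF_pos hr₀ hz).ne'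
  have h2 : ∀ i j, ContDiffOn ℝ ∞ (fun y : ℝ × ℝ => γ y i j / y.1 ^ 2) (outer r₀) := fun i j =>
    (D.smooth_γ i j).div (contDiffOn_fst.pow 2) fun z hz => pow_ne_zero 2 (hr₀.trans hz).ne'
  have h3 := (contDiffOn_hmF_fst (m := m) hr₀).continuousOn
  refine ((((h1.continuousOn.sub continuousOn_const).pow 2).add ?_).add
    (h3.mul ((h1.dirDeriv D.isOpen).continuousOn.pow 2))).add ?_
  · exact continuousOn_finsetSum _ fun i _ => continuousOn_finsetSum _ fun j _ =>
      ((h2 i j).continuousOn.sub continuousOn_const).pow 2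
  · exact continuousOn_finsetSum _ fun i _ => continuousOn_finsetSum _ fun j _ =>
      h3.mul (((h2 i j).dirDeriv D.isOpen).continuousOn.pow 2)

theorem continuousOn_massDensity (hr₀ : 0 < r₀) (D : IsBlockData (outer r₀) a c γ) :
    ContinuousOn (massDensity r₀ c γ) (outer r₀) := by
  have h3 := (contDiffOn_hmF_fst (m := m) hr₀).continuousOn
  have hf0 : ∀ z ∈ outer r₀, hmF m r₀ z.1 ≠ 0 := fun z hz => (hmF_pos hr₀ hz).ne'
  have hr0 : ∀ z ∈ outer r₀, z.1 ≠ 0 := fun z hz => (hr₀.trans hz).ne'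
  have hc0 : ∀ z ∈ outer r₀, c z ≠ 0 := fun z hz => (D.pos_c z hz).ne'
  have hc := D.smooth_c.continuousOn
  have hdc := (D.smooth_c.dirDeriv (w := (1, 0)) D.isOpen).continuousOn
  have ht := (D.smooth_trH (1, 0)).continuousOn
  have h4 : ContinuousOn (fun z : ℝ × ℝ => hmF' m r₀ z.1) (outer r₀) := by
    unfold hmF'
    exact (continuousOn_const.mul continuousOn_fst).add ((continuousOn_const.mul continuousOn_fst).mul
      ((continuousOn_const.div continuousOn_fst hr0).pow _))
  refine (continuousOn_fst.pow m).mul (((continuousOn_fst.mul h3).mul ?_).add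
    (h3.mul (continuousOn_const.sub (h3.div hc hc0))))
  refine (((ContinuousOn.add ?_ ?_).sub (hdc.div hc hc0)).add
    (continuousOn_const.div continuousOn_fst hr0)).sub (continuousOn_const.mul ht)
  · exact h4.div (continuousOn_const.mul hc) fun z hz => mul_ne_zero two_ne_zero (hc0 z hz)
  · exact h4.div (continuousOn_const.mul h3) fun z hz => mul_ne_zero two_ne_zero (hf0 z hz)

/-- Bounds for the coefficients from the uniform equivalence of the metrics. -/
theorem bounds_of_equivalent (D : IsBlockData (outer r₀) a c γ) (hr : r₀ < r) (hr0 : 0 < r) {C : ℝ}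
    (hC : 0 < C) (h : ∀ X : Idx m → ℝ, C⁻¹ * (X ⬝ᵥ (hmMetric m r₀ (polarPoint r θ 0) *ᵥ X)) ≤
      X ⬝ᵥ (blockG a c γ (polarPoint r θ 0) *ᵥ X)) :
    C⁻¹ * hmF m r₀ r ≤ c (r, θ) ∧ ∀ i j, |r ^ 2 * (γ (r, θ))⁻¹ i j| ≤ C := by
  refine ⟨?_, fun i j => ?_⟩
  · have := h (Pi.single (Sum.inl 1) 1)
    simpa [hmMetric, blockG, polarPoint, radAng_apply] using this
  -- Testing with the j-th column x of γ⁻¹ gives xᵀγx = x_j, so r²|x|² ≤ C x_j. The j-th entry then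
  -- yields r² x_j ≤ C, and every other entry follows from (r² x_i)² ≤ C r² x_j.
  · set x : Fin m → ℝ := fun k => (γ (r, θ))⁻¹ k j with hx
    have h1 := h (Sum.elim 0 x)
    have e1 : Sum.elim (0 : Fin 2 → ℝ) x ⬝ᵥ (hmMetric m r₀ (polarPoint r θ 0) *ᵥ Sum.elim 0 x) =
        r ^ 2 * ∑ k, x k ^ 2 := by
      simp [dotProduct, hmMetric, Matrix.mulVec_diagonal, Fintype.sum_sum_type, polarPoint,
        Finset.mul_sum]
      exact Finset.sum_congr rfl fun k _ => by ring
    have e3 : ∀ k, ∑ l, γ (r, θ) k l * x l = if k = j then 1 else 0 := fun k => by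
      have := congrFun (congrFun (Matrix.mul_nonsing_inv _ (D.det_γ (r, θ) hr).isUnit) k) j
      rwa [Matrix.mul_apply, Matrix.one_apply] at this
    have e2 : Sum.elim (0 : Fin 2 → ℝ) x ⬝ᵥ (blockG a c γ (polarPoint r θ 0) *ᵥ Sum.elim 0 x) =
        x j := by
      have : radAng m (polarPoint r θ 0) = (r, θ) := rfl
      simp [dotProduct, blockG, Fintype.sum_sum_type, Matrix.mulVec, this, e3]
    rw [e1, e2, inv_mul_le_iff₀ hC] at h1
    have h2 : ∀ k, r ^ 2 * x k ^ 2 ≤ C * x j := fun k => by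
      refine le_trans (mul_le_mul_of_nonneg_left ?_ (sq_nonneg r)) h1
      exact Finset.single_le_sum (f := fun k => x k ^ 2) (fun _ _ => sq_nonneg _) (Finset.mem_univ k)
    have h3 : r ^ 2 * x j ≤ C := by
      by_contra! hlt
      have := h2 j
      have hxj : 0 < x j := by
        by_contra! hle
        nlinarith [sq_nonneg r]
      nlinarith
    have h4 : (r ^ 2 * x i) ^ 2 ≤ C ^ 2 := by
      have := h2 i
      have hr2 : 0 < r ^ 2 := by positivity
      calc (r ^ 2 * x i) ^ 2 = r ^ 2 * (r ^ 2 * x i ^ 2) := by ring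
        _ ≤ r ^ 2 * (C * x j) := mul_le_mul_of_nonneg_left this hr2.le
        _ = C * (r ^ 2 * x j) := by ring
        _ ≤ C * C := mul_le_mul_of_nonneg_left h3 hC.le
        _ = C ^ 2 := by ring
    exact abs_le_of_sq_le_sq h4 hC.le

end

/-- Otherwise h ≥ ε/r eventually, and 1/r is not integrable at infinity. -/
theorem frequently_mul_lt_of_integrableOn {h : ℝ → ℝ} {r₁ : ℝ} (hi : IntegrableOn h (Set.Ioi r₁))
    {ε : ℝ} (hε : 0 < ε) : ∃ᶠ r in atTop, r * h r < ε := by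
  intro hev
  rw [eventually_atTop] at hev
  obtain ⟨R, hR⟩ := hev
  set R' := max (max R r₁) 1
  have hsub : IntegrableOn h (Set.Ioi R') := hi.mono_set
    (Set.Ioi_subset_Ioi ((le_max_right _ _).trans (le_max_left _ _)))
  refine not_integrableOn_Ioi_inv (a := R') ?_
  have h2 : IntegrableOn (fun r => ε⁻¹ * h r) (Set.Ioi R') := hsub.const_mul _
  refine h2.mono' (by fun_prop) ?_
  rw [ae_restrict_iff' measurableSet_Ioi]
  refine Eventually.of_forall fun r hr => ?_
  have hr1 : R' < r := hr
  have h1 : 1 < r := lt_of_le_of_lt (le_max_right _ _) hr1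
  have h3 := hR r ((le_max_left _ _).trans ((le_max_left _ _).trans hr1.le))
  rw [not_lt] at h3
  rw [Real.norm_of_nonneg (by positivity), inv_mul_eq_div, le_div_iff₀ hε, inv_mul_le_iff₀ (by positivity)]
  exact h3

/-! ### Comparison of mass and flux at arbitrarily large radii. -/

section
variable {m : ℕ} {r₀ : ℝ} {a c : ℝ × ℝ → ℝ} {γ : ℝ × ℝ → Matrix (Fin m) (Fin m) ℝ}
  {B : Module.Basis (Fin m) ℝ (Fin m → ℝ)}

/-- The volume of the fundamental domain of the torus. -/
def torusVolume (B : Module.Basis (Fin m) ℝ (Fin m → ℝ)) : ℝ :=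
  volume.real (ZSpan.fundamentalDomain B)

theorem volume_fundamentalDomain_lt_top (B : Module.Basis (Fin m) ℝ (Fin m → ℝ)) :
    volume (ZSpan.fundamentalDomain B) < ⊤ :=
  (ZSpan.fundamentalDomain_isBounded B).measure_lt_top

theorem torusVolume_pos (B : Module.Basis (Fin m) ℝ (Fin m → ℝ)) : 0 < torusVolume B :=
  ENNReal.toReal_pos (ZSpan.measure_fundamentalDomain_ne_zero B)
    (volume_fundamentalDomain_lt_top B).ne

theorem setIntegral_angle_torus (hr₀ : 0 < r₀) (F : ℝ → ℝ) :
    ∫ z in Set.Ico 0 (anglePeriod m r₀) ×ˢ ZSpan.fundamentalDomain B, F z.1 =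
      torusVolume B * ∫ θ in 0..anglePeriod m r₀, F θ := by
  have h := setIntegral_prod_mul (μ := volume) (ν := volume) F (fun _ : Fin m → ℝ => (1 : ℝ))
    (Set.Ico 0 (anglePeriod m r₀)) (ZSpan.fundamentalDomain B)
  simp only [mul_one, ← Measure.volume_eq_prod] at h
  rw [h, setIntegral_const, integral_Ico_eq_integral_Ioc,
    intervalIntegral.integral_of_le (anglePeriod_pos hr₀).le, smul_eq_mul, mul_one, mul_comm]
  rfl

theorem massFlux_eq (hr₀ : 0 < r₀) (D : IsBlockData (outer r₀) a c γ)
    (ha : ∀ z : ℝ × ℝ, r₀ < z.1 → a z = 1 / hmF m r₀ z.1) {r : ℝ} (hr : r₀ < r) :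
    massFlux r₀ B (blockG a c γ) r =
      torusVolume B * ∫ θ in 0..anglePeriod m r₀, massDensity r₀ c γ (r, θ) := by
  rw [massFlux, ← setIntegral_angle_torus hr₀]
  congr 1
  ext z
  exact D.massVector_eq hr₀ ha (p := polarPoint r z.1 z.2) hr

/-- The angular integral of the radial deviation, with its weight, is frequently small. -/
theorem HasMass.frequently_radialDeviation {μ : ℝ} (hr₀ : 0 < r₀)
    (D : IsBlockData (outer r₀) a c γ) (h : HasMass r₀ B (blockG a c γ) μ) {ε : ℝ} (hε : 0 < ε) :
    ∃ᶠ r in atTop,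
      r ^ (m + 2) * ∫ θ in 0..anglePeriod m r₀, radialDeviation r₀ c γ (r, θ) < ε := by
  obtain ⟨r₁, hr₁, hint⟩ := h.squareIntegrable
  set S := Set.Ico 0 (anglePeriod m r₀) ×ˢ ZSpan.fundamentalDomain B with hS
  have hSm : MeasurableSet S :=
    measurableSet_Ico.prod (ZSpan.fundamentalDomain_measurableSet B)
  have hi : IntegrableOn (fun z : ℝ × ℝ × (Fin m → ℝ) =>
      radialDeviation r₀ c γ (z.1, z.2.1) * z.1 ^ (m + 1)) (Set.Ioi r₁ ×ˢ S) := by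
    refine hint.mono' ?_ ?_
    · refine ContinuousOn.aestronglyMeasurable ?_ (measurableSet_Ioi.prod hSm)
      refine ContinuousOn.mul ?_ (by fun_prop)
      refine (continuousOn_radialDeviation hr₀ D).comp (by fun_prop) ?_
      rintro ⟨r, θ, x⟩ ⟨hz, -⟩
      exact hr₁.trans hz
    · rw [ae_restrict_iff' (measurableSet_Ioi.prod hSm)]
      refine Eventually.of_forall ?_
      rintro ⟨r, θ, x⟩ ⟨hz, -⟩
      have hr : r₀ < r := hr₁.trans hz
      have hr' : 0 < r := hr₀.trans hr
      have h0 : 0 ≤ radialDeviation r₀ c γ (r, θ) := by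
        have := (hmF_pos (m := m) hr₀ hr).le
        unfold radialDeviation
        positivity
      dsimp only
      rw [Real.norm_of_nonneg (by positivity), sqrt_det_hmMetric hr₀ (p := polarPoint r θ x) hr]
      calc _ ≤ frameDeviation m r₀ (blockG a c γ) (polarPoint r θ x) * r ^ (m + 1) :=
            mul_le_mul_of_nonneg_right (radialDeviation_le hr₀ D hr x) (by positivity)
        _ = _ := by
          rw [pow_succ', ← mul_assoc]; rfl
  rw [IntegrableOn, Measure.volume_eq_prod, ← Measure.prod_restrict] at hi
  have hi2 := hi.integral_prod_left
  have hi3 : IntegrableOn (fun r => torusVolume B *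
      (r ^ (m + 1) * ∫ θ in 0..anglePeriod m r₀, radialDeviation r₀ c γ (r, θ))) (Set.Ioi r₁) := by
    refine hi2.congr (Eventually.of_forall fun r => ?_)
    dsimp only
    rw [setIntegral_angle_torus hr₀ (fun θ => radialDeviation r₀ c γ (r, θ) * r ^ (m + 1)),
      intervalIntegral.integral_mul_const]
    ring
  have hV := torusVolume_pos B
  refine (frequently_mul_lt_of_integrableOn hi3 (mul_pos hV hε)).mono fun r h => ?_
  -- The weight V √(det b) is r^{m+1}, whereas the error bound carries r^{m+2}. The missing power of
  -- r is why smallness is obtained only frequently.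
  have h2 : r * (torusVolume B *
      (r ^ (m + 1) * ∫ θ in 0..anglePeriod m r₀, radialDeviation r₀ c γ (r, θ))) =
      torusVolume B * (r ^ (m + 2) * ∫ θ in 0..anglePeriod m r₀, radialDeviation r₀ c γ (r, θ)) := by
    ring
  rw [h2] at h
  exact lt_of_mul_lt_mul_left h hV.le

/-- The difference between the mass flux and the normalized flux is frequently small. -/
theorem HasMass.frequently_massFlux {μ : ℝ} (hr₀ : 0 < r₀)
    (D : IsBlockData (outer r₀) a c γ) (ha : ∀ z : ℝ × ℝ, r₀ < z.1 → a z = 1 / hmF m r₀ z.1)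
    (h : HasMass r₀ B (blockG a c γ) μ) {ε : ℝ} (hε : 0 < ε) :
    ∃ᶠ r in atTop, |massFlux r₀ B (blockG a c γ) r - torusVolume B *
      (anglePeriod m r₀ * ((m + 2) * r₀ ^ (m + 2)) - flux r₀ c γ r)| < ε := by
  obtain ⟨C, hC, r₁, hr₁, heq⟩ := h.equivalent
  have hV := torusVolume_pos B
  set K := (m + 2) / 2 * (1 + 2 * C) + C / 2 + C / 2 * (1 + m ^ 2) with hK
  have hK0 : 0 < K := by positivity
  have hfr := h.frequently_radialDeviation hr₀ D (ε := ε / (torusVolume B * K)) (by positivity)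
  refine (hfr.and_eventually (eventually_gt_atTop r₁)).mono ?_
  rintro r ⟨hsmall, hr1⟩
  have hr : r₀ < r := hr₁.trans hr1
  have cM := (continuousOn_massDensity hr₀ D).continuous_slice_snd hr
  have cF := (D.smooth_fluxDensity hr₀).continuousOn.continuous_slice_snd hr
  have cN : Continuous fun θ => (m + 2) * r₀ ^ (m + 2) - fluxDensity r₀ c γ (r, θ) :=
    continuous_const.sub cF
  have cR := (continuousOn_radialDeviation hr₀ D).continuous_slice_snd hr
  have e1 : massFlux r₀ B (blockG a c γ) r - torusVolume B *
      (anglePeriod m r₀ * ((m + 2) * r₀ ^ (m + 2)) - flux r₀ c γ r) =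
      torusVolume B * ∫ θ in 0..anglePeriod m r₀, (massDensity r₀ c γ (r, θ) -
        ((m + 2) * r₀ ^ (m + 2) - fluxDensity r₀ c γ (r, θ))) := by
    rw [massFlux_eq hr₀ D ha hr, ← mul_sub, intervalIntegral.integral_sub
      (cM.intervalIntegrable _ _) (cN.intervalIntegrable _ _),
      intervalIntegral.integral_sub (by simp) (cF.intervalIntegrable _ _)]
    simp [flux]
    exact Or.inl (by ring)
  have hb := fun θ => bounds_of_equivalent (θ := θ) D hr (hr₀.trans hr) hC
    fun X => (heq (polarPoint r θ 0) hr1 X).1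
  rw [e1, abs_mul, abs_of_pos hV]
  calc _ ≤ torusVolume B * ∫ θ in 0..anglePeriod m r₀,
        K * (r ^ (m + 2) * radialDeviation r₀ c γ (r, θ)) := by
        refine mul_le_mul_of_nonneg_left ?_ hV.le
        refine (intervalIntegral.abs_integral_le_integral_abs (anglePeriod_pos hr₀).le).trans ?_
        refine intervalIntegral.integral_mono_on (anglePeriod_pos hr₀).le
          ((cM.sub cN).abs.intervalIntegrable _ _)
          ((continuous_const.mul (continuous_const.mul cR)).intervalIntegrable _ _) fun θ _ => ?_
        exact massDensity_bound hr₀ D hr hC (hb θ).1 (hb θ).2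
    _ = torusVolume B * K * (r ^ (m + 2) *
        ∫ θ in 0..anglePeriod m r₀, radialDeviation r₀ c γ (r, θ)) := by
        rw [intervalIntegral.integral_const_mul, intervalIntegral.integral_const_mul]; ring
    _ < torusVolume B * K * (ε / (torusVolume B * K)) :=
        mul_lt_mul_of_pos_left hsmall (by positivity)
    _ = ε := by field_simp

end

/-! ### Mass of the background, and rigidity. -/

section
variable {m : ℕ} {r₀ : ℝ} {a c : ℝ × ℝ → ℝ} {γ : ℝ × ℝ → Matrix (Fin m) (Fin m) ℝ}
  {B : Module.Basis (Fin m) ℝ (Fin m → ℝ)} {W : ℝ × ℝ → ℝ}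
  {Γ : ℝ × ℝ → Matrix (Fin m) (Fin m) ℝ}

theorem massDensity_hm (hr₀ : 0 < r₀) (hc : ∀ z : ℝ × ℝ, r₀ < z.1 → c z = hmF m r₀ z.1)
    (hγ : ∀ z : ℝ × ℝ, r₀ < z.1 → γ z = Matrix.diagonal fun _ => z.1 ^ 2) {r θ : ℝ} (hr : r₀ < r) :
    massDensity r₀ c γ (r, θ) = 0 := by
  have hz : ((r, θ) : ℝ × ℝ) ∈ outer r₀ := hr
  have hr' : 0 < r := hr₀.trans hr
  have hf := hmF_pos (m := m) hr₀ hr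
  have hev := (isOpen_outer r₀).mem_nhds hz
  have e1 : dirDeriv (1, 0) c (r, θ) = hmF' m r₀ r := by
    rw [dirDeriv_congr (k := fun z => hmF m r₀ z.1) (by filter_upwards [hev] with y hy using hc y hy),
      dirDeriv_fst_comp (z := (r, θ)) (1, 0) (hasDerivAt_hmF hr'.ne')]
    simp
  have e2 : trH (1, 0) γ (r, θ) = m / r := by
    have : halfLog (1, 0) γ (r, θ) = (1 / r) • 1 := by
      rw [← halfLog_hm (m := m) (θ := θ) hr'.ne']
      ext i j
      simp only [halfLog, hγ (r, θ) hr]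
      refine Finset.sum_congr rfl fun k _ => ?_
      rw [dirDeriv_congr (h := fun y => γ y k j) (by
        filter_upwards [hev] with y hy
        rw [hγ y hy])]
    simp [trH, this]
    ring
  rw [massDensity, e1, e2, hc (r, θ) hr]
  dsimp only
  field_simp
  ring

/-- The pointwise consequences of a vanishing flux loss for the torus part, for all angles. -/
theorem CoreData.torus_deriv (K : CoreData r₀ c γ W Γ) (hr₀ : 0 < r₀)
    (h : ∀ r θ, r₀ < r → θ ∈ Set.Icc 0 (anglePeriod m r₀) →
      (∀ i j, dirDeriv (1, 0) (fun y => γ y i j) (r, θ) = 2 / r * γ (r, θ) i j) ∧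
      (∀ i j, dirDeriv (0, 1) (fun y => γ y i j) (r, θ) = 0)) {r : ℝ} (θ : ℝ) (hr : r₀ < r)
    (i j : Fin m) :
    dirDeriv (1, 0) (fun y => γ y i j) (r, θ) = 2 / r * γ (r, θ) i j ∧
      dirDeriv (0, 1) (fun y => γ y i j) (r, θ) = 0 := by
  have hp : Function.Periodic (fun θ => (dirDeriv (1, 0) (fun y => γ y i j) (r, θ),
      dirDeriv (0, 1) (fun y => γ y i j) (r, θ), γ (r, θ) i j)) (anglePeriod m r₀) := by
    intro θ
    have e : ((r, θ + anglePeriod m r₀) : ℝ × ℝ) = (r, θ) + (0, anglePeriod m r₀) := by simp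
    have hd : ∀ w, dirDeriv w (fun y => γ y i j) ((r, θ) + (0, anglePeriod m r₀)) =
        dirDeriv w (fun y => γ y i j) (r, θ) := fun w => by
      apply dirDeriv_add_right
      filter_upwards [(isOpen_outer r₀).mem_nhds (show ((r, θ) : ℝ × ℝ) ∈ outer r₀ from hr)] with y hy
      rw [K.period_γ hy]
    simp only [e, hd, K.period_γ (z := (r, θ)) hr]
  obtain ⟨t, ht, e⟩ := hp.exists_mem_Ico₀ (anglePeriod_pos hr₀) θ
  simp only [Prod.mk.injEq] at e
  rw [e.1, e.2.1, e.2.2]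
  have := h r t hr (Set.Ico_subset_Icc_self ht)
  exact ⟨this.1 i j, this.2 i j⟩

/-- A torus part with vanishing flux loss is that of a cone. -/
theorem IsBlockData.torus_eq (hr₀ : 0 < r₀) (D : IsBlockData (outer r₀) a c γ)
    (h : ∀ (r θ : ℝ), r₀ < r → ∀ i j,
      dirDeriv (1, 0) (fun y => γ y i j) (r, θ) = 2 / r * γ (r, θ) i j ∧
      dirDeriv (0, 1) (fun y => γ y i j) (r, θ) = 0) (i j : Fin m) :
    ∃ k : ℝ, ∀ z : ℝ × ℝ, r₀ < z.1 → γ z i j / z.1 ^ 2 = k := by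
  have hs : ContDiffOn ℝ ∞ (fun y : ℝ × ℝ => γ y i j / y.1 ^ 2) (outer r₀) :=
    (D.smooth_γ i j).div (contDiffOn_fst.pow 2) fun z hz => pow_ne_zero 2 (hr₀.trans hz).ne'
  -- First θ is removed; then γ/r² is constant along the ray θ = 0, with base point r₀ + 1 chosen
  -- arbitrarily in the domain.
  have h1 : ∀ r, r₀ < r → ∀ θ, γ (r, θ) i j = γ (r, 0) i j := fun r hr θ => by
    have hd : ∀ t, HasDerivAt (fun t => γ (r, t) i j) 0 t := fun t => by
      have := hasDerivAt_slice_snd (D.dγ (show ((r, t) : ℝ × ℝ) ∈ outer r₀ from hr) i j)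
      rwa [(h r t hr i j).2] at this
    exact is_const_of_deriv_eq_zero (fun t => (hd t).differentiableAt) (fun t => (hd t).deriv) θ 0
  refine ⟨γ (r₀ + 1, 0) i j / (r₀ + 1) ^ 2, ?_⟩
  rintro ⟨r, θ⟩ hr
  dsimp only at hr ⊢
  rw [h1 r hr θ]
  have hd : ∀ t ∈ Set.Ioi r₀, HasDerivAt (fun s => γ (s, 0) i j / s ^ 2) 0 t := fun t ht => by
    have := hasDerivAt_slice_fst (hs.differentiableAt_of_isOpen D.isOpen
      (show ((t, 0) : ℝ × ℝ) ∈ outer r₀ from ht))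
    rwa [dirDeriv_γ_div hr₀ D ht, (h t 0 ht i j).1, sub_self, zero_div] at this
  exact isOpen_Ioi.is_const_of_deriv_eq_zero isPreconnected_Ioi
    (fun t ht => (hd t ht).differentiableAt.differentiableWithinAt) (fun t ht => (hd t ht).deriv)
    hr (show r₀ + 1 ∈ Set.Ioi r₀ by simp)

/-- A conical torus part of a metric with well-defined mass is that of the background. -/
theorem HasMass.torus_eq_diagonal {μ : ℝ} (hr₀ : 0 < r₀) (D : IsBlockData (outer r₀) a c γ)
    (hM : HasMass r₀ B (blockG a c γ) μ)
    (h : ∀ i j, ∃ k : ℝ, ∀ z : ℝ × ℝ, r₀ < z.1 → γ z i j / z.1 ^ 2 = k) {z : ℝ × ℝ}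
    (hz : r₀ < z.1) : γ z = Matrix.diagonal fun _ => z.1 ^ 2 := by
  ext i j
  obtain ⟨k, hk⟩ := h i j
  have hβ := anglePeriod_pos (m := m) hr₀
  -- If k differed from δ_ij, the radial deviation would be at least (k - δ_ij)² at all radii, so
  -- for r ≥ 1 its weighted angular integral could not fall below β (k - δ_ij)².
  have hk1 : k = (1 : Matrix (Fin m) (Fin m) ℝ) i j := by
    by_contra hne
    have hpos : 0 < (k - (1 : Matrix (Fin m) (Fin m) ℝ) i j) ^ 2 := by
      have := sub_ne_zero.2 hne
      positivity
    have hf := (hM.frequently_radialDeviation hr₀ D (mul_pos hβ hpos)).and_eventually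
      (eventually_gt_atTop (max r₀ 1))
    obtain ⟨r, hlt, hr⟩ := hf.exists
    have hr0 : r₀ < r := (le_max_left _ _).trans_lt hr
    have hr1 : 1 ≤ r := ((le_max_right _ _).trans_lt hr).le
    have hle : ∀ θ, (k - (1 : Matrix (Fin m) (Fin m) ℝ) i j) ^ 2 ≤ radialDeviation r₀ c γ (r, θ) := by
      intro θ
      have g1 := Finset.single_le_sum (f := fun j => (γ (r, θ) i j / r ^ 2 -
        (1 : Matrix (Fin m) (Fin m) ℝ) i j) ^ 2) (fun _ _ => sq_nonneg _) (Finset.mem_univ j)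
      have g2 := Finset.single_le_sum (f := fun i => ∑ j, (γ (r, θ) i j / r ^ 2 -
        (1 : Matrix (Fin m) (Fin m) ℝ) i j) ^ 2)
        (fun _ _ => Finset.sum_nonneg fun _ _ => sq_nonneg _) (Finset.mem_univ i)
      have g3 := (hmF_pos (m := m) hr₀ hr0).le
      have g4 : 0 ≤ hmF m r₀ r * dirDeriv (1, 0) (fun y => c y / hmF m r₀ y.1) (r, θ) ^ 2 := by
        positivity
      have g5 : 0 ≤ ∑ i, ∑ j, hmF m r₀ r *
        dirDeriv (1, 0) (fun y => γ y i j / y.1 ^ 2) (r, θ) ^ 2 := by positivity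
      have g6 := sq_nonneg (c (r, θ) / hmF m r₀ r - 1)
      rw [← hk (r, θ) hr0]
      unfold radialDeviation
      dsimp only at g1 g2 ⊢
      linarith
    have cR := (continuousOn_radialDeviation hr₀ D).continuous_slice_snd hr0
    have hint := intervalIntegral.integral_mono_on (μ := volume) hβ.le
      (continuous_const.intervalIntegrable _ _) (cR.intervalIntegrable _ _) fun θ _ => hle θ
    rw [intervalIntegral.integral_const, sub_zero, smul_eq_mul] at hint
    have hp : 1 ≤ r ^ (m + 2) := one_le_pow₀ hr1
    nlinarith [mul_pos hβ hpos]
  have hz' : 0 < z.1 := hr₀.trans hz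
  have := hk z hz
  rw [div_eq_iff (by positivity), hk1] at this
  rw [this, Matrix.one_apply, Matrix.diagonal_apply]
  split_ifs <;> simp

/-- If the torus part is that of the background and the flux density is constant, then the `dθ²`
coefficient is that of the background. -/
theorem CoreData.angle_eq_hmF (hr₀ : 0 < r₀) (K : CoreData r₀ c γ W Γ)
    (D : IsBlockData (outer r₀) a c γ) {θ : ℝ}
    (ht : ∀ r, r₀ < r → trH (1, 0) γ (r, θ) = m / r)
    (hJ : ∀ r, r₀ < r → fluxDensity r₀ c γ (r, θ) = (m + 2) * r₀ ^ (m + 2)) {r : ℝ} (hr : r₀ < r) :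
    c (r, θ) = hmF m r₀ r := by
  -- For tr(½ γ⁻¹∂_r γ) = m/r the flux density is 2 r^{m+2} √f ∂_r(√c/r). It has the same value for
  -- c and for f, so the two quotients have equal derivatives.
  have hd : ∀ t ∈ Set.Ioi r₀, HasDerivAt (fun s => (√(c (s, θ)) - √(hmF m r₀ s)) / s) 0 t := by
    intro t ht'
    have ht0 : r₀ < t := ht'
    have hz : ((t, θ) : ℝ × ℝ) ∈ outer r₀ := ht0
    have hpos : 0 < t := hr₀.trans ht0
    have hf := hmF_pos (m := m) hr₀ ht0
    have hc := D.pos_c _ hz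
    have hsf := Real.sqrt_pos.2 hf
    have hsc := Real.sqrt_pos.2 hc
    have q1 : hmF m r₀ t = √(hmF m r₀ t) ^ 2 := (Real.sq_sqrt hf.le).symm
    have q2 : c (t, θ) = √(c (t, θ)) ^ 2 := (Real.sq_sqrt hc.le).symm
    have d := ((((hasDerivAt_slice_fst (D.dC hz)).sqrt hc.ne').sub
      ((hasDerivAt_hmF (m := m) (r₀ := r₀) hpos.ne').sqrt hf.ne')).div (hasDerivAt_id t) hpos.ne')
    refine d.congr_deriv ?_
    have e1 : (m + 2) * r₀ ^ (m + 2) = t ^ m * (t * hmF' m r₀ t - 2 * hmF m r₀ t) := by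
      rw [mul_hmF'_eq, ← pow_mul_hmQ (m := m) (r₀ := r₀) hpos.ne']; ring
    have hj := hJ t ht0
    rw [e1, fluxDensity, ht t ht0] at hj
    dsimp only at hj
    simp only [id, Pi.sub_apply]
    generalize √(hmF m r₀ t) = f at *
    generalize √(c (t, θ)) = C at *
    rw [q1, q2] at hj
    have hP : 0 < t ^ m := pow_pos hpos m
    field_simp at hj ⊢
    linarith
  -- Both √c and √f vanish at the core, which fixes the constant of integration.
  have hlim : Tendsto (fun s => (√(c (s, θ)) - √(hmF m r₀ s)) / s) (𝓝[>] r₀) (𝓝 0) := by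
    have h1 : Tendsto (fun s => √(c (s, θ))) (𝓝[>] r₀) (𝓝 0) := by
      have : Continuous fun s => √((s - r₀) * W (√(s - r₀), θ)) := by
        have := K.smooth_W.continuous
        fun_prop
      have h := (this.tendsto r₀).mono_left (nhdsWithin_le_nhds (s := Set.Ioi r₀))
      simp only [sub_self, zero_mul, Real.sqrt_zero] at h
      refine h.congr' ?_
      filter_upwards [self_mem_nhdsWithin] with s hs
      rw [K.c_eq (s, θ) hs]
    have h2 : Tendsto (fun s => √(hmF m r₀ s)) (𝓝[>] r₀) (𝓝 0) := by
      have h := ((hasDerivAt_hmF (m := m) (r₀ := r₀) hr₀.ne').continuousAt.sqrt.tendsto).mono_left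
        (nhdsWithin_le_nhds (s := Set.Ioi r₀))
      simpa [hmF_core] using h
    have h3 : Tendsto (fun s => (√(c (s, θ)) - √(hmF m r₀ s)) / s) (𝓝[>] r₀) (𝓝 ((0 - 0) / r₀)) :=
      (h1.sub h2).div (tendsto_id.mono_left (nhdsWithin_le_nhds (s := Set.Ioi r₀))) hr₀.ne'
    simpa using h3
  have hconst : ∀ s, r₀ < s → (√(c (s, θ)) - √(hmF m r₀ s)) / s =
      (√(c (r, θ)) - √(hmF m r₀ r)) / r := fun s hs =>
    isOpen_Ioi.is_const_of_deriv_eq_zero isPreconnected_Ioi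
      (fun t ht => (hd t ht).differentiableAt.differentiableWithinAt) (fun t ht => (hd t ht).deriv)
      hs hr
  have h0 : (√(c (r, θ)) - √(hmF m r₀ r)) / r = 0 := by
    refine tendsto_nhds_unique (tendsto_const_nhds.congr' ?_) hlim
    filter_upwards [self_mem_nhdsWithin] with s hs using (hconst s hs).symm
  have hr' : 0 < r := hr₀.trans hr
  rw [div_eq_zero_iff, or_iff_left hr'.ne', sub_eq_zero] at h0
  exact (Real.sqrt_inj (D.pos_c (r, θ) hr).le (hmF_pos hr₀ hr).le).1 h0

/-- Rigidity: constant flux forces the background metric. -/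
theorem CoreData.eq_background (hr₀ : 0 < r₀) (K : CoreData r₀ c γ W Γ)
    (D : IsBlockData (outer r₀) a c γ) (ha : ∀ z : ℝ × ℝ, r₀ < z.1 → a z = 1 / hmF m r₀ z.1)
    (hR : ∀ p : Idx m → ℝ, r₀ < p (Sum.inl 0) →
      -((m + 2) * (m + 1)) ≤ scalarCurvature (blockG a c γ) p) {μ : ℝ}
    (hM : HasMass r₀ B (blockG a c γ) μ)
    (hF : ∀ r₁ r₂, r₀ < r₁ → r₀ < r₂ → flux r₀ c γ r₁ = flux r₀ c γ r₂) (z : ℝ × ℝ)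
    (hz : r₀ < z.1) :
    c z = hmF m r₀ z.1 ∧ γ z = Matrix.diagonal fun _ => z.1 ^ 2 := by
  have hQ := fun r θ (hr : r₀ < r) =>
    D.fluxLoss_nonneg_and hr₀ ha (fun z hz => K.posDef hz) hR (θ := θ) hr
  have hQ0 := fun r θ (hr : r₀ < r) => K.fluxLoss_eq_zero hr₀ D
    (fun r θ hr => (hQ r θ hr).1) hF (θ := θ) hr
  have hd := fun (r θ : ℝ) (hr : r₀ < r) (i j : Fin m) => K.torus_deriv hr₀
    (fun r θ hr hθ => (hQ r θ hr).2 (hQ0 r θ hr hθ)) θ hr i j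
  have hγ : ∀ z : ℝ × ℝ, r₀ < z.1 → γ z = Matrix.diagonal fun _ => z.1 ^ 2 := fun z hz =>
    hM.torus_eq_diagonal hr₀ D (D.torus_eq hr₀ hd) hz
  refine ⟨?_, hγ z hz⟩
  have hang : ∀ z ∈ outer r₀, angularTerm c γ z = 0 := by
    rintro ⟨r, θ⟩ hz
    simp [angularTerm, trH, halfLog, (hd r θ hz _ _).2]
  have htr : ∀ r θ, r₀ < r → trH (1, 0) γ (r, θ) = m / r := fun r θ hr => by
    simp only [trH, halfLog, (hd r θ hr _ _).1]
    have : ∀ i, ∑ k, (γ (r, θ))⁻¹ i k * (2 / r * γ (r, θ) k i / 2) =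
        1 / r * ∑ k, (γ (r, θ))⁻¹ i k * γ (r, θ) k i := fun i => by
      rw [Finset.mul_sum]
      exact Finset.sum_congr rfl fun k _ => by ring
    simp only [this, D.sum_inv_mul (z := (r, θ)) hr]
    simp
    ring
  -- Constancy of the flux becomes pointwise here: once the angular term vanishes identically, zero
  -- loss means ∂_r J = 0 for each θ, and the core limit gives the value.
  have hJ : ∀ θ ∈ Set.Icc 0 (anglePeriod m r₀), ∀ r, r₀ < r →
      fluxDensity r₀ c γ (r, θ) = (m + 2) * r₀ ^ (m + 2) := by
    intro θ hθ r hr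
    have hder : ∀ t ∈ Set.Ioi r₀, HasDerivAt (fun s => fluxDensity r₀ c γ (s, θ)) 0 t := by
      intro t ht
      have hz : ((t, θ) : ℝ × ℝ) ∈ outer r₀ := ht
      have h1 := hasDerivAt_slice_fst ((D.smooth_fluxDensity hr₀).differentiableAt_of_isOpen
        D.isOpen hz)
      have h2 := hQ0 t θ ht hθ
      have h3 : dirDeriv (0, 1) (angularTerm c γ) (t, θ) = 0 := by
        rw [dirDeriv_congr (k := fun _ => 0), dirDeriv_const]
        filter_upwards [D.isOpen.mem_nhds hz] with y hy using hang y hy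
      rw [fluxLoss, h3, mul_zero, add_zero, neg_eq_zero] at h2
      rwa [h2] at h1
    have hconst : ∀ s, r₀ < s → fluxDensity r₀ c γ (s, θ) = fluxDensity r₀ c γ (r, θ) :=
      fun s hs => isOpen_Ioi.is_const_of_deriv_eq_zero isPreconnected_Ioi
        (fun t ht => (hder t ht).differentiableAt.differentiableWithinAt)
        (fun t ht => (hder t ht).deriv) hs hr
    refine tendsto_nhds_unique (tendsto_const_nhds.congr' ?_) (K.tendsto_fluxDensity hr₀ θ)
    filter_upwards [self_mem_nhdsWithin] with s hs using (hconst s hs).symm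
  obtain ⟨r, θ⟩ := z
  have hp : Function.Periodic (fun θ => c (r, θ)) (anglePeriod m r₀) := fun θ => by
    have := K.period_c (z := (r, θ)) hz
    simpa using this
  obtain ⟨t, ht, e⟩ := hp.exists_mem_Ico₀ (anglePeriod_pos hr₀) θ
  rw [e]
  exact K.angle_eq_hmF hr₀ D (fun r hr => htr r t hr) (hJ t (Set.Ico_subset_Icc_self ht)) hz

end

end

/-! ### The positive mass theorem with rigidity. -/

theorem mainTheorem3 (m : ℕ) (r₀ : ℝ) (hr₀ : 0 < r₀)
    (B : Module.Basis (Fin m) ℝ (Fin m → ℝ))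
    (u v : ℝ → ℝ → ℝ) (γ : ℝ → ℝ → Matrix (Fin m) (Fin m) ℝ) (μ : ℝ)
    (hsmooth : IsSmoothMetric r₀ B (blockMetric u v γ))
    (hu : ∀ r θ, r₀ < r → u r θ = uHM m r₀ r)
    (hmass : HasMass r₀ B (blockMetric u v γ) μ)
    (hR : ∀ p : Idx m → ℝ, r₀ < p (Sum.inl 0) →
      -(((m + 2 : ℕ) : ℝ) * (((m + 2 : ℕ) : ℝ) - 1)) ≤ scalarCurvature (blockMetric u v γ) p) :
    0 ≤ μ ∧
      (μ = 0 ↔ ∀ p : Idx m → ℝ, r₀ < p (Sum.inl 0) → blockMetric u v γ p = hmMetric m r₀ p) := by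
  obtain ⟨W, Γ, K⟩ := exists_coreData hr₀ hsmooth hu
  set a : ℝ × ℝ → ℝ := fun z => Real.exp (2 * u z.1 z.2) with ha_def
  set c : ℝ × ℝ → ℝ := fun z => Real.exp (2 * v z.1 z.2) with hc_def
  set g : ℝ × ℝ → Matrix (Fin m) (Fin m) ℝ := fun z => γ z.1 z.2 with hg_def
  have hblock : blockMetric u v γ = blockG a c g := rfl
  have ha : ∀ z : ℝ × ℝ, r₀ < z.1 → a z = 1 / hmF m r₀ z.1 := fun z hz => by
    rw [ha_def]
    dsimp only
    rw [hu _ _ hz, exp_uHM hr₀ hz]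
  have D : IsBlockData (outer r₀) a c g := K.isBlockData hr₀ ha
  rw [hblock] at hmass hR ⊢
  have hR' : ∀ p : Idx m → ℝ, r₀ < p (Sum.inl 0) →
      -(((m : ℝ) + 2) * (m + 1)) ≤ scalarCurvature (blockG a c g) p := fun p hp => by
    have := hR p hp
    push_cast at this
    linarith
  have hQ := fun r θ (hr : r₀ < r) =>
    (D.fluxLoss_nonneg_and hr₀ ha (fun z hz => K.posDef hz) hR' (θ := θ) hr).1
  have hanti := K.flux_antitone hr₀ D hQ
  have hle : ∀ r, r₀ < r → flux r₀ c g r ≤ anglePeriod m r₀ * ((m + 2) * r₀ ^ (m + 2)) := by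
    intro r hr
    refine ge_of_tendsto (K.tendsto_flux hr₀) ?_
    filter_upwards [Ioo_mem_nhdsGT hr] with s hs using hanti hs.1 hr hs.2.le
  have hV := torusVolume_pos B
  -- The mass flux converges to μ along all radii, so closeness to the normalized flux at
  -- arbitrarily large radii is enough.
  have happrox : ∀ ε > 0, ∃ᶠ r in atTop, |torusVolume B *
      (anglePeriod m r₀ * ((m + 2) * r₀ ^ (m + 2)) - flux r₀ c g r) - μ| < ε := by
    intro ε hε
    have h1 := hmass.frequently_massFlux hr₀ D ha (half_pos hε)
    have h2 := hmass.tendsto.eventually (Metric.ball_mem_nhds μ (half_pos hε))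
    refine (h1.and_eventually h2).mono fun r hr => ?_
    have h3 : |massFlux r₀ B (blockG a c g) r - μ| < ε / 2 := hr.2
    have h4 := hr.1
    rw [abs_lt] at h3 h4 ⊢
    constructor <;> linarith
  refine ⟨?_, fun hμ => ?_, fun hb => ?_⟩
  · refine le_of_forall_pos_lt_add fun ε hε => ?_
    obtain ⟨r, h1, hr⟩ := ((happrox ε hε).and_eventually (eventually_gt_atTop r₀)).exists
    have := mul_nonneg hV.le (sub_nonneg.2 (hle r hr))
    rw [abs_lt] at h1
    linarith
  -- With μ = 0 the flux comes arbitrarily close to its core value at large radii; monotonicity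
  -- squeezes it at all smaller ones.
  · have hF : ∀ r, r₀ < r → flux r₀ c g r = anglePeriod m r₀ * ((m + 2) * r₀ ^ (m + 2)) := by
      intro r hr
      refine le_antisymm (hle r hr) ?_
      refine le_of_forall_pos_lt_add fun ε hε => ?_
      obtain ⟨s, h1, hs⟩ := ((happrox _ (mul_pos hV hε)).and_eventually
        (eventually_ge_atTop r)).exists
      rw [hμ, sub_zero] at h1
      have h2 := lt_of_mul_lt_mul_left (lt_of_abs_lt h1) hV.le
      have h3 := hanti (Set.mem_Ioi.2 hr) (Set.mem_Ioi.2 (hr.trans_le hs)) hs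
      linarith
    intro p hp
    have h := K.eq_background hr₀ D ha hR' hmass
      (fun r₁ r₂ h₁ h₂ => (hF r₁ h₁).trans (hF r₂ h₂).symm) (radAng m p) hp
    rw [hmMetric_eq_blockG, blockG, blockG, h.1, h.2, ha _ (show r₀ < (radAng m p).1 from hp)]
  · have hc : ∀ z : ℝ × ℝ, r₀ < z.1 → c z = hmF m r₀ z.1 := fun z hz => by
      have := congrFun (congrFun (hb (polarPoint z.1 z.2 0) hz) (Sum.inl 1)) (Sum.inl 1)
      simpa [hmMetric_eq_blockG, blockG, polarPoint, radAng_apply] using this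
    have hg : ∀ z : ℝ × ℝ, r₀ < z.1 → g z = Matrix.diagonal fun _ => z.1 ^ 2 := fun z hz => by
      ext i j
      have := congrFun (congrFun (hb (polarPoint z.1 z.2 0) hz) (Sum.inr i)) (Sum.inr j)
      simpa [hmMetric_eq_blockG, blockG, polarPoint, radAng_apply] using this
    -- For g = b the mass integrand vanishes identically, so the limit defining μ is zero.
    refine tendsto_nhds_unique hmass.tendsto (tendsto_const_nhds.congr' ?_)
    filter_upwards [eventually_gt_atTop r₀] with r hr
    rw [massFlux_eq hr₀ D ha hr]
    simp [massDensity_hm hr₀ hc hg hr]
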